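/- Let $p$ be an odd prime, $n\ge 0$ and $k$ integers, and let $\psi$ be a Dirichlet character modulo $p$, either the trivial one $\chi_0$ or the quadratic one $\chi_p$, with $\psi(-1)=(-1)^k$. **Notation.** Write $g=\begin{pmatrix}A_g&B_g\\C_g&D_g\end{pmatrix}$ in $n\times n$ blocks. Let $\mathfrak H_n$ be the Siegel upper half space, $Z=X+\sqrt{-1}\,Y\in\mathfrak H_n$; for a real symplectic similitude $g$ with factor $\mu(g)>0$ put $g\langle Z\rangle=(A_gZ+B_g)(C_gZ+D_g)^{-1}$, $j(g,Z)=\mu(g)^{-n/2}\det(C_gZ+D_g)$ and $(f|_kg)(Z)=j(g,Z)^{-k}f(g\langle Z\rangle)$. Let $P=\{g\in \mathrm{Sp}(n,\mathbb Z): C_g=0\}$, $\Gamma=\Gamma_0^n(p)=\{g\in \mathrm{Sp}(n,\mathbb Z): C_g\equiv 0 \bmod p\}$, $\tau_p=\mathrm{diag}(1_n,p1_n)$, and for $0\le r\le n$ $$w_r=\begin{pmatrix}0_r&&-1_r&\\&1_{n-r}&&0_{n-r}\\1_r&&0_r&\\&0_{n-r}&&1_{n-r}\end{pmatrix}.$$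 On $P w_r\Gamma$ put $\psi^*(\eta w_r\kappa)=\psi(\det D_\eta)\psi(\det D_\kappa)$ for $\eta\in P$, $\kappa\in\Gamma$. For $2\,\mathrm{Re}(s)>n+1$, where the series converges absolutely, let $$E^n_{k,\psi}(w_r;Z,s)=\det(Y)^{s-k/2}\sum_{\gamma\in P\backslash Pw_r\Gamma}\psi^*(\gamma)\,j(\gamma,Z)^{-k}\,|j(\gamma,Z)|^{-2s+k};$$ for other $s$ it is understood by meromorphic continuation in $s$. The operator $U(p)$ is $$(U(p)f)(Z)=p^{nk/2-n(n+1)/2}\sum_{\gamma\in\Gamma\backslash\Gamma\tau_p\Gamma}\psi(\det A_\gamma)\,(f|_k\gamma)(Z).$$ For $0\le i\le j\le n$ let $$m_{\chi_0}(s)_{ij}=\begin{cases}p^{2si-\frac{j(j+1)}2+\frac{(j-i)(j-i+2)}4}\ \dfrac{\prod_{r=i+1}^{j}(p^r-1)}{\prod_{r=1}^{(j-i)/2}(p^{2r}-1)}&j-i\text{ even},\\[3ex] p^{2si-\frac{j(j+1)}2+\frac{(j-i)^2-1}4}\ \dfrac{\prod_{r=i+1}^{j}(p^r-1)}{\prod_{r=1}^{(j-i-1)/2}(p^{2r}-1)}&j-i\text{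 odd},\end{cases}$$ $$m_{\chi_p}(s)_{ij}=\chi_p(-1)^{(j-i)/2}\,p^{2si-\frac{j(j+1)}2+\frac{(j-i)^2}4}\ \dfrac{\prod_{r=i+1}^{j}(p^r-1)}{\prod_{r=1}^{(j-i)/2}(p^{2r}-1)}\quad(j-i\text{ even}),$$ with $m_{\chi_0}(s)_{ij}=0$ for $i>j$, and $m_{\chi_p}(s)_{ij}=0$ if $i>j$ or $j-i$ is odd. **Theorem.** For every $0\le i\le n$ and $Z\in\mathfrak H_n$: 1. If $\psi=\chi_0$, then $$U(p)E^n_{k,\chi_0}(w_i;Z,s)=p^{n(k/2-s)}\sum_{j=i}^{n}m_{\chi_0}(s)_{ij}\,E^n_{k,\chi_0}(w_j;Z,s).$$ 2. If $\psi=\chi_p$, then $$U(p)E^n_{k,\chi_p}(w_i;Z,s)=p^{n(k/2-s)}\sum_{\substack{i\le j\le n\\ j\equiv i\bmod 2}}m_{\chi_p}(s)_{ij}\,E^n_{k,\chi_p}(w_j;Z,s).$$ Both identities hold for every $s$ with $2\,\mathrm{Re}(s)>n+1$. For any meromorphic continuations in $s\in\mathbb C$ of the functions $E^n_{k,\psi}(w_j;Z,s)$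 ($0\le j\le n$, $Z\in\mathfrak H_n$), they hold as identities of meromorphic functions of $s$ (that is, off a discrete closed set of $s$ for each $Z$), and at every $s$ at which all these continuations are holomorphic. -/

import Mathlib

open Matrix

/-- `2n × 2n` matrices, written in `n × n` blocks `A = toBlocks₁₁`, `B = toBlocks₁₂`,
`C = toBlocks₂₁`, `D = toBlocks₂₂`. -/
abbrev BlockMatrix (n : ℕ) (R : Type*) : Type _ :=
  Matrix (Fin n ⊕ Fin n) (Fin n ⊕ Fin n) R

/-- The Siegel upper half space of degree `n`: symmetric complex matrices with positive definite
imaginary part. -/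
def siegelUpperHalfSpace (n : ℕ) : Set (Matrix (Fin n) (Fin n) ℂ) :=
  {Z | Zᵀ = Z ∧ (Z.map Complex.im).PosDef}

/-- A block of a real matrix, viewed as a complex matrix. -/
def toComplexMatrix {n : ℕ} (M : Matrix (Fin n) (Fin n) ℝ) : Matrix (Fin n) (Fin n) ℂ :=
  M.map Complex.ofReal

/-- An integral `2n × 2n` matrix viewed as a real one. -/
def toRealBlock {n : ℕ} (g : BlockMatrix n ℤ) : BlockMatrix n ℝ :=
  g.map (Int.cast : ℤ → ℝ)

/-- The similitude factor `μ(g)` of a symplectic similitude: `ᵗg J g = μ(g) J`. -/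
noncomputable def similitude {n : ℕ} (g : BlockMatrix n ℝ) : ℝ :=
  Classical.epsilon fun μ : ℝ => gᵀ * J (Fin n) ℝ * g = μ • J (Fin n) ℝ

/-- The action `g⟨Z⟩ = (AZ + B)(CZ + D)⁻¹`. -/
noncomputable def siegelAction {n : ℕ} (g : BlockMatrix n ℝ) (Z : Matrix (Fin n) (Fin n) ℂ) :
    Matrix (Fin n) (Fin n) ℂ :=
  (toComplexMatrix g.toBlocks₁₁ * Z + toComplexMatrix g.toBlocks₁₂) *
    (toComplexMatrix g.toBlocks₂₁ * Z + toComplexMatrix g.toBlocks₂₂)⁻¹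

/-- The automorphy factor `j(g, Z) = μ(g)^(-n/2) det(CZ + D)`. -/
noncomputable def autFactor {n : ℕ} (g : BlockMatrix n ℝ) (Z : Matrix (Fin n) (Fin n) ℂ) : ℂ :=
  ((similitude g ^ (-(n : ℝ) / 2) : ℝ) : ℂ) *
    (toComplexMatrix g.toBlocks₂₁ * Z + toComplexMatrix g.toBlocks₂₂).det

/-- The slash operator `(f|_k g)(Z) = j(g, Z)^(-k) f(g⟨Z⟩)`. -/
noncomputable def siegelSlash {n : ℕ} (k : ℤ) (f : Matrix (Fin n) (Fin n) ℂ → ℂ)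
    (g : BlockMatrix n ℝ) (Z : Matrix (Fin n) (Fin n) ℂ) : ℂ :=
  autFactor g Z ^ (-k) * f (siegelAction g Z)

/-- The subgroup of `Sp(n, ℤ)` of matrices whose lower left block is divisible by `N`. -/
def lowerLeftSubgroup (n : ℕ) (N : ℤ) : Subgroup (symplecticGroup (Fin n) ℤ) where
  carrier := {g | ∀ i j, N ∣ (g : BlockMatrix n ℤ).toBlocks₂₁ i j}
  mul_mem' := by
    intro a b ha hb i j
    change N ∣ ((a : BlockMatrix n ℤ) * (b : BlockMatrix n ℤ)) (Sum.inr i) (Sum.inl j)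
    rw [Matrix.mul_apply, Fintype.sum_sum_type]
    refine dvd_add (Finset.dvd_sum fun x _ => ?_) (Finset.dvd_sum fun x _ => ?_)
    · exact Dvd.dvd.mul_right (ha i x) _
    · exact Dvd.dvd.mul_left (hb x j) _
  one_mem' := by
    intro i j
    change N ∣ (1 : BlockMatrix n ℤ) (Sum.inr i) (Sum.inl j)
    simp
  inv_mem' := by
    intro a ha i j
    change N ∣ (-J (Fin n) ℤ * (a : BlockMatrix n ℤ)ᵀ * J (Fin n) ℤ) (Sum.inr i) (Sum.inl j)
    have h := ha j i
    rw [← Matrix.fromBlocks_toBlocks (a : BlockMatrix n ℤ)]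
    simp only [J, Matrix.fromBlocks_transpose, Matrix.fromBlocks_neg, Matrix.fromBlocks_multiply,
      Matrix.fromBlocks_apply₂₁]
    simpa using h

/-- `Γ₀ⁿ(p)`: elements of `Sp(n, ℤ)` with `C ≡ 0 mod p`. -/
def siegelGamma0 (n p : ℕ) : Subgroup (symplecticGroup (Fin n) ℤ) :=
  lowerLeftSubgroup n (p : ℤ)

/-- The Siegel parabolic `P_{0,n}(ℤ)`: elements of `Sp(n, ℤ)` with `C = 0`. -/
def siegelParabolic (n : ℕ) : Subgroup (symplecticGroup (Fin n) ℤ) :=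
  lowerLeftSubgroup n 0

/-- The matrix `w_r`: the block `J` on the first `r` coordinates and the identity on the remaining
`n - r` ones. -/
def cuspMatrix (n r : ℕ) : BlockMatrix n ℤ :=
  Matrix.fromBlocks
    (Matrix.diagonal fun i : Fin n => if i.val < r then 0 else 1)
    (Matrix.diagonal fun i : Fin n => if i.val < r then -1 else 0)
    (Matrix.diagonal fun i : Fin n => if i.val < r then 1 else 0)
    (Matrix.diagonal fun i : Fin n => if i.val < r then 0 else 1)

/-- `w_r` as an element of `Sp(n, ℤ)`. -/
def cuspElement (n r : ℕ) : symplecticGroup (Fin n) ℤ :=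
  ⟨cuspMatrix n r, by
    rw [SymplecticGroup.mem_iff, cuspMatrix, J, Matrix.fromBlocks_transpose,
      Matrix.fromBlocks_multiply, Matrix.fromBlocks_multiply, Matrix.fromBlocks_inj]
    refine ⟨?_, ?_, ?_, ?_⟩ <;>
      · ext i j
        by_cases hij : i = j
        · subst hij
          by_cases hi : i.val < r <;> simp [hi]
        · simp [hij]⟩

/-- The double coset `P_{0,n}(ℤ) w_r Γ₀ⁿ(p)`. -/
def cuspDoubleCoset (n p r : ℕ) : Set (symplecticGroup (Fin n) ℤ) :=
  DoubleCoset.doubleCoset (cuspElement n r) (siegelParabolic n) (siegelGamma0 n p)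

/-- The set `P_{0,n}(ℤ) \ P_{0,n}(ℤ) w_r Γ₀ⁿ(p)`. -/
abbrev CuspCosets (n p r : ℕ) : Type :=
  Quotient (Setoid.comap (Subtype.val : cuspDoubleCoset n p r → symplecticGroup (Fin n) ℤ)
    (MulAction.orbitRel (siegelParabolic n) (symplecticGroup (Fin n) ℤ)))

/-- The value of a Dirichlet character at the determinant of the lower right block. -/
noncomputable def charDetD {n p : ℕ} (ψ : DirichletCharacter ℂ p)
    (g : symplecticGroup (Fin n) ℤ) : ℂ :=
  ψ (((g : BlockMatrix n ℤ).toBlocks₂₂.det : ℤ) : ZMod p)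

open Classical in
/-- `ψ*(γ) = ψ(det D_η) ψ(det D_κ)` for `γ = η w_r κ` with `η ∈ P_{0,n}(ℤ)`, `κ ∈ Γ₀ⁿ(p)`.
When `ψ` takes values in `{0, 1, -1}` this does not depend on the decomposition. -/
noncomputable def psiStar {n p : ℕ} (ψ : DirichletCharacter ℂ p) (r : ℕ)
    (γ : symplecticGroup (Fin n) ℤ) : ℂ :=
  if h : ∃ x : siegelParabolic n × siegelGamma0 n p,
      γ = (x.1 : symplecticGroup (Fin n) ℤ) * cuspElement n r * (x.2 : symplecticGroup (Fin n) ℤ)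
  then charDetD ψ (h.choose.1 : symplecticGroup (Fin n) ℤ) *
    charDetD ψ (h.choose.2 : symplecticGroup (Fin n) ℤ)
  else 0

/-- The series `E^n_{k,ψ}(w_r; Z, s)`, which converges absolutely for `2 Re s > n + 1`.
When `ψ(-1) = (-1)^k` and `ψ` is trivial or quadratic, the summand depends only on the coset. -/
noncomputable def siegelEisenstein (n : ℕ) {p : ℕ} (ψ : DirichletCharacter ℂ p) (k : ℤ) (r : ℕ)
    (Z : Matrix (Fin n) (Fin n) ℂ) (s : ℂ) : ℂ :=
  (((Z.map Complex.im).det : ℝ) : ℂ) ^ (s - (k : ℂ) / 2) *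
    ∑' c : CuspCosets n p r,
      psiStar ψ r c.out.val * autFactor (toRealBlock (c.out.val : BlockMatrix n ℤ)) Z ^ (-k) *
        ((‖autFactor (toRealBlock (c.out.val : BlockMatrix n ℤ)) Z‖ : ℝ) : ℂ) ^ (-2 * s + (k : ℂ))

/-- `τ_p = diag(1_n, p 1_n)`. -/
def heckeTau (n p : ℕ) : BlockMatrix n ℤ :=
  Matrix.fromBlocks 1 0 0 ((p : ℤ) • (1 : Matrix (Fin n) (Fin n) ℤ))

/-- `Γ₀ⁿ(p)` as a set of integral matrices. -/
def siegelGamma0Matrices (n p : ℕ) : Set (BlockMatrix n ℤ) :=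
  (fun g : symplecticGroup (Fin n) ℤ => (g : BlockMatrix n ℤ)) '' (siegelGamma0 n p)

/-- The double coset `Γ₀ⁿ(p) τ_p Γ₀ⁿ(p)`. -/
def heckeDoubleCoset (n p : ℕ) : Set (BlockMatrix n ℤ) :=
  DoubleCoset.doubleCoset (heckeTau n p) (siegelGamma0Matrices n p) (siegelGamma0Matrices n p)

/-- The (finite) set `Γ₀ⁿ(p) \ Γ₀ⁿ(p) τ_p Γ₀ⁿ(p)`. -/
abbrev HeckeCosets (n p : ℕ) : Type :=
  Quotient (Setoid.comap (Subtype.val : heckeDoubleCoset n p → BlockMatrix n ℤ)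
    (MulAction.orbitRel (siegelGamma0 n p) (BlockMatrix n ℤ)))

/-- The operator `U(p)` in weight `k` with character `ψ`:
`(U(p) f)(Z) = p^(nk/2 - n(n+1)/2) ∑_γ ψ(det A_γ) (f|_k γ)(Z)`, with `γ` running over
`Γ₀ⁿ(p) \ Γ₀ⁿ(p) τ_p Γ₀ⁿ(p)`. If `f|_k δ = ψ(det D_δ) f` for all `δ ∈ Γ₀ⁿ(p)`, the summand depends
only on the coset of `γ`. -/
noncomputable def heckeU (n : ℕ) {p : ℕ} (ψ : DirichletCharacter ℂ p) (k : ℤ)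
    (f : Matrix (Fin n) (Fin n) ℂ → ℂ) (Z : Matrix (Fin n) (Fin n) ℂ) : ℂ :=
  (((p : ℝ) ^ ((n : ℝ) * (k : ℝ) / 2 - (n : ℝ) * ((n : ℝ) + 1) / 2) : ℝ) : ℂ) *
    ∑ᶠ c : HeckeCosets n p,
      ψ (((c.out.val).toBlocks₁₁.det : ℤ) : ZMod p) *
        siegelSlash k f (toRealBlock c.out.val) Z

/-- The quadratic character modulo an odd prime `p`, with complex values. -/
noncomputable def quadraticDirichletCharacter (p : ℕ) [Fact p.Prime] : DirichletCharacter ℂ p :=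
  (quadraticChar (ZMod p)).ringHomComp (Int.castRingHom ℂ)

/-- The coefficients `m_{χ₀}(s)_{ij}`. -/
noncomputable def mTrivial (p : ℕ) (s : ℂ) (i j : ℕ) : ℂ :=
  if j < i then 0
  else if Even (j - i) then
    (p : ℂ) ^ (2 * s * (i : ℂ) - (j : ℂ) * ((j : ℂ) + 1) / 2
        + ((j : ℂ) - (i : ℂ)) * ((j : ℂ) - (i : ℂ) + 2) / 4) *
      ((∏ r ∈ Finset.Icc (i + 1) j, ((p : ℂ) ^ r - 1)) /
        ∏ r ∈ Finset.Icc 1 ((j - i) / 2), ((p : ℂ) ^ (2 * r) - 1))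
  else
    (p : ℂ) ^ (2 * s * (i : ℂ) - (j : ℂ) * ((j : ℂ) + 1) / 2
        + (((j : ℂ) - (i : ℂ)) ^ 2 - 1) / 4) *
      ((∏ r ∈ Finset.Icc (i + 1) j, ((p : ℂ) ^ r - 1)) /
        ∏ r ∈ Finset.Icc 1 ((j - i - 1) / 2), ((p : ℂ) ^ (2 * r) - 1))

/-- The coefficients `m_{χ_p}(s)_{ij}`. -/
noncomputable def mQuadratic (p : ℕ) [Fact p.Prime] (s : ℂ) (i j : ℕ) : ℂ :=
  if i ≤ j ∧ Even (j - i) then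
    quadraticDirichletCharacter p (-1) ^ ((j - i) / 2) *
      (p : ℂ) ^ (2 * s * (i : ℂ) - (j : ℂ) * ((j : ℂ) + 1) / 2
        + ((j : ℂ) - (i : ℂ)) ^ 2 / 4) *
      ((∏ r ∈ Finset.Icc (i + 1) j, ((p : ℂ) ^ r - 1)) /
        ∏ r ∈ Finset.Icc 1 ((j - i) / 2), ((p : ℂ) ^ (2 * r) - 1))
  else 0

/-- `F j` is, for each `j ≤ n` and each `Z` in the Siegel upper half space, a meromorphic
continuation to `ℂ` of `s ↦ E^n_{k,ψ}(w_j; Z, s)`, given by its series for `2 Re s > n + 1`. -/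
def IsEisensteinContinuation (n : ℕ) {p : ℕ} (ψ : DirichletCharacter ℂ p) (k : ℤ)
    (F : ℕ → Matrix (Fin n) (Fin n) ℂ → ℂ → ℂ) : Prop :=
  ∀ j ≤ n, ∀ Z ∈ siegelUpperHalfSpace n,
    Meromorphic (F j Z) ∧
      ∀ s : ℂ, (n : ℝ) + 1 < 2 * s.re → F j Z s = siegelEisenstein n ψ k j Z s

/-! Unfolding. Since ψ* vanishes off P w_r Γ, the series E(w_r) is a sum over all of P\Sp(n, ℤ)
(`siegelEisenstein_eq`). The group Sp(n, ℤ) is the disjoint union of the double cosets P w_r Γ, 0 ≤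
r ≤ n, where r is the rank of C modulo p (`exists_cusp_decomposition`, `rank_of_mem_doubleCoset`).
The cosets in U(p) are represented by (1, S; 0, p) with S symmetric modulo p
(`exists_heckeCosets_equiv`).

Transfer. Fix S. For γ' in Sp(n, ℤ) write γ'(p, -S; 0, 1) = Hγ with γ in Sp(n, ℤ) and H block upper
triangular. Then γ' ↦ γ permutes P\Sp(n, ℤ) (`exists_heckePerm`), and Hγ(1, S; 0, p) = pγ', so the
translated summand at γ is an explicit multiple of the summand at γ'. After reindexing by γ', the
sum over S only has to collect the values ψ*(γ) (`sum_eisensteinSummand_transfer`).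

Local computation. If γ' = η w_j κ, then κ merely permutes the matrices S modulo p
(`gamma0_mul_heckeAdjoint`, `symmetricAction_bijective`), so w_j(p, -S; 0, 1) is what matters.
Diagonalizing the leading j × j block of S modulo p by SL_j(ℤ) reduces it to 2 × 2 matrices
(`exists_local_factor`): a zero entry keeps its Weyl factor and puts a p into H, and a nonzero entry
d removes the Weyl factor and contributes ψ(-d). Hence γ lies in P w_r Γ with r the corank of the
block, and the lower right block of H has determinant p^r (`exists_triangular_factor`).

Counting. Up to powers of p, the coefficient of E(w_j) in U(p)E(w_i) is therefore the sum of ∏ψ(-d)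
over the symmetric j × j matrices modulo p of rank j - i, the product being over the nonzero entries
of a diagonal form. The polynomial generating these sums by rank obeys a recursion got by adding one
row and column (`sum_bordered`). In it ψ occurs only through ψ(-1) and ∑ψ, and the latter is p - 1
or 0. The recursion has the closed solutions `weightPolynomial_coeff_trivial` and
`weightPolynomial_coeff_quadratic`.

Analysis. No convergence estimate is made. For Re s ≥ 0, convergence of one of the series at one
point forces absolute convergence of all of them at all points (`summable_autTerm`); failing that,
every infinite sum is 0 by convention and the identity is trivial. The continued identities follow
from the identity theorem (`heckeU_continuation`). -/

set_option linter.unusedSimpArgs false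
set_option linter.unusedSectionVars false

/-! ### Block matrices and elements of `Sp(n, ℤ)` -/

section Blocks

variable {n : ℕ} {R : Type*}

theorem toBlocks₁₁_mul [CommRing R] (M N : BlockMatrix n R) :
    (M * N).toBlocks₁₁ = M.toBlocks₁₁ * N.toBlocks₁₁ + M.toBlocks₁₂ * N.toBlocks₂₁ := by
  conv_lhs => rw [← fromBlocks_toBlocks M, ← fromBlocks_toBlocks N, fromBlocks_multiply]
  simp

theorem toBlocks₁₂_mul [CommRing R] (M N : BlockMatrix n R) :
    (M * N).toBlocks₁₂ = M.toBlocks₁₁ * N.toBlocks₁₂ + M.toBlocks₁₂ * N.toBlocks₂₂ := by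
  conv_lhs => rw [← fromBlocks_toBlocks M, ← fromBlocks_toBlocks N, fromBlocks_multiply]
  simp

theorem toBlocks₂₁_mul [CommRing R] (M N : BlockMatrix n R) :
    (M * N).toBlocks₂₁ = M.toBlocks₂₁ * N.toBlocks₁₁ + M.toBlocks₂₂ * N.toBlocks₂₁ := by
  conv_lhs => rw [← fromBlocks_toBlocks M, ← fromBlocks_toBlocks N, fromBlocks_multiply]
  simp

theorem toBlocks₂₂_mul [CommRing R] (M N : BlockMatrix n R) :
    (M * N).toBlocks₂₂ = M.toBlocks₂₁ * N.toBlocks₁₂ + M.toBlocks₂₂ * N.toBlocks₂₂ := by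
  conv_lhs => rw [← fromBlocks_toBlocks M, ← fromBlocks_toBlocks N, fromBlocks_multiply]
  simp

theorem blockMatrix_ext {M N : BlockMatrix n R} (h₁ : M.toBlocks₁₁ = N.toBlocks₁₁)
    (h₂ : M.toBlocks₁₂ = N.toBlocks₁₂) (h₃ : M.toBlocks₂₁ = N.toBlocks₂₁)
    (h₄ : M.toBlocks₂₂ = N.toBlocks₂₂) : M = N := by
  rw [← fromBlocks_toBlocks M, ← fromBlocks_toBlocks N, h₁, h₂, h₃, h₄]

/-- Reduction of an integral matrix modulo `p`. -/
def matrixMod (p : ℕ) {m : Type*} [Fintype m] [DecidableEq m] :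
    Matrix m m ℤ →+* Matrix m m (ZMod p) :=
  (Int.castRingHom (ZMod p)).mapMatrix

theorem matrixMod_apply (p : ℕ) {m : Type*} [Fintype m] [DecidableEq m] (M : Matrix m m ℤ)
    (i j : m) : matrixMod p M i j = (M i j : ZMod p) := rfl

theorem matrixMod_transpose (p : ℕ) {m : Type*} [Fintype m] [DecidableEq m] (M : Matrix m m ℤ) :
    matrixMod p Mᵀ = (matrixMod p M)ᵀ := rfl

theorem matrixMod_det (p : ℕ) {m : Type*} [Fintype m] [DecidableEq m] (M : Matrix m m ℤ) :
    (matrixMod p M).det = (M.det : ZMod p) :=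
  ((Int.castRingHom (ZMod p)).map_det M).symm

theorem matrixMod_diagonal (p : ℕ) {m : Type*} [Fintype m] [DecidableEq m] (d : m → ℤ) :
    matrixMod p (diagonal d) = diagonal fun i => (d i : ZMod p) := by
  ext i j
  by_cases h : i = j
  · subst h; simp [matrixMod_apply]
  · simp [matrixMod_apply, h]

theorem matrixMod_eq_iff (p : ℕ) {m : Type*} [Fintype m] [DecidableEq m] (M N : Matrix m m ℤ) :
    matrixMod p M = matrixMod p N ↔ ∃ X : Matrix m m ℤ, M = N + (p : ℤ) • X := by
  constructor
  · intro h
    have h' : ∀ i j, ∃ x : ℤ, M i j = N i j + p * x := fun i j => by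
      have := congrFun (congrFun h i) j
      rw [matrixMod_apply, matrixMod_apply, eq_comm, ZMod.intCast_eq_intCast_iff_dvd_sub] at this
      obtain ⟨x, hx⟩ := this
      exact ⟨x, by linarith⟩
    choose X hX using h'
    refine ⟨of X, ?_⟩
    ext i j
    rw [Matrix.add_apply, Matrix.smul_apply, hX, of_apply, smul_eq_mul]
  · rintro ⟨X, rfl⟩
    ext i j
    rw [matrixMod_apply, Matrix.add_apply, Matrix.smul_apply, smul_eq_mul]
    simp [matrixMod_apply]

theorem matrixMod_eq_zero_iff (p : ℕ) {m : Type*} [Fintype m] [DecidableEq m] (M : Matrix m m ℤ) :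
    matrixMod p M = 0 ↔ ∀ i j, (p : ℤ) ∣ M i j := by
  constructor
  · intro h i j
    rw [← ZMod.intCast_zmod_eq_zero_iff_dvd]
    exact congrFun (congrFun h i) j
  · intro h
    ext i j
    exact (ZMod.intCast_zmod_eq_zero_iff_dvd _ _).2 (h i j)

/-- The lift of a matrix over `ℤ/p` with entries in `{0, …, p - 1}`. -/
def matrixLift {p : ℕ} {m : Type*} (M : Matrix m m (ZMod p)) : Matrix m m ℤ :=
  M.map fun x => (x.val : ℤ)

theorem matrixMod_matrixLift {p : ℕ} [NeZero p] {m : Type*} [Fintype m] [DecidableEq m]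
    (M : Matrix m m (ZMod p)) : matrixMod p (matrixLift M) = M := by
  ext i j
  simp [matrixMod_apply, matrixLift]

theorem matrixLift_transpose {p : ℕ} {m : Type*} {M : Matrix m m (ZMod p)} (h : Mᵀ = M) :
    (matrixLift M)ᵀ = matrixLift M := by
  rw [matrixLift, ← transpose_map, h]

theorem transpose_mul_eq_of_mem_symplectic [CommRing R] {g : BlockMatrix n R}
    (hg : g ∈ symplecticGroup (Fin n) R) :
    g.toBlocks₁₁ᵀ * g.toBlocks₂₁ = g.toBlocks₂₁ᵀ * g.toBlocks₁₁ ∧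
      g.toBlocks₁₂ᵀ * g.toBlocks₂₂ = g.toBlocks₂₂ᵀ * g.toBlocks₁₂ ∧
      g.toBlocks₁₁ᵀ * g.toBlocks₂₂ - g.toBlocks₂₁ᵀ * g.toBlocks₁₂ = 1 := by
  rw [← fromBlocks_toBlocks g] at hg
  exact SymplecticGroup.fromBlocks_mem_iff.1 hg

theorem mul_transpose_eq_of_mem_symplectic [CommRing R] {g : BlockMatrix n R}
    (hg : g ∈ symplecticGroup (Fin n) R) :
    g.toBlocks₁₁ * g.toBlocks₁₂ᵀ = g.toBlocks₁₂ * g.toBlocks₁₁ᵀ ∧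
      g.toBlocks₂₁ * g.toBlocks₂₂ᵀ = g.toBlocks₂₂ * g.toBlocks₂₁ᵀ ∧
      g.toBlocks₁₁ * g.toBlocks₂₂ᵀ - g.toBlocks₁₂ * g.toBlocks₂₁ᵀ = 1 := by
  have h := SymplecticGroup.transpose_mem hg
  rw [← fromBlocks_toBlocks g, fromBlocks_transpose] at h
  simpa using SymplecticGroup.fromBlocks_mem_iff.1 h

theorem mem_siegelGamma0 {p : ℕ} {g : symplecticGroup (Fin n) ℤ} :
    g ∈ siegelGamma0 n p ↔ matrixMod p (g : BlockMatrix n ℤ).toBlocks₂₁ = 0 :=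
  (matrixMod_eq_zero_iff p _).symm

theorem mem_siegelParabolic {g : symplecticGroup (Fin n) ℤ} :
    g ∈ siegelParabolic n ↔ (g : BlockMatrix n ℤ).toBlocks₂₁ = 0 := by
  constructor
  · intro h
    ext i j
    exact zero_dvd_iff.1 (h i j)
  · intro h i j
    rw [h]
    simp

/-- The unipotent element with upper right block `S`. -/
def unipotentElement (S : Matrix (Fin n) (Fin n) ℤ) (hS : Sᵀ = S) : symplecticGroup (Fin n) ℤ :=
  ⟨fromBlocks 1 S 0 1, SymplecticGroup.fromBlocks_mem_iff.2 (by simp [hS])⟩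

/-- The block diagonal element with blocks `A` and `D`. -/
def leviElement (A D : Matrix (Fin n) (Fin n) ℤ) (h : Aᵀ * D = 1) : symplecticGroup (Fin n) ℤ :=
  ⟨fromBlocks A 0 0 D, SymplecticGroup.fromBlocks_mem_iff.2 (by simp [h])⟩

/-- The element of `Sp(n, ℤ)` built from `n` elements of `SL(2, ℤ)`. -/
def diagonalElement (a b c d : Fin n → ℤ) (h : ∀ i, a i * d i - c i * b i = 1) :
    symplecticGroup (Fin n) ℤ :=
  ⟨fromBlocks (diagonal a) (diagonal b) (diagonal c) (diagonal d),
    SymplecticGroup.fromBlocks_mem_iff.2 (by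
      refine ⟨by simp [mul_comm], by simp [mul_comm], ?_⟩
      simp only [diagonal_transpose, diagonal_mul_diagonal, diagonal_sub]
      rw [← diagonal_one]
      congr 1
      ext i
      exact h i)⟩

/-- The Weyl group element which is `J` on the coordinates in `E` and the identity elsewhere. -/
def weylElement (E : Finset (Fin n)) : symplecticGroup (Fin n) ℤ :=
  diagonalElement (fun i => if i ∈ E then 0 else 1) (fun i => if i ∈ E then -1 else 0)
    (fun i => if i ∈ E then 1 else 0) (fun i => if i ∈ E then 0 else 1)
    (fun i => by by_cases h : i ∈ E <;> simp [h])

theorem cuspElement_eq_weylElement (r : ℕ) :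
    cuspElement n r = weylElement (Finset.univ.filter fun i : Fin n => i.val < r) := by
  apply Subtype.ext
  simp [cuspElement, cuspMatrix, weylElement, diagonalElement]

theorem coe_inv_eq_fromBlocks (g : symplecticGroup (Fin n) ℤ) :
    ((g⁻¹ : symplecticGroup (Fin n) ℤ) : BlockMatrix n ℤ) =
      fromBlocks (g : BlockMatrix n ℤ).toBlocks₂₂ᵀ (-(g : BlockMatrix n ℤ).toBlocks₁₂ᵀ)
        (-(g : BlockMatrix n ℤ).toBlocks₂₁ᵀ) (g : BlockMatrix n ℤ).toBlocks₁₁ᵀ := by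
  rw [SymplecticGroup.coe_inv]
  conv_lhs => rw [← fromBlocks_toBlocks (g : BlockMatrix n ℤ)]
  simp [J, fromBlocks_transpose, fromBlocks_neg, fromBlocks_multiply]

/-- The conjugating element is a permutation matrix in the Levi subgroup. It lies in P and in every
Γ₀(p), so the double coset of a Weyl element depends only on the size of E. -/
theorem exists_perm_weylElement (E : Finset (Fin n)) :
    ∃ m ∈ siegelParabolic n, (∀ p, m ∈ siegelGamma0 n p) ∧
      weylElement E = m * cuspElement n E.card * m⁻¹ := by
  classical
  have hE : E.card ≤ n := by simpa using E.card_le_univ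
  have hcard : Fintype.card {i : Fin n // i.val < E.card} = Fintype.card {i : Fin n // i ∈ E} := by
    rw [Fintype.card_subtype, Fintype.card_coe, Fin.card_filter_val_lt, min_eq_right hE]
  let e := Fintype.equivOfCardEq hcard
  let σ : Equiv.Perm (Fin n) := e.extendSubtype
  have hσ : ∀ i, σ i ∈ E ↔ i.val < E.card := by
    intro i
    constructor
    · intro h
      by_contra h'
      exact e.extendSubtype_not_mem i h' h
    · exact fun h => e.extendSubtype_mem i h
  let P : Matrix (Fin n) (Fin n) ℤ := of fun i j => if i = σ j then 1 else 0
  have hP : Pᵀ * P = 1 := by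
    ext i j
    simp [P, mul_apply, one_apply, eq_comm]
  let m := leviElement P P hP
  have key : ∀ a b : ℤ, (diagonal fun i : Fin n => if i ∈ E then a else b) * P =
      P * diagonal fun i : Fin n => if i.val < E.card then a else b := by
    intro a b
    ext i j
    rw [diagonal_mul, mul_diagonal]
    by_cases h : i = σ j
    · subst h; simp [P, hσ]
    · simp [P, h]
  have h21 : (m : BlockMatrix n ℤ).toBlocks₂₁ = 0 := by simp [m, leviElement]
  refine ⟨m, mem_siegelParabolic.2 h21, fun p => mem_siegelGamma0.2 (by rw [h21, map_zero]), ?_⟩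
  rw [eq_mul_inv_iff_mul_eq]
  apply Subtype.ext
  change fromBlocks _ _ _ _ * fromBlocks P 0 0 P = fromBlocks P 0 0 P * cuspMatrix n E.card
  rw [cuspMatrix, fromBlocks_multiply, fromBlocks_multiply]
  simp only [Matrix.mul_zero, Matrix.zero_mul, add_zero, zero_add, key]

end Blocks

/-! ### The decomposition of `Sp(n, ℤ)` into the double cosets `P w_r Γ₀(p)` -/

section Decomposition

variable {n p : ℕ} [Fact p.Prime]

/-- Row operations have to come from the Levi subgroup of P, hence from matrices invertible over ℤ.
Products of transvections lift to such matrices; diagonal matrices modulo p in general do not. -/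
theorem exists_lift_transvection_prod (L : List (TransvectionStruct (Fin n) (ZMod p))) :
    ∃ U U' : Matrix (Fin n) (Fin n) ℤ, U * U' = 1 ∧ U.det = 1 ∧
      matrixMod p U = (L.map TransvectionStruct.toMatrix).prod := by
  induction L with
  | nil => exact ⟨1, 1, by simp, by simp, by simp⟩
  | cons t L ih =>
    obtain ⟨U, U', h₁, h₂, h₃⟩ := ih
    refine ⟨transvection t.i t.j (t.c.val : ℤ) * U, U' * transvection t.i t.j (-(t.c.val : ℤ)),
      ?_, ?_, ?_⟩
    · rw [Matrix.mul_assoc, ← Matrix.mul_assoc U, h₁, Matrix.one_mul,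
        transvection_mul_transvection_same _ _ t.hij]
      simp
    · rw [det_mul, det_transvection_of_ne _ _ t.hij, h₂, mul_one]
    · rw [map_mul, h₃, List.map_cons, List.prod_cons]
      congr 1
      ext i j
      simp only [matrixMod_apply, TransvectionStruct.toMatrix, transvection, Matrix.add_apply,
        one_apply, single_apply]
      push_cast
      simp

theorem exists_lift_diag (x : ZMod p) (hx : x ≠ 0) :
    ∃ a b c d : ℤ, a * d - c * b = 1 ∧ (b : ZMod p) = 0 ∧ (c : ZMod p) = 0 ∧ (d : ZMod p) = x := by
  -- Both off-diagonal entries must carry a factor p, so the determinant equation is a Bézout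
  -- relation between x and p².
  have hcop : IsCoprime (x.val : ℤ) ((p : ℤ) * p) := by
    have h : IsCoprime (x.val : ℤ) (p : ℤ) := by
      rw [Nat.isCoprime_iff_coprime, Nat.coprime_comm, (Fact.out : p.Prime).coprime_iff_not_dvd]
      intro h
      exact hx (by rw [← ZMod.natCast_zmod_val x, (ZMod.natCast_eq_zero_iff _ _).2 h])
    exact h.mul_right h
  obtain ⟨a, m, h⟩ := hcop
  exact ⟨a, -p, m * p, x.val, by linarith, by simp, by simp, by simp⟩

/-- Every invertible matrix modulo `p` is the lower right block of an element of `Γ₀(p)` whose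
upper right block is divisible by `p`. -/
theorem exists_gamma0_lift (G : Matrix (Fin n) (Fin n) (ZMod p)) (hG : G.det ≠ 0) :
    ∃ κ : symplecticGroup (Fin n) ℤ, matrixMod p (κ : BlockMatrix n ℤ).toBlocks₂₁ = 0 ∧
      matrixMod p (κ : BlockMatrix n ℤ).toBlocks₁₂ = 0 ∧
      matrixMod p (κ : BlockMatrix n ℤ).toBlocks₂₂ = G := by
  refine Matrix.diagonal_transvection_induction_of_det_ne_zero
    (fun G => ∃ κ : symplecticGroup (Fin n) ℤ, matrixMod p (κ : BlockMatrix n ℤ).toBlocks₂₁ = 0 ∧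
      matrixMod p (κ : BlockMatrix n ℤ).toBlocks₁₂ = 0 ∧
      matrixMod p (κ : BlockMatrix n ℤ).toBlocks₂₂ = G) G hG ?_ ?_ ?_
  · intro δ hδ
    rw [det_diagonal, Finset.prod_ne_zero_iff] at hδ
    choose a b c d h₁ h₂ h₃ h₄ using fun i => exists_lift_diag (δ i) (hδ i (Finset.mem_univ i))
    refine ⟨diagonalElement a b c d h₁, ?_, ?_, ?_⟩ <;>
      simp [diagonalElement, matrixMod_diagonal, h₂, h₃, h₄]
  · intro t
    refine ⟨leviElement (transvection t.i t.j (-(t.c.val : ℤ)))ᵀ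
      (transvection t.i t.j (t.c.val : ℤ)) ?_, ?_, ?_, ?_⟩
    · rw [transpose_transpose, transvection_mul_transvection_same _ _ t.hij]
      simp
    · simp [leviElement]
    · simp [leviElement]
    · ext i j
      simp only [leviElement, toBlocks_fromBlocks₂₂, matrixMod_apply, TransvectionStruct.toMatrix,
        transvection, Matrix.add_apply, one_apply, single_apply]
      push_cast
      simp
  · rintro A B - - ⟨κ, h₁, h₂, h₃⟩ ⟨κ', h₁', h₂', h₃'⟩
    refine ⟨κ * κ', ?_, ?_, ?_⟩
    · rw [Submonoid.coe_mul, toBlocks₂₁_mul, map_add, map_mul, map_mul, h₁, h₁']; simp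
    · rw [Submonoid.coe_mul, toBlocks₁₂_mul, map_add, map_mul, map_mul, h₂, h₂']; simp
    · rw [Submonoid.coe_mul, toBlocks₂₂_mul, map_add, map_mul, map_mul, h₁, h₃, h₃']; simp

/-- The relations between the blocks of a symplectic matrix modulo `p`. -/
theorem matrixMod_relations (p : ℕ) (g : symplecticGroup (Fin n) ℤ) :
    (matrixMod p (g : BlockMatrix n ℤ).toBlocks₁₁)ᵀ * matrixMod p (g : BlockMatrix n ℤ).toBlocks₂₂ -
      (matrixMod p (g : BlockMatrix n ℤ).toBlocks₂₁)ᵀ *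
        matrixMod p (g : BlockMatrix n ℤ).toBlocks₁₂ = 1 ∧
    matrixMod p (g : BlockMatrix n ℤ).toBlocks₂₁ * (matrixMod p (g : BlockMatrix n ℤ).toBlocks₂₂)ᵀ =
      matrixMod p (g : BlockMatrix n ℤ).toBlocks₂₂ *
        (matrixMod p (g : BlockMatrix n ℤ).toBlocks₂₁)ᵀ := by
  have h := (transpose_mul_eq_of_mem_symplectic g.2).2.2
  have h' := (mul_transpose_eq_of_mem_symplectic g.2).2.1
  refine ⟨?_, ?_⟩
  · rw [← matrixMod_transpose, ← matrixMod_transpose, ← map_mul, ← map_mul, ← map_sub, h, map_one]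
  · rw [← matrixMod_transpose, ← matrixMod_transpose, ← map_mul, ← map_mul, h']

theorem gamma0_transpose_mul {κ : symplecticGroup (Fin n) ℤ} (hκ : κ ∈ siegelGamma0 n p) :
    (matrixMod p (κ : BlockMatrix n ℤ).toBlocks₁₁)ᵀ *
      matrixMod p (κ : BlockMatrix n ℤ).toBlocks₂₂ = 1 := by
  have h := (matrixMod_relations p κ).1
  rw [mem_siegelGamma0.1 hκ] at h
  simpa using h

/-- The projection onto the coordinates in `E`. -/
def coordProj (R : Type*) [Zero R] [One R] (E : Finset (Fin n)) : Matrix (Fin n) (Fin n) R :=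
  diagonal fun i => if i ∈ E then 1 else 0

theorem coordProj_transpose (R : Type*) [Zero R] [One R] (E : Finset (Fin n)) :
    (coordProj R E)ᵀ = coordProj R E := diagonal_transpose _

theorem coordProj_mul_self (R : Type*) [CommRing R] (E : Finset (Fin n)) :
    coordProj R E * coordProj R E = coordProj R E := by
  rw [coordProj, diagonal_mul_diagonal]
  congr 1
  ext i
  split_ifs <;> simp

theorem matrixMod_coordProj (E : Finset (Fin n)) :
    matrixMod p (coordProj ℤ E) = coordProj (ZMod p) E := by
  rw [coordProj, matrixMod_diagonal, coordProj]
  congr 1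
  ext i
  split_ifs <;> simp

theorem coe_weylElement (E : Finset (Fin n)) :
    (weylElement E : BlockMatrix n ℤ) =
      fromBlocks (1 - coordProj ℤ E) (-coordProj ℤ E) (coordProj ℤ E) (1 - coordProj ℤ E) := by
  have h : (diagonal fun i => if i ∈ E then (0 : ℤ) else 1) = 1 - coordProj ℤ E := by
    rw [coordProj, ← diagonal_one, diagonal_sub]
    congr 1
    ext i
    split_ifs <;> simp
  have h' : (diagonal fun i => if i ∈ E then (-1 : ℤ) else 0) = -coordProj ℤ E := by
    rw [coordProj, diagonal_neg]
    congr 1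
    ext i
    by_cases hi : i ∈ E <;> simp [hi]
  change fromBlocks _ _ _ _ = _
  rw [h, h']
  rfl

theorem coe_weylElement_inv (E : Finset (Fin n)) :
    ((weylElement E)⁻¹ : symplecticGroup (Fin n) ℤ).1 =
      fromBlocks (1 - coordProj ℤ E) (coordProj ℤ E) (-coordProj ℤ E) (1 - coordProj ℤ E) := by
  rw [coe_inv_eq_fromBlocks, coe_weylElement]
  simp [coordProj_transpose]

/-- The principal congruence subgroup is normal in Sp(n, ℤ) and contained in Γ₀(p). -/
theorem mem_gamma0_of_matrixMod_eq_one {g : symplecticGroup (Fin n) ℤ}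
    (h : matrixMod p (g : BlockMatrix n ℤ) = 1) (w : symplecticGroup (Fin n) ℤ) :
    w⁻¹ * g * w ∈ siegelGamma0 n p := by
  rw [mem_siegelGamma0]
  have h' : matrixMod p ((w⁻¹ * g * w : symplecticGroup (Fin n) ℤ) : BlockMatrix n ℤ) = 1 := by
    rw [Submonoid.coe_mul, Submonoid.coe_mul, map_mul, map_mul, h, mul_one, ← map_mul,
      ← Submonoid.coe_mul, inv_mul_cancel, Submonoid.coe_one, map_one]
  ext i j
  exact (congrFun (congrFun h' (Sum.inr i)) (Sum.inl j)).trans (by simp)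

/-- The bottom row determines the coset modulo p: g w⁻¹ is unipotent modulo p, a unipotent element
of P makes it congruent to 1, and what remains can be conjugated past w into Γ₀(p). -/
theorem exists_eq_of_matrixMod_bottom {g : symplecticGroup (Fin n) ℤ} {E : Finset (Fin n)}
    (hC : matrixMod p (g : BlockMatrix n ℤ).toBlocks₂₁ = coordProj (ZMod p) E)
    (hD : matrixMod p (g : BlockMatrix n ℤ).toBlocks₂₂ = 1 - coordProj (ZMod p) E) :
    ∃ η ∈ siegelParabolic n, ∃ κ ∈ siegelGamma0 n p, g = η * weylElement E * κ := by
  set e := coordProj (ZMod p) E with he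
  have hee : e * e = e := coordProj_mul_self _ _
  set δ := g * (weylElement E)⁻¹ with hδ
  have hδC : matrixMod p (δ : BlockMatrix n ℤ).toBlocks₂₁ = 0 := by
    rw [hδ, Submonoid.coe_mul, coe_weylElement_inv, toBlocks₂₁_mul, map_add, map_mul, map_mul, hC,
      hD, toBlocks_fromBlocks₁₁, toBlocks_fromBlocks₂₁, map_sub, map_one, map_neg,
      matrixMod_coordProj, ← he]
    simp [mul_sub, sub_mul, hee]
  have hδD : matrixMod p (δ : BlockMatrix n ℤ).toBlocks₂₂ = 1 := by
    rw [hδ, Submonoid.coe_mul, coe_weylElement_inv, toBlocks₂₂_mul, map_add, map_mul, map_mul, hC,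
      hD, toBlocks_fromBlocks₁₂, toBlocks_fromBlocks₂₂, map_sub, map_one,
      matrixMod_coordProj, ← he]
    simp [mul_sub, sub_mul, hee]
  have hδA : matrixMod p (δ : BlockMatrix n ℤ).toBlocks₁₁ = 1 := by
    have h := gamma0_transpose_mul (mem_siegelGamma0.2 hδC)
    rw [hδD, mul_one] at h
    exact transpose_injective (h.trans transpose_one.symm)
  -- The unipotent element needs an integral symmetric block. The upper right block B of δ is
  -- symmetric only modulo p, whereas DᵀB is symmetric over ℤ and congruent to B because D ≡ 1.
  set b := (δ : BlockMatrix n ℤ).toBlocks₂₂ᵀ * (δ : BlockMatrix n ℤ).toBlocks₁₂ with hb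
  have hbt : bᵀ = b := by
    rw [hb, transpose_mul, transpose_transpose]
    exact (transpose_mul_eq_of_mem_symplectic δ.2).2.1
  have hbm : matrixMod p b = matrixMod p (δ : BlockMatrix n ℤ).toBlocks₁₂ := by
    rw [hb, map_mul, matrixMod_transpose, hδD, transpose_one, one_mul]
  set u := unipotentElement (-b) (by rw [transpose_neg, hbt]) with hu
  have huP : u⁻¹ ∈ siegelParabolic n :=
    inv_mem (mem_siegelParabolic.2 (by simp [hu, unipotentElement]))
  have hρ : matrixMod p ((u * δ : symplecticGroup (Fin n) ℤ) : BlockMatrix n ℤ) = 1 := by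
    have hu' : (u : BlockMatrix n ℤ) = fromBlocks 1 (-b) 0 1 := rfl
    have h₁ : matrixMod p ((u * δ : symplecticGroup (Fin n) ℤ) : BlockMatrix n ℤ).toBlocks₁₁ = 1 := by
      rw [Submonoid.coe_mul, toBlocks₁₁_mul, hu', map_add, map_mul, map_mul, hδA, hδC]; simp
    have h₂ : matrixMod p ((u * δ : symplecticGroup (Fin n) ℤ) : BlockMatrix n ℤ).toBlocks₁₂ = 0 := by
      rw [Submonoid.coe_mul, toBlocks₁₂_mul, hu', map_add, map_mul, map_mul, hδD]; simp [hbm]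
    have h₃ : matrixMod p ((u * δ : symplecticGroup (Fin n) ℤ) : BlockMatrix n ℤ).toBlocks₂₁ = 0 := by
      rw [Submonoid.coe_mul, toBlocks₂₁_mul, hu', map_add, map_mul, map_mul, hδC]; simp
    have h₄ : matrixMod p ((u * δ : symplecticGroup (Fin n) ℤ) : BlockMatrix n ℤ).toBlocks₂₂ = 1 := by
      rw [Submonoid.coe_mul, toBlocks₂₂_mul, hu', map_add, map_mul, map_mul, hδD]; simp
    rw [← fromBlocks_one]
    exact blockMatrix_ext (h₁.trans (toBlocks_fromBlocks₁₁ _ _ _ _).symm)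
      (h₂.trans (toBlocks_fromBlocks₁₂ _ _ _ _).symm)
      (h₃.trans (toBlocks_fromBlocks₂₁ _ _ _ _).symm)
      (h₄.trans (toBlocks_fromBlocks₂₂ _ _ _ _).symm)
  refine ⟨u⁻¹, huP, (weylElement E)⁻¹ * (u * δ) * weylElement E,
    mem_gamma0_of_matrixMod_eq_one hρ _, ?_⟩
  rw [hδ]
  group

/-- Gaussian elimination on the bottom row (C, D) modulo p. Transvections on the left come from P;
on the right any invertible matrix comes from Γ₀(p), by `exists_gamma0_lift`. This brings C to a
coordinate projection e, after which the symplectic relations allow D to be brought to 1 - e by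
elements of Γ₀(p). -/
theorem exists_weyl_decomposition (γ : symplecticGroup (Fin n) ℤ) :
    ∃ E : Finset (Fin n), ∃ η ∈ siegelParabolic n, ∃ κ ∈ siegelGamma0 n p,
      γ = η * weylElement E * κ := by
  classical
  obtain ⟨L, L', δ, h⟩ := Pivot.exists_list_transvec_mul_diagonal_mul_list_transvec
    (matrixMod p (γ : BlockMatrix n ℤ).toBlocks₂₁)
  obtain ⟨U, U', hUU', -, hU⟩ := exists_lift_transvection_prod L
  have hU'U : U' * U = 1 := mul_eq_one_comm.1 hUU'
  set η₁ := leviElement Uᵀ U' (by rw [transpose_transpose, hUU']) with hη₁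
  have hη₁P : η₁ ∈ siegelParabolic n := mem_siegelParabolic.2 (by simp [hη₁, leviElement])
  set E : Finset (Fin n) := Finset.univ.filter fun i => δ i ≠ 0 with hE
  set e := coordProj (ZMod p) E with he
  have hee : e * e = e := coordProj_mul_self _ _
  have het : eᵀ = e := coordProj_transpose _ _
  -- The zeros of δ are replaced by ones: G is then invertible, and diag(δ) differs from it only by
  -- the projection e.
  set G : Matrix (Fin n) (Fin n) (ZMod p) :=
    (diagonal fun i => if δ i = 0 then 1 else δ i) * (L'.map TransvectionStruct.toMatrix).prod
    with hG
  have hGdet : G.det ≠ 0 := by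
    rw [hG, det_mul, TransvectionStruct.det_toMatrix_prod, mul_one, det_diagonal,
      Finset.prod_ne_zero_iff]
    intro i _
    split_ifs with hi
    · exact one_ne_zero
    · exact hi
  have heG : diagonal δ * (L'.map TransvectionStruct.toMatrix).prod = e * G := by
    rw [hG, ← mul_assoc, he, coordProj, diagonal_mul_diagonal]
    congr 2
    ext i
    by_cases hi : δ i = 0 <;> simp [hE, hi]
  obtain ⟨κ₁, hκ₁C, hκ₁B, hκ₁D⟩ := exists_gamma0_lift Gᵀ (by rwa [det_transpose])
  have hκ₁ : κ₁ ∈ siegelGamma0 n p := mem_siegelGamma0.2 hκ₁C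
  have hGA : G * matrixMod p (κ₁ : BlockMatrix n ℤ).toBlocks₁₁ = 1 := by
    have := gamma0_transpose_mul hκ₁
    rw [hκ₁D, ← transpose_mul] at this
    exact transpose_injective (this.trans transpose_one.symm)
  set γ₂ := η₁ * γ * κ₁ with hγ₂
  have hC₂ : matrixMod p (γ₂ : BlockMatrix n ℤ).toBlocks₂₁ = e := by
    have h₁ : matrixMod p ((η₁ * γ : symplecticGroup (Fin n) ℤ) : BlockMatrix n ℤ).toBlocks₂₁ =
        e * G := by
      have hη' : (η₁ : BlockMatrix n ℤ) = fromBlocks Uᵀ 0 0 U' := rfl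
      rw [Submonoid.coe_mul, toBlocks₂₁_mul, hη', toBlocks_fromBlocks₂₁, toBlocks_fromBlocks₂₂,
        Matrix.zero_mul, zero_add, map_mul, h, ← hU, ← heG, ← mul_assoc, ← mul_assoc, ← map_mul,
        hU'U, map_one, one_mul]
    rw [hγ₂, Submonoid.coe_mul, toBlocks₂₁_mul, map_add, map_mul, map_mul, h₁, hκ₁C, mul_zero,
      add_zero, mul_assoc, hGA, mul_one]
  set D₂ := matrixMod p (γ₂ : BlockMatrix n ℤ).toBlocks₂₂ with hD₂
  have hsym : e * D₂ᵀ = D₂ * e := by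
    have := (matrixMod_relations p γ₂).2
    rwa [hC₂, het] at this
  have heDe : e * D₂ * e = D₂ * e := by
    rw [mul_assoc, ← hsym, ← mul_assoc, hee]
  -- B must be symmetric with eB = -eD₂. The block eD₂e = D₂e is symmetric already; the remaining
  -- part of eD₂ is symmetrized by adding its transpose, which e annihilates.
  set B : Matrix (Fin n) (Fin n) (ZMod p) :=
    -(D₂ * e + e * D₂ * (1 - e) + (e * D₂ * (1 - e))ᵀ) with hB
  have hBt : Bᵀ = B := by
    rw [hB]
    simp only [transpose_neg, transpose_add, transpose_mul, transpose_transpose, het, hsym,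
      transpose_sub, transpose_one]
    abel
  have heB : e * B = -(e * D₂) := by
    rw [hB]
    simp only [transpose_mul, het, transpose_sub, transpose_one]
    have h0 : e * ((1 - e) * (D₂ᵀ * e)) = 0 := by
      rw [← mul_assoc, mul_sub, hee, mul_one, sub_self, Matrix.zero_mul]
    rw [mul_neg, mul_add, mul_add, h0, add_zero, mul_sub, mul_sub, mul_one, heDe, ← mul_assoc,
      ← mul_assoc, hee, heDe]
    abel
  set u := unipotentElement (matrixLift B) (matrixLift_transpose hBt) with hu
  have hu' : (u : BlockMatrix n ℤ) = fromBlocks 1 (matrixLift B) 0 1 := rfl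
  have huΓ : u ∈ siegelGamma0 n p := mem_siegelGamma0.2 (by simp [hu'])
  set γ₃ := γ₂ * u with hγ₃
  have hC₃ : matrixMod p (γ₃ : BlockMatrix n ℤ).toBlocks₂₁ = e := by
    rw [hγ₃, Submonoid.coe_mul, toBlocks₂₁_mul, hu']
    simp [hC₂]
  set D₃ := matrixMod p (γ₃ : BlockMatrix n ℤ).toBlocks₂₂ with hD₃
  have hD₃' : D₃ = D₂ - e * D₂ := by
    rw [hD₃, hγ₃, Submonoid.coe_mul, toBlocks₂₂_mul, hu', map_add, map_mul, map_mul,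
      toBlocks_fromBlocks₁₂, toBlocks_fromBlocks₂₂, matrixMod_matrixLift, hC₂, heB, map_one,
      mul_one]
    abel
  have heD₃ : e * D₃ = 0 := by
    rw [hD₃', mul_sub, ← mul_assoc, hee, sub_self]
  have hD₃e : D₃ * e = 0 := by
    rw [hD₃', sub_mul, heDe, sub_self]
  have heD₃t : e * D₃ᵀ = 0 := by
    rw [← het, ← transpose_mul, hD₃e, transpose_zero]
  set A₃ := matrixMod p (γ₃ : BlockMatrix n ℤ).toBlocks₁₁ with hA₃
  have hrel : A₃ᵀ * D₃ - e * matrixMod p (γ₃ : BlockMatrix n ℤ).toBlocks₁₂ = 1 := by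
    have := (matrixMod_relations p γ₃).1
    rwa [hC₃, het] at this
  have hfAD : (1 - e) * (A₃ᵀ * D₃) = 1 - e := by
    have h1 : A₃ᵀ * D₃ = 1 + e * matrixMod p (γ₃ : BlockMatrix n ℤ).toBlocks₁₂ := by
      rw [← hrel]; abel
    rw [h1, mul_add, mul_one, ← mul_assoc, sub_mul, one_mul, hee, sub_self, Matrix.zero_mul,
      add_zero]
  -- D₃ now lives on the complementary coordinates, where the relation between the blocks makes A₃ᵀ
  -- its inverse. Hence H inverts D₃ + e.
  set H := (1 - e) * A₃ᵀ * (1 - e) + e with hH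
  have hfD₃ : (1 - e) * D₃ = D₃ := by rw [sub_mul, one_mul, heD₃, sub_zero]
  have hHD : H * (D₃ + e) = 1 := by
    have h0 : (1 - e) * e = 0 := by rw [sub_mul, one_mul, hee, sub_self]
    rw [hH, mul_add, add_mul, add_mul, heD₃, hee, mul_assoc _ _ D₃, hfD₃, mul_assoc _ _ e, h0,
      mul_assoc, hfAD]
    simp
  have hDH : (D₃ + e) * H = 1 := mul_eq_one_comm.1 hHD
  have hHdet : H.det ≠ 0 := by
    intro h0
    have := congrArg det hHD
    rw [det_mul, h0, zero_mul, det_one] at this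
    exact zero_ne_one this
  obtain ⟨κ₃, hκ₃C, hκ₃B, hκ₃D⟩ := exists_gamma0_lift H hHdet
  have hκ₃ : κ₃ ∈ siegelGamma0 n p := mem_siegelGamma0.2 hκ₃C
  have hκ₃A : matrixMod p (κ₃ : BlockMatrix n ℤ).toBlocks₁₁ = (D₃ + e)ᵀ := by
    have h1 := gamma0_transpose_mul hκ₃
    rw [hκ₃D] at h1
    apply transpose_injective
    rw [transpose_transpose]
    calc _ = (matrixMod p (κ₃ : BlockMatrix n ℤ).toBlocks₁₁)ᵀ * (H * (D₃ + e)) := by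
            rw [hHD, mul_one]
      _ = D₃ + e := by rw [← mul_assoc, h1, one_mul]
  have hC₄ : matrixMod p ((γ₃ * κ₃ : symplecticGroup (Fin n) ℤ) : BlockMatrix n ℤ).toBlocks₂₁ =
      e := by
    rw [Submonoid.coe_mul, toBlocks₂₁_mul, map_add, map_mul, map_mul, hC₃, hκ₃C, mul_zero, add_zero,
      hκ₃A, transpose_add, mul_add, heD₃t, het, hee, zero_add]
  have hD₄ : matrixMod p ((γ₃ * κ₃ : symplecticGroup (Fin n) ℤ) : BlockMatrix n ℤ).toBlocks₂₂ =
      1 - e := by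
    have heH : e * H = e := by
      have h0 : e * (1 - e) = 0 := by rw [mul_sub, mul_one, hee, sub_self]
      rw [hH, mul_add, ← mul_assoc, ← mul_assoc, h0, hee, Matrix.zero_mul, Matrix.zero_mul, zero_add]
    rw [Submonoid.coe_mul, toBlocks₂₂_mul, map_add, map_mul, map_mul, hκ₃B, mul_zero, zero_add,
      hκ₃D, ← hD₃, ← hDH, add_mul, heH]
    abel
  obtain ⟨η, hη, κ, hκ, hfinal⟩ := exists_eq_of_matrixMod_bottom hC₄ hD₄
  refine ⟨E, η₁⁻¹ * η, mul_mem (inv_mem hη₁P) hη, κ * κ₃⁻¹ * u⁻¹ * κ₁⁻¹,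
    mul_mem (mul_mem (mul_mem hκ (inv_mem hκ₃)) (inv_mem huΓ)) (inv_mem hκ₁), ?_⟩
  have : γ = η₁⁻¹ * (γ₃ * κ₃) * κ₃⁻¹ * u⁻¹ * κ₁⁻¹ := by
    rw [hγ₃, hγ₂]; group
  rw [this, hfinal]
  group

theorem exists_cusp_decomposition (γ : symplecticGroup (Fin n) ℤ) :
    ∃ r ≤ n, ∃ η ∈ siegelParabolic n, ∃ κ ∈ siegelGamma0 n p, γ = η * cuspElement n r * κ := by
  obtain ⟨E, η, hη, κ, hκ, h⟩ := exists_weyl_decomposition (p := p) γ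
  obtain ⟨m, hmP, hmΓ, hm⟩ := exists_perm_weylElement E
  refine ⟨E.card, by simpa using E.card_le_univ, η * m, mul_mem hη hmP, m⁻¹ * κ,
    mul_mem (inv_mem (hmΓ p)) hκ, ?_⟩
  rw [h, hm]
  group

end Decomposition

/-! ### The function `ψ*` -/

section PsiStar

variable {n p : ℕ} [Fact p.Prime] {ψ : DirichletCharacter ℂ p}

theorem siegelParabolic_le_siegelGamma0 (n p : ℕ) : siegelParabolic n ≤ siegelGamma0 n p := by
  intro g hg
  rw [mem_siegelGamma0, mem_siegelParabolic.1 hg, map_zero]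

theorem charDetD_eq (ψ : DirichletCharacter ℂ p) (g : symplecticGroup (Fin n) ℤ) :
    charDetD ψ g = ψ (matrixMod p (g : BlockMatrix n ℤ).toBlocks₂₂).det := by
  rw [charDetD, matrixMod_det]

theorem charDetD_mul (ψ : DirichletCharacter ℂ p) {g : symplecticGroup (Fin n) ℤ}
    (hg : g ∈ siegelGamma0 n p) (κ : symplecticGroup (Fin n) ℤ) :
    charDetD ψ (g * κ) = charDetD ψ g * charDetD ψ κ := by
  rw [charDetD_eq, charDetD_eq, charDetD_eq, Submonoid.coe_mul, toBlocks₂₂_mul, map_add, map_mul,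
    map_mul, mem_siegelGamma0.1 hg, Matrix.zero_mul, zero_add, det_mul, map_mul]

theorem charDetD_one (ψ : DirichletCharacter ℂ p) :
    charDetD ψ (1 : symplecticGroup (Fin n) ℤ) = 1 := by
  have : ((1 : symplecticGroup (Fin n) ℤ) : BlockMatrix n ℤ).toBlocks₂₂ = 1 := by
    rw [Submonoid.coe_one, ← fromBlocks_one, toBlocks_fromBlocks₂₂]
  rw [charDetD_eq, this]
  simp

theorem charDetD_sq (hψ : ∀ x : ZMod p, x ≠ 0 → ψ x ^ 2 = 1) {g : symplecticGroup (Fin n) ℤ}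
    (hg : g ∈ siegelGamma0 n p) : charDetD ψ g * charDetD ψ g = 1 := by
  rw [charDetD_eq, ← sq]
  apply hψ
  intro h
  have := congrArg det (gamma0_transpose_mul hg)
  rw [det_mul, h, mul_zero, det_one] at this
  exact zero_ne_one this

theorem charDetD_inv (hψ : ∀ x : ZMod p, x ≠ 0 → ψ x ^ 2 = 1) {g : symplecticGroup (Fin n) ℤ}
    (hg : g ∈ siegelGamma0 n p) : charDetD ψ g⁻¹ = charDetD ψ g := by
  have h : charDetD ψ g * charDetD ψ g⁻¹ = 1 := by
    rw [← charDetD_mul ψ hg, mul_inv_cancel, charDetD_one]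
  calc _ = charDetD ψ g * charDetD ψ g * charDetD ψ g⁻¹ := by rw [charDetD_sq hψ hg, one_mul]
    _ = _ := by rw [mul_assoc, h, mul_one]

/-- This is why ψ* is well defined. Modulo p the lower right blocks of h and k are block triangular
with respect to E. They agree on the complement of E, while on E they are inverse transposes of each
other. The product of their determinants is thus a nonzero square, on which ψ is 1. -/
theorem charDetD_eq_of_commute (hψ : ∀ x : ZMod p, x ≠ 0 → ψ x ^ 2 = 1)
    {h k : symplecticGroup (Fin n) ℤ} (hk : k ∈ siegelGamma0 n p)
    (hh : h ∈ siegelParabolic n) {E : Finset (Fin n)} (hhk : h * weylElement E = weylElement E * k) :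
    charDetD ψ h = charDetD ψ k := by
  classical
  set e := coordProj (ZMod p) E with he
  set Dh := matrixMod p (h : BlockMatrix n ℤ).toBlocks₂₂ with hDh
  set A := matrixMod p (k : BlockMatrix n ℤ).toBlocks₁₁ with hA
  set B := matrixMod p (k : BlockMatrix n ℤ).toBlocks₁₂ with hB
  set D := matrixMod p (k : BlockMatrix n ℤ).toBlocks₂₂ with hD
  have hval : (h : BlockMatrix n ℤ) * weylElement E = weylElement E * k := congrArg Subtype.val hhk
  have h₁ : Dh * e = e * A := by
    have := congrArg (fun M : BlockMatrix n ℤ => matrixMod p M.toBlocks₂₁) hval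
    simpa [toBlocks₂₁_mul, coe_weylElement, mem_siegelParabolic.1 hh, mem_siegelGamma0.1 hk,
      matrixMod_coordProj] using this
  have h₂ : Dh * (1 - e) = e * B + (1 - e) * D := by
    have := congrArg (fun M : BlockMatrix n ℤ => matrixMod p M.toBlocks₂₂) hval
    simpa [toBlocks₂₂_mul, coe_weylElement, mem_siegelParabolic.1 hh,
      matrixMod_coordProj] using this
  have h₁' : ∀ i j, Dh i j * (if j ∈ E then 1 else 0) = (if i ∈ E then 1 else 0) * A i j := by
    intro i j
    have := congrFun (congrFun h₁ i) j
    rwa [he, coordProj, mul_diagonal, diagonal_mul] at this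
  have h₂' : ∀ i j, Dh i j * (if j ∈ E then 0 else 1) =
      (if i ∈ E then 1 else 0) * B i j + (if i ∈ E then 0 else 1) * D i j := by
    intro i j
    have h0 : 1 - e = diagonal fun i => if i ∈ E then (0 : ZMod p) else 1 := by
      rw [he, coordProj, ← diagonal_one, diagonal_sub]
      congr 1
      ext i
      split_ifs <;> simp
    have := congrFun (congrFun h₂ i) j
    rwa [h0, Matrix.add_apply, he, coordProj, mul_diagonal, diagonal_mul, diagonal_mul] at this
  have hDh0 : ∀ i, i ∉ E → ∀ j, j ∈ E → Dh i j = 0 := by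
    intro i hi j hj
    simpa [hi, hj] using h₁' i j
  have hD0 : ∀ i, i ∉ E → ∀ j, j ∈ E → D i j = 0 := by
    intro i hi j hj
    simpa [hi, hj] using (h₂' i j).symm
  have hAD : Aᵀ * D = 1 := gamma0_transpose_mul hk
  obtain ⟨P, hP⟩ : ∃ P : Fin n → Prop, ∀ i, P i ↔ i ∈ E := ⟨_, fun _ => Iff.rfl⟩
  have e₁ : Dh.toSquareBlockProp P = A.toSquareBlockProp P := by
    ext i j
    have := h₁' i j
    rwa [if_pos ((hP _).1 i.2), if_pos ((hP _).1 j.2), mul_one, one_mul] at this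
  have e₂ : Dh.toSquareBlockProp (fun i => ¬ P i) = D.toSquareBlockProp (fun i => ¬ P i) := by
    ext i j
    have := h₂' i j
    rwa [if_neg fun h => i.2 ((hP _).2 h), if_neg fun h => i.2 ((hP _).2 h),
      if_neg fun h => j.2 ((hP _).2 h), mul_one, one_mul, zero_mul, zero_add] at this
  have e₃ : (A.toSquareBlockProp P)ᵀ * D.toSquareBlockProp P = 1 := by
    ext i j
    have h := congrFun (congrFun hAD i) j
    rw [mul_apply] at h ⊢
    have h' : (∑ l : {l // P l}, Aᵀ i l * D l j) = ∑ l, Aᵀ i l * D l j := by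
      rw [← Finset.sum_subtype (p := P) (Finset.univ.filter P) (by simp)
        fun l => Aᵀ i.1 l * D l j.1]
      · apply Finset.sum_subset (Finset.subset_univ _)
        intro l _ hl
        rw [hD0 l (fun hh => hl (by simpa using (hP l).2 hh)) j ((hP _).1 j.2), mul_zero]
    calc _ = (∑ l : {l // P l}, Aᵀ i l * D l j) := rfl
      _ = _ := by
        rw [h', h, one_apply, one_apply]
        exact if_congr Subtype.ext_iff.symm rfl rfl
  have hDhP : ∀ i, ¬ P i → ∀ j, P j → Dh i j = 0 := fun i hi j hj =>
    hDh0 i (fun h => hi ((hP i).2 h)) j ((hP j).1 hj)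
  have hDP : ∀ i, ¬ P i → ∀ j, P j → D i j = 0 := fun i hi j hj =>
    hD0 i (fun h => hi ((hP i).2 h)) j ((hP j).1 hj)
  have hdet : Dh.det * D.det = (D.toSquareBlockProp (fun i => ¬ P i)).det ^ 2 := by
    have e₃' := congrArg det e₃
    rw [det_mul, det_transpose, det_one] at e₃'
    rw [twoBlockTriangular_det Dh P hDhP, twoBlockTriangular_det D P hDP, e₁, e₂]
    linear_combination (D.toSquareBlockProp (fun i => ¬ P i)).det ^ 2 * e₃'
  have hDdet : D.det ≠ 0 := by
    intro h0
    have := congrArg det hAD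
    rw [det_mul, h0, mul_zero, det_one] at this
    exact zero_ne_one this
  have hx : (D.toSquareBlockProp (fun i => ¬ P i)).det ≠ 0 := by
    intro h0
    exact hDdet (by rw [twoBlockTriangular_det D P hDP, h0, mul_zero])
  have hmul : charDetD ψ h * charDetD ψ k = 1 := by
    rw [charDetD_eq, charDetD_eq, ← map_mul, ← hDh, ← hD, hdet, map_pow, hψ _ hx]
  calc _ = charDetD ψ h * (charDetD ψ k * charDetD ψ k) := by rw [charDetD_sq hψ hk, mul_one]
    _ = _ := by rw [← mul_assoc, hmul, one_mul]

/-- Two decompositions of the same element differ by a pair h, k with h w_r = w_r k, and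
`charDetD_eq_of_commute` compares the two characters on such a pair. -/
theorem psiStar_apply (hψ : ∀ x : ZMod p, x ≠ 0 → ψ x ^ 2 = 1) (r : ℕ)
    {η κ : symplecticGroup (Fin n) ℤ} (hη : η ∈ siegelParabolic n) (hκ : κ ∈ siegelGamma0 n p) :
    psiStar ψ r (η * cuspElement n r * κ) = charDetD ψ η * charDetD ψ κ := by
  have hex : ∃ x : siegelParabolic n × siegelGamma0 n p,
      η * cuspElement n r * κ = (x.1 : symplecticGroup (Fin n) ℤ) * cuspElement n r *
        (x.2 : symplecticGroup (Fin n) ℤ) := ⟨⟨⟨η, hη⟩, ⟨κ, hκ⟩⟩, rfl⟩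
  rw [psiStar, dif_pos hex]
  have hspec := hex.choose_spec
  set x := hex.choose
  have hPΓ := siegelParabolic_le_siegelGamma0 n p
  have h := charDetD_eq_of_commute (ψ := ψ) hψ (h := (x.1 : symplecticGroup (Fin n) ℤ)⁻¹ * η)
    (k := (x.2 : symplecticGroup (Fin n) ℤ) * κ⁻¹) (mul_mem x.2.2 (inv_mem hκ))
    (mul_mem (inv_mem x.1.2) hη) (E := Finset.univ.filter fun i : Fin n => i.val < r) (by
      rw [← cuspElement_eq_weylElement, mul_assoc, inv_mul_eq_iff_eq_mul, ← mul_assoc, ← mul_assoc,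
        eq_mul_inv_iff_mul_eq]
      exact hspec)
  rw [charDetD_mul ψ (inv_mem (hPΓ x.1.2)), charDetD_mul ψ x.2.2, charDetD_inv hψ (hPΓ x.1.2),
    charDetD_inv hψ hκ] at h
  have h1 := charDetD_sq hψ (hPΓ x.1.2)
  have h2 := charDetD_sq hψ hκ
  calc _ = charDetD ψ x.1.1 * (charDetD ψ x.2.1 * charDetD ψ κ) * charDetD ψ κ := by
        rw [mul_assoc, mul_assoc, h2, mul_one]
    _ = charDetD ψ x.1.1 * charDetD ψ x.1.1 * charDetD ψ η * charDetD ψ κ := by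
        rw [← h]; ring
    _ = _ := by rw [h1, one_mul]

theorem psiStar_eq_zero {r : ℕ} {γ : symplecticGroup (Fin n) ℤ}
    (h : ¬ ∃ η ∈ siegelParabolic n, ∃ κ ∈ siegelGamma0 n p, γ = η * cuspElement n r * κ) :
    psiStar ψ r γ = 0 := by
  rw [psiStar, dif_neg]
  rintro ⟨⟨η, κ⟩, hx⟩
  exact h ⟨η, η.2, κ, κ.2, hx⟩

theorem psiStar_mul_left (hψ : ∀ x : ZMod p, x ≠ 0 → ψ x ^ 2 = 1) (r : ℕ)
    {η : symplecticGroup (Fin n) ℤ} (hη : η ∈ siegelParabolic n) (γ : symplecticGroup (Fin n) ℤ) :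
    psiStar ψ r (η * γ) = charDetD ψ η * psiStar ψ r γ := by
  by_cases h : ∃ η ∈ siegelParabolic n, ∃ κ ∈ siegelGamma0 n p, γ = η * cuspElement n r * κ
  · obtain ⟨η', hη', κ, hκ, rfl⟩ := h
    rw [← mul_assoc, ← mul_assoc, psiStar_apply hψ r (mul_mem hη hη') hκ, psiStar_apply hψ r hη' hκ,
      charDetD_mul ψ (siegelParabolic_le_siegelGamma0 n p hη), mul_assoc]
  · rw [psiStar_eq_zero h, psiStar_eq_zero, mul_zero]
    rintro ⟨η', hη', κ, hκ, h'⟩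
    exact h ⟨η⁻¹ * η', mul_mem (inv_mem hη) hη', κ, hκ, by
      rw [mul_assoc, mul_assoc, ← mul_assoc η', ← h', inv_mul_cancel_left]⟩

theorem psiStar_mul_right (hψ : ∀ x : ZMod p, x ≠ 0 → ψ x ^ 2 = 1) (r : ℕ)
    (γ : symplecticGroup (Fin n) ℤ) {κ : symplecticGroup (Fin n) ℤ} (hκ : κ ∈ siegelGamma0 n p) :
    psiStar ψ r (γ * κ) = psiStar ψ r γ * charDetD ψ κ := by
  by_cases h : ∃ η ∈ siegelParabolic n, ∃ κ ∈ siegelGamma0 n p, γ = η * cuspElement n r * κ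
  · obtain ⟨η', hη', κ', hκ', rfl⟩ := h
    rw [mul_assoc _ κ', psiStar_apply hψ r hη' (mul_mem hκ' hκ), psiStar_apply hψ r hη' hκ',
      charDetD_mul ψ hκ', mul_assoc]
  · rw [psiStar_eq_zero h, psiStar_eq_zero, zero_mul]
    rintro ⟨η', hη', κ', hκ', h'⟩
    exact h ⟨η', hη', κ' * κ⁻¹, mul_mem hκ' (inv_mem hκ), by
      rw [← mul_assoc, ← h', mul_inv_cancel_right]⟩

/-- Modulo p the lower left block is D_η e A_κ with invertible outer factors. This invariant
separates the double cosets. -/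
theorem rank_of_mem_doubleCoset {r : ℕ} (hr : r ≤ n) {η κ : symplecticGroup (Fin n) ℤ}
    (hη : η ∈ siegelParabolic n) (hκ : κ ∈ siegelGamma0 n p) :
    (matrixMod p ((η * cuspElement n r * κ : symplecticGroup (Fin n) ℤ) :
      BlockMatrix n ℤ).toBlocks₂₁).rank = r := by
  set E : Finset (Fin n) := Finset.univ.filter fun i : Fin n => i.val < r with hE
  have hPΓ := siegelParabolic_le_siegelGamma0 n p
  have h : matrixMod p ((η * cuspElement n r * κ : symplecticGroup (Fin n) ℤ) :
      BlockMatrix n ℤ).toBlocks₂₁ = matrixMod p (η : BlockMatrix n ℤ).toBlocks₂₂ *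
        coordProj (ZMod p) E * matrixMod p (κ : BlockMatrix n ℤ).toBlocks₁₁ := by
    rw [cuspElement_eq_weylElement, ← hE, Submonoid.coe_mul, Submonoid.coe_mul, toBlocks₂₁_mul,
      map_add, map_mul, map_mul, mem_siegelGamma0.1 hκ, mul_zero, add_zero, toBlocks₂₁_mul,
      mem_siegelParabolic.1 hη, Matrix.zero_mul, zero_add, coe_weylElement, toBlocks_fromBlocks₂₁,
      map_mul, matrixMod_coordProj]
  have hη' : IsUnit (matrixMod p (η : BlockMatrix n ℤ).toBlocks₂₂).det :=
    (Matrix.isUnit_iff_isUnit_det _).1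
      (IsUnit.of_mul_eq_one _ (mul_eq_one_comm.1 (gamma0_transpose_mul (hPΓ hη))))
  have hκ' : IsUnit (matrixMod p (κ : BlockMatrix n ℤ).toBlocks₁₁).det := by
    have := (Matrix.isUnit_iff_isUnit_det _).1
      (IsUnit.of_mul_eq_one _ (gamma0_transpose_mul hκ))
    rwa [det_transpose] at this
  rw [h, rank_mul_eq_left_of_isUnit_det _ _ hκ', rank_mul_eq_right_of_isUnit_det _ _ hη', coordProj,
    rank_diagonal]
  have : ∀ i : Fin n, (if i ∈ E then (1 : ZMod p) else 0) ≠ 0 ↔ i.val < r := by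
    intro i
    simp [hE]
  rw [Fintype.card_congr (Equiv.subtypeEquivRight this), Fintype.card_subtype,
    Fin.card_filter_val_lt, min_eq_right hr]

theorem psiStar_of_ne {r j : ℕ} (hr : r ≤ n) (hj : j ≤ n) (hrj : r ≠ j)
    {η κ : symplecticGroup (Fin n) ℤ} (hη : η ∈ siegelParabolic n) (hκ : κ ∈ siegelGamma0 n p) :
    psiStar ψ r (η * cuspElement n j * κ) = 0 := by
  apply psiStar_eq_zero
  rintro ⟨η', hη', κ', hκ', h⟩
  have h₁ := rank_of_mem_doubleCoset hj hη hκ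
  rw [h, rank_of_mem_doubleCoset hr hη' hκ'] at h₁
  exact hrj h₁

/-- The permutation matrix relating the two Weyl elements enters once from P and once from Γ₀(p), so
its character is squared and disappears. -/
theorem psiStar_weylElement (hψ : ∀ x : ZMod p, x ≠ 0 → ψ x ^ 2 = 1) {r : ℕ} (hr : r ≤ n)
    (E : Finset (Fin n)) {κ : symplecticGroup (Fin n) ℤ} (hκ : κ ∈ siegelGamma0 n p) :
    psiStar ψ r (weylElement E * κ) = if r = E.card then charDetD ψ κ else 0 := by
  obtain ⟨m, hmP, hmΓ, hm⟩ := exists_perm_weylElement E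
  rw [hm, mul_assoc _ m⁻¹]
  split_ifs with h
  · rw [h, psiStar_apply hψ _ hmP (mul_mem (inv_mem (hmΓ p)) hκ),
      charDetD_mul ψ (inv_mem (hmΓ p)), charDetD_inv hψ (hmΓ p), ← mul_assoc,
      charDetD_sq hψ (hmΓ p), one_mul]
  · exact psiStar_of_ne hr (by simpa using E.card_le_univ) h hmP (mul_mem (inv_mem (hmΓ p)) hκ)

end PsiStar

/-! ### Block triangular factors of `w_j T` -/

section Triangular

variable {n p : ℕ} [Fact p.Prime] {ψ : DirichletCharacter ℂ p}

/-- The matrix `(1, S; 0, p)`. -/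
def heckeUpper (p : ℕ) (S : Matrix (Fin n) (Fin n) ℤ) : BlockMatrix n ℤ :=
  fromBlocks 1 S 0 ((p : ℤ) • 1)

/-- The matrix `(p, -S; 0, 1)`, adjoint to `(1, S; 0, p)`. -/
def heckeAdjoint (p : ℕ) (S : Matrix (Fin n) (Fin n) ℤ) : BlockMatrix n ℤ :=
  fromBlocks ((p : ℤ) • 1) (-S) 0 1

theorem heckeAdjoint_mul_heckeUpper (S : Matrix (Fin n) (Fin n) ℤ) :
    heckeAdjoint p S * heckeUpper p S = (p : ℤ) • (1 : BlockMatrix n ℤ) := by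
  rw [heckeAdjoint, heckeUpper, fromBlocks_multiply, ← fromBlocks_one, fromBlocks_smul]
  simp only [Matrix.smul_mul, Matrix.mul_smul, Matrix.one_mul, Matrix.mul_one, Matrix.mul_zero,
    Matrix.zero_mul, add_zero, zero_add, smul_zero, smul_neg, Matrix.neg_mul, add_neg_cancel,
    neg_add_cancel]

theorem heckeUpper_mul_heckeAdjoint (S : Matrix (Fin n) (Fin n) ℤ) :
    heckeUpper p S * heckeAdjoint p S = (p : ℤ) • (1 : BlockMatrix n ℤ) := by
  rw [heckeAdjoint, heckeUpper, fromBlocks_multiply, ← fromBlocks_one, fromBlocks_smul]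
  simp only [Matrix.smul_mul, Matrix.mul_smul, Matrix.one_mul, Matrix.mul_one, Matrix.mul_zero,
    Matrix.zero_mul, add_zero, zero_add, smul_zero, smul_neg, Matrix.neg_mul, add_neg_cancel,
    neg_add_cancel]

theorem heckeAdjoint_similitude {S : Matrix (Fin n) (Fin n) ℤ} (hS : Sᵀ = S) :
    (heckeAdjoint p S)ᵀ * J (Fin n) ℤ * heckeAdjoint p S = (p : ℤ) • J (Fin n) ℤ := by
  rw [heckeAdjoint, J, fromBlocks_transpose, fromBlocks_multiply, fromBlocks_multiply,
    fromBlocks_smul]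
  simp only [transpose_smul, transpose_neg, transpose_zero, transpose_one, hS, Matrix.smul_mul,
    Matrix.mul_smul, Matrix.one_mul, Matrix.mul_one, Matrix.mul_zero, Matrix.zero_mul, add_zero,
    zero_add, smul_zero, smul_neg, Matrix.neg_mul, Matrix.mul_neg, neg_neg, add_neg_cancel,
    neg_add_cancel, neg_zero]

theorem heckeUpper_similitude {S : Matrix (Fin n) (Fin n) ℤ} (hS : Sᵀ = S) :
    (heckeUpper p S)ᵀ * J (Fin n) ℤ * heckeUpper p S = (p : ℤ) • J (Fin n) ℤ := by
  rw [heckeUpper, J, fromBlocks_transpose, fromBlocks_multiply, fromBlocks_multiply,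
    fromBlocks_smul]
  simp only [transpose_smul, transpose_zero, transpose_one, hS, Matrix.smul_mul,
    Matrix.mul_smul, Matrix.one_mul, Matrix.mul_one, Matrix.mul_zero, Matrix.zero_mul, add_zero,
    zero_add, smul_zero, smul_neg, Matrix.neg_mul, Matrix.mul_neg, add_neg_cancel,
    neg_add_cancel, neg_zero]

/-- M and N have the same similitude factor p, which cancels. For K only integrality then has to be
checked by hand. -/
theorem mem_symplectic_of_mul_eq {M N K : BlockMatrix n ℤ} {g : symplecticGroup (Fin n) ℤ}
    (hM : Mᵀ * J (Fin n) ℤ * M = (p : ℤ) • J (Fin n) ℤ)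
    (hN : Nᵀ * J (Fin n) ℤ * N = (p : ℤ) • J (Fin n) ℤ) (h : (g : BlockMatrix n ℤ) * M = N * K) :
    K ∈ symplecticGroup (Fin n) ℤ := by
  rw [SymplecticGroup.mem_iff']
  have h₁ : (N * K)ᵀ * J (Fin n) ℤ * (N * K) = (p : ℤ) • (Kᵀ * J (Fin n) ℤ * K) := by
    calc _ = Kᵀ * (Nᵀ * J (Fin n) ℤ * N) * K := by rw [transpose_mul]; noncomm_ring
      _ = _ := by rw [hN, Matrix.mul_smul, Matrix.smul_mul]
  have h₂ : ((g : BlockMatrix n ℤ) * M)ᵀ * J (Fin n) ℤ * (g * M) = (p : ℤ) • J (Fin n) ℤ := by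
    have hg := SymplecticGroup.mem_iff'.1 g.2
    calc _ = Mᵀ * ((g : BlockMatrix n ℤ)ᵀ * J (Fin n) ℤ * g) * M := by
          rw [transpose_mul]; noncomm_ring
      _ = _ := by rw [hg, hM]
  rw [h, h₁] at h₂
  exact smul_right_injective _ (Int.natCast_ne_zero.2 (Fact.out : p.Prime).ne_zero) h₂

/-- Elements of `Γ₀(p)` permute the matrices `(p, -S; 0, 1)`, up to elements of `Γ₀(p)` on the
right. -/
theorem gamma0_mul_heckeAdjoint (ψ : DirichletCharacter ℂ p) {κ : symplecticGroup (Fin n) ℤ}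
    (hκ : κ ∈ siegelGamma0 n p) {S : Matrix (Fin n) (Fin n) ℤ} (hS : Sᵀ = S) :
    ∃ S' : Matrix (Fin n) (Fin n) ℤ, S'ᵀ = S' ∧
      S' = (κ : BlockMatrix n ℤ).toBlocks₁₁ * S * (κ : BlockMatrix n ℤ).toBlocks₁₁ᵀ -
        (κ : BlockMatrix n ℤ).toBlocks₁₂ * (κ : BlockMatrix n ℤ).toBlocks₁₁ᵀ ∧
      ∃ κ' ∈ siegelGamma0 n p, charDetD ψ κ' = charDetD ψ κ ∧
        (κ : BlockMatrix n ℤ) * heckeAdjoint p S = heckeAdjoint p S' * κ' := by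
  set A := (κ : BlockMatrix n ℤ).toBlocks₁₁ with hA
  set B := (κ : BlockMatrix n ℤ).toBlocks₁₂ with hB
  set C := (κ : BlockMatrix n ℤ).toBlocks₂₁ with hC
  set D := (κ : BlockMatrix n ℤ).toBlocks₂₂ with hD
  have hκ' : (κ : BlockMatrix n ℤ) = fromBlocks A B C D := (fromBlocks_toBlocks _).symm
  have hAB : A * Bᵀ = B * Aᵀ := (mul_transpose_eq_of_mem_symplectic κ.2).1
  -- The upper right block of κ' is (B - AS + S'(D - CS))/p. It is integral because C ≡ 0 and AᵀD ≡
  -- 1 modulo p, so that S'D ≡ AS - B.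
  set S' := A * S * Aᵀ - B * Aᵀ with hS'
  have hS't : S'ᵀ = S' := by
    rw [hS', transpose_sub, transpose_mul, transpose_mul, transpose_mul, transpose_transpose, hS,
      hAB, Matrix.mul_assoc]
  have hAD : (matrixMod p A)ᵀ * matrixMod p D = 1 := gamma0_transpose_mul hκ
  have hC0 : matrixMod p C = 0 := mem_siegelGamma0.1 hκ
  have hX : matrixMod p (B - A * S + S' * (D - C * S)) = matrixMod p 0 := by
    simp only [hS', map_add, map_sub, map_mul, hC0, matrixMod_transpose, zero_mul, sub_zero, sub_mul,
      mul_assoc, hAD, mul_one, map_zero]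
    abel
  obtain ⟨X, hX⟩ := (matrixMod_eq_iff p _ _).1 hX
  have heq : (κ : BlockMatrix n ℤ) * heckeAdjoint p S =
      heckeAdjoint p S' * fromBlocks (A + S' * C) X ((p : ℤ) • C) (D - C * S) := by
    rw [hκ', heckeAdjoint, heckeAdjoint, fromBlocks_multiply, fromBlocks_multiply, fromBlocks_inj]
    refine ⟨?_, ?_, ?_, ?_⟩
    · simp only [Matrix.mul_zero, add_zero, Matrix.mul_smul, Matrix.smul_mul, Matrix.mul_one,
        Matrix.one_mul, smul_add, Matrix.neg_mul, smul_neg, add_neg_cancel_right]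
    · rw [zero_add] at hX
      simp only [Matrix.smul_mul, Matrix.one_mul, ← hX]
      noncomm_ring
    · simp only [Matrix.mul_zero, add_zero, Matrix.mul_smul, Matrix.mul_one, Matrix.zero_mul,
        Matrix.one_mul, zero_add]
    · simp only [Matrix.zero_mul, Matrix.mul_one, Matrix.mul_neg, zero_add, Matrix.one_mul]
      abel
  have hmem := mem_symplectic_of_mul_eq (p := p) (heckeAdjoint_similitude hS)
    (heckeAdjoint_similitude hS't) heq
  refine ⟨S', hS't, rfl, ⟨_, hmem⟩, ?_, ?_, heq⟩
  · rw [mem_siegelGamma0]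
    change matrixMod p ((p : ℤ) • C) = 0
    rw [zsmul_eq_mul, map_mul, hC0, mul_zero]
  · rw [charDetD_eq, charDetD_eq]
    change ψ (matrixMod p (D - C * S)).det = _
    rw [map_sub, map_mul, hC0, zero_mul, sub_zero]

/-- Put η = g g'⁻¹, so that Hη = H'. The lower left block of η is annihilated by the nonsingular
lower right block of H; multiplying by the adjugate shows this over ℤ. -/
theorem parabolic_of_triangular_mul {H H' : BlockMatrix n ℤ} {g g' : symplecticGroup (Fin n) ℤ}
    (hC : H.toBlocks₂₁ = 0) (hC' : H'.toBlocks₂₁ = 0) (hD : H.toBlocks₂₂.det ≠ 0)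
    (h : H * g = H' * g') : ∃ η ∈ siegelParabolic n, g = η * g' ∧
      H.toBlocks₂₂ * (η : BlockMatrix n ℤ).toBlocks₂₂ = H'.toBlocks₂₂ := by
  have hη : H * ((g * g'⁻¹ : symplecticGroup (Fin n) ℤ) : BlockMatrix n ℤ) = H' := by
    rw [Submonoid.coe_mul, ← Matrix.mul_assoc, h, Matrix.mul_assoc, ← Submonoid.coe_mul,
      mul_inv_cancel, Submonoid.coe_one, Matrix.mul_one]
  have h₁ := congrArg toBlocks₂₁ hη
  have h₂ := congrArg toBlocks₂₂ hη
  rw [toBlocks₂₁_mul, hC, Matrix.zero_mul, zero_add, hC'] at h₁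
  rw [toBlocks₂₂_mul, hC, Matrix.zero_mul, zero_add] at h₂
  refine ⟨g * g'⁻¹, mem_siegelParabolic.2 ?_, by group, h₂⟩
  have h₃ := congrArg (fun M => H.toBlocks₂₂.adjugate * M) h₁
  simp only [← Matrix.mul_assoc, adjugate_mul, Matrix.smul_mul, Matrix.one_mul,
    Matrix.mul_zero] at h₃
  exact (smul_eq_zero.1 h₃).resolve_left hD

theorem det_parabolic {η : symplecticGroup (Fin n) ℤ} (hη : η ∈ siegelParabolic n) :
    (η : BlockMatrix n ℤ).toBlocks₂₂.det = 1 ∨ (η : BlockMatrix n ℤ).toBlocks₂₂.det = -1 := by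
  have h := (transpose_mul_eq_of_mem_symplectic η.2).2.2
  rw [mem_siegelParabolic.1 hη, transpose_zero, Matrix.zero_mul, sub_zero] at h
  have h' := congrArg det h
  rw [det_mul, det_one] at h'
  exact Int.isUnit_iff.1 (IsUnit.of_mul_eq_one_right _ h')

/-- The case n = 1: the matrix (0, -1; p, -d) is (x, y; 0, z) times w times (a, b; c, e), with w =
(0, -1; 1, 0) if d = 0 and w = 1 otherwise. For d = 0 it is (1, 0; 0, p) w. For d prime to p, a
Bézout relation ud + vp = 1 gives (p, u; 0, 1)(-u, -v; p, -d), whose second factor lies in Γ₀(p). -/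
theorem exists_local_factor (d : ℤ)
    (hd : d = 0 ∨ (d : ZMod p) ≠ 0) :
    ∃ a b c e x y z : ℤ, a * e - c * b = 1 ∧ (c : ZMod p) = 0 ∧
      (if d = 0 then e = 1 else (e : ZMod p) = -d) ∧ z = (if d = 0 then (p : ℤ) else 1) ∧
      0 = x * ((if d = 0 then 0 else 1) * a + (if d = 0 then -1 else 0) * c) +
        y * ((if d = 0 then 1 else 0) * a + (if d = 0 then 0 else 1) * c) ∧
      -1 = x * ((if d = 0 then 0 else 1) * b + (if d = 0 then -1 else 0) * e) +
        y * ((if d = 0 then 1 else 0) * b + (if d = 0 then 0 else 1) * e) ∧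
      (p : ℤ) = z * ((if d = 0 then 1 else 0) * a + (if d = 0 then 0 else 1) * c) ∧
      -d = z * ((if d = 0 then 1 else 0) * b + (if d = 0 then 0 else 1) * e) := by
  by_cases h : d = 0
  · subst h
    exact ⟨1, 0, 0, 1, 1, 0, p, by simp⟩
  · have hd' := hd.resolve_left h
    have hcop : IsCoprime d (p : ℤ) := by
      rw [Int.isCoprime_iff_gcd_eq_one, Int.gcd_comm, ← Int.isCoprime_iff_gcd_eq_one,
        Prime.coprime_iff_not_dvd (Nat.prime_iff_prime_int.1 Fact.out)]
      intro hdvd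
      exact hd' ((ZMod.intCast_zmod_eq_zero_iff_dvd _ _).2 hdvd)
    obtain ⟨u, v, huv⟩ := hcop
    refine ⟨-u, -v, p, -d, p, u, 1, by linarith, by simp, by simp [h], by simp [h], ?_, ?_, ?_, ?_⟩
    · simp [h]; ring
    · simp [h]; linarith
    · simp [h]
    · simp [h]

/-- The factorization of `w_J (p, -diag(d); 0, 1)`. -/
theorem exists_diagonal_factor (ψ : DirichletCharacter ℂ p) (I : Finset (Fin n)) (d : Fin n → ℤ)
    (hd : ∀ i, d i = 0 ∨ (d i : ZMod p) ≠ 0) (hdI : ∀ i ∉ I, d i = 0) :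
    ∃ H : BlockMatrix n ℤ, ∃ κ ∈ siegelGamma0 n p, H.toBlocks₂₁ = 0 ∧
      H.toBlocks₂₂.det = (p : ℤ) ^ (I.filter fun i => d i = 0).card ∧
      charDetD ψ κ = ∏ i, (if d i = 0 then 1 else ψ (-(d i : ZMod p))) ∧
      (weylElement I : BlockMatrix n ℤ) * heckeAdjoint p (diagonal d) =
        H * ((weylElement (I.filter fun i => d i = 0) * κ : symplecticGroup (Fin n) ℤ) :
          BlockMatrix n ℤ) := by
  have hloc : ∀ i, ∃ a b c e x y z : ℤ, a * e - c * b = 1 ∧ (c : ZMod p) = 0 ∧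
      (if d i = 0 then e = 1 else (e : ZMod p) = -d i) ∧
      z = (if i ∈ I.filter (fun i => d i = 0) then (p : ℤ) else 1) ∧
      (if i ∈ I then 0 else 1) * (p : ℤ) =
        x * ((if i ∈ I.filter (fun i => d i = 0) then 0 else 1) * a +
          (if i ∈ I.filter (fun i => d i = 0) then -1 else 0) * c) +
        y * ((if i ∈ I.filter (fun i => d i = 0) then 1 else 0) * a +
          (if i ∈ I.filter (fun i => d i = 0) then 0 else 1) * c) ∧
      (if i ∈ I then 0 else 1) * (-d i) + (if i ∈ I then -1 else 0) =
        x * ((if i ∈ I.filter (fun i => d i = 0) then 0 else 1) * b +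
          (if i ∈ I.filter (fun i => d i = 0) then -1 else 0) * e) +
        y * ((if i ∈ I.filter (fun i => d i = 0) then 1 else 0) * b +
          (if i ∈ I.filter (fun i => d i = 0) then 0 else 1) * e) ∧
      (if i ∈ I then 1 else 0) * (p : ℤ) =
        z * ((if i ∈ I.filter (fun i => d i = 0) then 1 else 0) * a +
          (if i ∈ I.filter (fun i => d i = 0) then 0 else 1) * c) ∧
      (if i ∈ I then 1 else 0) * (-d i) + (if i ∈ I then 0 else 1) =
        z * ((if i ∈ I.filter (fun i => d i = 0) then 1 else 0) * b +
          (if i ∈ I.filter (fun i => d i = 0) then 0 else 1) * e) := by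
    intro i
    by_cases hi : i ∈ I
    · obtain ⟨a, b, c, e, x, y, z, h₁, h₂, h₃, h₄, h₅, h₆, h₇, h₈⟩ :=
        exists_local_factor (d i) (hd i)
      refine ⟨a, b, c, e, x, y, z, h₁, h₂, h₃, ?_, ?_, ?_, ?_, ?_⟩
      · simpa [hi] using h₄
      · simpa [hi] using h₅
      · simpa [hi] using h₆
      · simpa [hi] using h₇
      · simpa [hi] using h₈
    -- Off I there is no Weyl factor and d = 0, so (p, 0; 0, 1) is already upper triangular.
    · refine ⟨1, 0, 0, 1, p, 0, 1, ?_⟩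
      simp [hi, hdI i hi]
  choose a b c e x y z h₁ h₂ h₃ h₄ h₅ h₆ h₇ h₈ using hloc
  refine ⟨fromBlocks (diagonal x) (diagonal y) 0 (diagonal z), diagonalElement a b c e h₁,
    ?_, by simp, ?_, ?_, ?_⟩
  · rw [mem_siegelGamma0]
    simp [diagonalElement, matrixMod_diagonal, h₂]
  · rw [toBlocks_fromBlocks₂₂, det_diagonal]
    simp only [h₄]
    rw [Finset.prod_ite, Finset.prod_const, Finset.prod_const_one, mul_one,
      Finset.filter_mem_eq_inter, Finset.univ_inter]
  · rw [charDetD_eq]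
    simp only [diagonalElement, toBlocks_fromBlocks₂₂, matrixMod_diagonal, det_diagonal, map_prod]
    refine Finset.prod_congr rfl fun i _ => ?_
    have := h₃ i
    by_cases hi : d i = 0
    · rw [if_pos hi] at this ⊢
      rw [this]; simp
    · rw [if_neg hi] at this ⊢
      rw [this]
  · have hp1 : ((p : ℤ) • (1 : Matrix (Fin n) (Fin n) ℤ)) = diagonal fun _ => (p : ℤ) := by
      rw [← diagonal_one, ← diagonal_smul]
      congr 1
      ext i
      simp
    change fromBlocks _ _ _ _ * fromBlocks _ _ _ _ =
      fromBlocks _ _ _ _ * (fromBlocks _ _ _ _ * fromBlocks _ _ _ _)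
    rw [hp1, fromBlocks_multiply, fromBlocks_multiply, fromBlocks_multiply, fromBlocks_inj]
    simp only [diagonal_mul_diagonal, diagonal_add, Matrix.mul_zero, Matrix.mul_one, add_zero,
      Matrix.zero_mul, zero_add, diagonal_neg]
    refine ⟨?_, ?_, ?_, ?_⟩ <;> congr 1 <;> ext i
    · exact h₅ i
    · exact h₆ i
    · exact h₇ i
    · exact h₈ i

end Triangular

/-! ### Integral congruence of symmetric matrices modulo `p` -/

section Congruence

variable {p : ℕ} [Fact p.Prime] {ι κ : Type*} [Fintype ι] [DecidableEq ι] [Fintype κ]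
  [DecidableEq κ]

/-- Congruence of matrices modulo `p` under `SL(ι, ℤ)`. -/
def IntegrallyCongruent (S T : Matrix ι ι (ZMod p)) : Prop :=
  ∃ U U' : Matrix ι ι ℤ, U * U' = 1 ∧ U.det = 1 ∧ matrixMod p U * S * (matrixMod p U)ᵀ = T

theorem IntegrallyCongruent.refl (S : Matrix ι ι (ZMod p)) : IntegrallyCongruent S S :=
  ⟨1, 1, by simp, by simp, by simp⟩

theorem IntegrallyCongruent.trans {S T W : Matrix ι ι (ZMod p)} (h : IntegrallyCongruent S T)
    (h' : IntegrallyCongruent T W) : IntegrallyCongruent S W := by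
  obtain ⟨U, U', h₁, h₂, h₃⟩ := h
  obtain ⟨V, V', h₁', h₂', h₃'⟩ := h'
  refine ⟨V * U, U' * V', ?_, by rw [det_mul, h₂, h₂', mul_one], ?_⟩
  · rw [Matrix.mul_assoc, ← Matrix.mul_assoc U, h₁, Matrix.one_mul, h₁']
  · rw [← h₃', ← h₃, map_mul, transpose_mul]
    simp only [Matrix.mul_assoc]

theorem IntegrallyCongruent.reindex {S T : Matrix ι ι (ZMod p)} (h : IntegrallyCongruent S T)
    (e : ι ≃ κ) : IntegrallyCongruent (Matrix.reindex e e S) (Matrix.reindex e e T) := by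
  obtain ⟨U, U', h₁, h₂, h₃⟩ := h
  refine ⟨Matrix.reindex e e U, Matrix.reindex e e U', ?_, ?_, ?_⟩
  · simp [reindex_apply, submatrix_mul_equiv, h₁]
  · simpa using h₂
  · have : matrixMod p (Matrix.reindex e e U) = Matrix.reindex e e (matrixMod p U) := rfl
    rw [this, ← h₃]
    simp [reindex_apply, submatrix_mul_equiv, transpose_submatrix]

end Congruence

/-! ### Triangular factorization of w_j (p, -S; 0, 1) -/

section Factor

variable {n p : ℕ} [Fact p.Prime] {ψ : DirichletCharacter ℂ p}

/-- Conjugation by w_I moves only the block eRe to the lower left corner. When it vanishes, the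
conjugate stays in P, and its lower right block 1 + eR(1 - e) has determinant 1. -/
theorem weylElement_mul_unipotent (I : Finset (Fin n)) {R : Matrix (Fin n) (Fin n) ℤ} (hR : Rᵀ = R)
    (heRe : coordProj ℤ I * R * coordProj ℤ I = 0) :
    ∃ h ∈ siegelParabolic n, (h : BlockMatrix n ℤ).toBlocks₂₂.det = 1 ∧
      weylElement I * unipotentElement R hR = h * weylElement I := by
  set e := coordProj ℤ I with he
  have hee : e * e = e := coordProj_mul_self _ _
  set w := weylElement I with hw
  set u := unipotentElement R hR with hu
  have hbot : ((w * u : symplecticGroup (Fin n) ℤ) : BlockMatrix n ℤ) =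
      fromBlocks (1 - e) ((1 - e) * R - e) e (e * R + (1 - e)) := by
    have hu' : (u : BlockMatrix n ℤ) = fromBlocks 1 R 0 1 := rfl
    rw [Submonoid.coe_mul, hw, coe_weylElement, hu', fromBlocks_multiply, ← he]
    simp [sub_eq_add_neg]
  have hef : e * (1 - e) = 0 := by rw [mul_sub, mul_one, hee, sub_self]
  have hfe : (1 - e) * e = 0 := by rw [sub_mul, one_mul, hee, sub_self]
  refine ⟨w * u * w⁻¹, mem_siegelParabolic.2 ?_, ?_, by group⟩
  · rw [Submonoid.coe_mul, toBlocks₂₁_mul, hbot, hw, coe_weylElement_inv, ← he]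
    simp only [toBlocks_fromBlocks₂₁, toBlocks_fromBlocks₂₂, toBlocks_fromBlocks₁₁, hef, mul_neg,
      add_mul, hfe, heRe]
    simp
  · rw [Submonoid.coe_mul, toBlocks₂₂_mul, hbot, hw, coe_weylElement_inv, ← he]
    simp only [toBlocks_fromBlocks₂₁, toBlocks_fromBlocks₂₂, toBlocks_fromBlocks₁₂]
    have h1 : e * e + (e * R + (1 - e)) * (1 - e) = 1 + e * (R * (1 - e)) := by
      rw [hee]
      simp only [add_mul, sub_mul, mul_sub, one_mul, mul_one, hee]
      noncomm_ring
    rw [h1, det_one_add_mul_comm, mul_assoc, hfe, mul_zero, add_zero, det_one]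

/-- V acts on the coordinates in I only, and there w_I is the full J, which exchanges the two Levi
blocks. -/
theorem weylElement_mul_levi (I : Finset (Fin n)) {V V' : Matrix (Fin n) (Fin n) ℤ}
    (hV : V * V' = 1) (hf : (1 - coordProj ℤ I) * V = 1 - coordProj ℤ I)
    (hf' : V * (1 - coordProj ℤ I) = 1 - coordProj ℤ I) :
    weylElement I * (leviElement V V'ᵀ (by rw [← transpose_mul, mul_eq_one_comm.1 hV,
        transpose_one]))⁻¹ =
      leviElement Vᵀ V' (by rw [transpose_transpose, hV]) * weylElement I := by
  have hV' : V' * V = 1 := mul_eq_one_comm.1 hV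
  set e := coordProj ℤ I with he
  have hft : Vᵀ * (1 - e) = 1 - e := by
    have := congrArg transpose hf
    rwa [transpose_mul, transpose_sub, transpose_one, coordProj_transpose] at this
  have hft' : (1 - e) * Vᵀ = 1 - e := by
    have := congrArg transpose hf'
    rwa [transpose_mul, transpose_sub, transpose_one, coordProj_transpose] at this
  have h3 : (1 - e) * V' = 1 - e := by
    calc _ = (1 - e) * V * V' := by rw [hf]
      _ = _ := by rw [Matrix.mul_assoc, hV, Matrix.mul_one]
  have h4 : V' * (1 - e) = 1 - e := by
    calc _ = V' * (V * (1 - e)) := by rw [hf']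
      _ = _ := by rw [← Matrix.mul_assoc, hV', Matrix.one_mul]
  have hcomm : e * V' = V' * e := by
    have := h3.trans h4.symm
    rw [sub_mul, mul_sub, one_mul, mul_one] at this
    exact sub_right_injective this
  have hcomm' : e * Vᵀ = Vᵀ * e := by
    have := hft'.trans hft.symm
    rw [sub_mul, mul_sub, one_mul, mul_one] at this
    exact sub_right_injective this
  apply Subtype.ext
  rw [Submonoid.coe_mul, Submonoid.coe_mul, coe_inv_eq_fromBlocks, coe_weylElement]
  change fromBlocks _ _ _ _ * fromBlocks V'ᵀᵀ (-0ᵀ) (-0ᵀ) Vᵀ = fromBlocks Vᵀ 0 0 V' * _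
  rw [fromBlocks_multiply, fromBlocks_multiply, ← he, transpose_transpose, fromBlocks_inj]
  refine ⟨?_, ?_, ?_, ?_⟩
  · rw [h3, hft]; simp
  · rw [neg_mul, hcomm']; simp
  · rw [hcomm]; simp
  · rw [hft', h4]; simp

theorem heckeAdjoint_levi {V V' S : Matrix (Fin n) (Fin n) ℤ} (hV : V * V' = 1) :
    ((leviElement V V'ᵀ (by rw [← transpose_mul, mul_eq_one_comm.1 hV,
        transpose_one]) : symplecticGroup (Fin n) ℤ) : BlockMatrix n ℤ) * heckeAdjoint p S =
      heckeAdjoint p (V * S * Vᵀ) * ((leviElement V V'ᵀ (by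
        rw [← transpose_mul, mul_eq_one_comm.1 hV, transpose_one]) :
          symplecticGroup (Fin n) ℤ) : BlockMatrix n ℤ) := by
  have h : Vᵀ * V'ᵀ = 1 := by rw [← transpose_mul, mul_eq_one_comm.1 hV, transpose_one]
  change fromBlocks V 0 0 V'ᵀ * fromBlocks _ _ _ _ =
    fromBlocks _ _ _ _ * fromBlocks V 0 0 V'ᵀ
  rw [fromBlocks_multiply, fromBlocks_multiply]
  simp only [Matrix.mul_zero, Matrix.zero_mul, add_zero, zero_add, Matrix.mul_smul, Matrix.smul_mul,
    Matrix.mul_one, Matrix.one_mul, Matrix.mul_neg, Matrix.neg_mul, Matrix.mul_assoc, h, neg_zero,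
    smul_zero, zero_add]

/-- Unipotent factors on the left translate S by arbitrary symmetric matrices, those on the right by
multiples of p only. The former will be moved past w_j into P, the latter absorbed into Γ₀(p). -/
theorem heckeAdjoint_add (R S X : Matrix (Fin n) (Fin n) ℤ) (hR : Rᵀ = R) (hX : Xᵀ = X) :
    heckeAdjoint p (R + S + (p : ℤ) • X) =
      (unipotentElement (-R) (by rw [transpose_neg, hR]) : BlockMatrix n ℤ) * heckeAdjoint p S *
        (unipotentElement (-X) (by rw [transpose_neg, hX]) : BlockMatrix n ℤ) := by
  change _ = fromBlocks 1 (-R) 0 1 * fromBlocks _ _ _ _ * fromBlocks 1 (-X) 0 1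
  rw [heckeAdjoint, fromBlocks_multiply, fromBlocks_multiply, fromBlocks_inj]
  refine ⟨by simp, ?_, by simp, by simp⟩
  simp only [Matrix.one_mul, Matrix.mul_zero, Matrix.mul_one, Matrix.mul_neg, Matrix.smul_mul,
    add_zero]
  abel

/-- A Levi element diagonalizes the leading block of S modulo p. The new S splits as R + diag(d') +
pX with R zero in that block: R passes through w_j into P, pX goes to Γ₀(p), and the diagonal part
is treated one coordinate at a time. All auxiliary factors have determinant 1, so neither ψ* nor the
determinant of H sees them. -/
theorem exists_triangular_factor (hψ : ∀ x : ZMod p, x ≠ 0 → ψ x ^ 2 = 1) {j m : ℕ}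
    {S : Matrix (Fin (j + m)) (Fin (j + m)) ℤ} (hS : Sᵀ = S) {d : Fin j → ZMod p}
    (hd : IntegrallyCongruent ((matrixMod p S).submatrix (Fin.castAdd m) (Fin.castAdd m))
      (diagonal d)) :
    ∃ (H : BlockMatrix (j + m) ℤ) (γ : symplecticGroup (Fin (j + m)) ℤ), H.toBlocks₂₁ = 0 ∧
      H.toBlocks₂₂.det = (p : ℤ) ^ (Finset.univ.filter fun i => d i = 0).card ∧
      (cuspElement (j + m) j : BlockMatrix (j + m) ℤ) * heckeAdjoint p S = H * γ ∧
      ∀ r ≤ j + m, psiStar ψ r γ = if r = (Finset.univ.filter fun i => d i = 0).card then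
        ∏ i, (if d i = 0 then 1 else ψ (-d i)) else 0 := by
  obtain ⟨U, U', hUU', hU, hUd⟩ := hd
  have hU'U : U' * U = 1 := mul_eq_one_comm.1 hUU'
  set ρ := reindexAlgEquiv ℤ ℤ (finSumFinEquiv : Fin j ⊕ Fin m ≃ Fin (j + m)) with hρ
  set I : Finset (Fin (j + m)) := Finset.univ.filter fun i => i.val < j with hI
  set e := coordProj ℤ I with he
  have hee : e * e = e := coordProj_mul_self _ _
  have hρt : ∀ M, (ρ M)ᵀ = ρ Mᵀ := fun M => rfl
  have heρ : e = ρ (fromBlocks 1 0 0 0) := by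
    rw [← ρ.symm_apply_eq]
    ext i k
    change (diagonal fun i => if i ∈ I then (1 : ℤ) else 0) (finSumFinEquiv i) (finSumFinEquiv k) = _
    rcases i with i | i <;> rcases k with k | k
    · by_cases hik : i = k
      · subst hik; simp [hI]
      · simp [hik]
    · rw [diagonal_apply_ne _ (finSumFinEquiv.injective.ne (by simp))]; simp
    · rw [diagonal_apply_ne _ (finSumFinEquiv.injective.ne (by simp))]; simp
    · by_cases hik : i = k
      · subst hik; simp [hI]
      · simp [hik]
  have hfρ : 1 - e = ρ (fromBlocks 0 0 0 1) := by
    rw [heρ, ← map_one ρ, ← map_sub, ← fromBlocks_one]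
    congr 1
    rw [sub_eq_add_neg, fromBlocks_neg, fromBlocks_add]
    simp
  set V := ρ (fromBlocks U 0 0 1) with hV
  set V' := ρ (fromBlocks U' 0 0 1) with hV'
  have hVV' : V * V' = 1 := by
    rw [hV, hV', ← map_mul, fromBlocks_multiply]
    simp [hUU']
  have hVdet : V.det = 1 := by
    rw [hV, hρ, det_reindexAlgEquiv]
    simpa using hU
  have hV'det : V'.det = 1 := by
    have := congrArg det hVV'
    rwa [det_mul, hVdet, one_mul, det_one] at this
  have hf : (1 - e) * V = 1 - e := by
    rw [hfρ, hV, ← map_mul, fromBlocks_multiply]; simp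
  have hf' : V * (1 - e) = 1 - e := by
    rw [hfρ, hV, ← map_mul, fromBlocks_multiply]; simp
  set S₁ := V * S * Vᵀ with hS₁
  have hS₁t : S₁ᵀ = S₁ := by
    rw [hS₁, transpose_mul, transpose_mul, transpose_transpose, hS, Matrix.mul_assoc]
  -- The representatives in [0, p) make an entry that vanishes modulo p vanish exactly, as
  -- `exists_diagonal_factor` requires.
  set d' : Fin (j + m) → ℤ := Fin.append (fun i => ((d i).val : ℤ)) (fun _ => 0) with hd'
  have hd'1 : ∀ i, d' (Fin.castAdd m i) = (d i).val := fun i => Fin.append_left _ _ i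
  have hd'2 : ∀ i, d' (Fin.natAdd j i) = 0 := fun i => Fin.append_right _ _ i
  have hd'1z : ∀ i, d' (Fin.castAdd m i) = 0 ↔ d i = 0 := fun i => by
    rw [hd'1, Nat.cast_eq_zero, ZMod.val_eq_zero]
  have hd'1c : ∀ i, (d' (Fin.castAdd m i) : ZMod p) = d i := fun i => by
    rw [hd'1]; simp
  have hmod : matrixMod p (e * S₁ * e) = matrixMod p (diagonal d') := by
    have h1 : e * S₁ * e = ρ (fromBlocks (U * (ρ.symm S).toBlocks₁₁ * Uᵀ) 0 0 0) := by
      have h2 : S = ρ (fromBlocks (ρ.symm S).toBlocks₁₁ (ρ.symm S).toBlocks₁₂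
          (ρ.symm S).toBlocks₂₁ (ρ.symm S).toBlocks₂₂) := by
        rw [fromBlocks_toBlocks, AlgEquiv.apply_symm_apply]
      conv_lhs => rw [hS₁, h2]
      rw [hV, hρt, heρ]
      simp only [← map_mul, fromBlocks_multiply, fromBlocks_transpose]
      simp
    have h3 : matrixMod p (U * (ρ.symm S).toBlocks₁₁ * Uᵀ) = diagonal d := by
      rw [map_mul, map_mul, matrixMod_transpose, ← hUd]
      rfl
    rw [h1, matrixMod_diagonal]
    ext i k
    obtain ⟨i, rfl⟩ := finSumFinEquiv.surjective i
    obtain ⟨k, rfl⟩ := finSumFinEquiv.surjective k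
    have h4 : matrixMod p (ρ (fromBlocks (U * (ρ.symm S).toBlocks₁₁ * Uᵀ) 0 0 0))
        (finSumFinEquiv i) (finSumFinEquiv k) =
        ((fromBlocks (U * (ρ.symm S).toBlocks₁₁ * Uᵀ) 0 0 0 : Matrix (Fin j ⊕ Fin m) _ ℤ) i k :
          ZMod p) := by
      rw [matrixMod_apply, hρ, coe_reindexAlgEquiv, reindex_apply, submatrix_apply,
        Equiv.symm_apply_apply, Equiv.symm_apply_apply]
    rw [h4]
    rcases i with i | i <;> rcases k with k | k
    · have := congrFun (congrFun h3 i) k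
      rw [matrixMod_apply] at this
      rw [fromBlocks_apply₁₁, this]
      by_cases hik : i = k
      · subst hik
        simp [hd'1]
      · simp [hik]
    · rw [diagonal_apply_ne _ (finSumFinEquiv.injective.ne (by simp))]; simp
    · rw [diagonal_apply_ne _ (finSumFinEquiv.injective.ne (by simp))]; simp
    · by_cases hik : i = k
      · subst hik
        simp [hd'2]
      · simp [hik]
  obtain ⟨X, hX⟩ := (matrixMod_eq_iff p _ _).1 hmod
  have het : eᵀ = e := coordProj_transpose _ _
  have heSt : (e * S₁ * e)ᵀ = e * S₁ * e := by
    rw [transpose_mul, transpose_mul, het, hS₁t, Matrix.mul_assoc e S₁ e]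
  -- X is determined by pX = eS₁e - diag(d'), and the right side is symmetric.
  have hXt : Xᵀ = X := by
    have h1 : (p : ℤ) • Xᵀ = (p : ℤ) • X := by
      rw [← transpose_smul, eq_sub_of_add_eq' hX.symm, transpose_sub, heSt, diagonal_transpose]
    exact smul_right_injective _ (Int.natCast_ne_zero.2 (Fact.out : p.Prime).ne_zero) h1
  set R := S₁ - e * S₁ * e with hR
  have hRt : Rᵀ = R := by rw [hR, transpose_sub, hS₁t, heSt]
  have heRe : e * R * e = 0 := by
    have : e * (e * S₁ * e) * e = e * S₁ * e := by
      rw [← Matrix.mul_assoc, ← Matrix.mul_assoc, hee, Matrix.mul_assoc _ e e, hee]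
    rw [hR, mul_sub, sub_mul, this, sub_self]
  have hS₁' : S₁ = R + diagonal d' + (p : ℤ) • X := by
    rw [add_assoc, ← hX, hR]; abel
  have hd'0 : ∀ i, d' i = 0 ∨ (d' i : ZMod p) ≠ 0 := by
    intro i
    obtain ⟨i, rfl⟩ := finSumFinEquiv.surjective i
    rcases i with i | i
    · rw [finSumFinEquiv_apply_left, hd'1z, hd'1c]
      exact em _
    · left; rw [finSumFinEquiv_apply_right, hd'2]
  have hd'I : ∀ i ∉ I, d' i = 0 := by
    intro i hi
    obtain ⟨i, rfl⟩ := finSumFinEquiv.surjective i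
    rcases i with i | i
    · exact absurd (by simp [hI]) hi
    · rw [finSumFinEquiv_apply_right, hd'2]
  obtain ⟨H, κ, hκ, hHC, hHD, hκψ, hfac⟩ := exists_diagonal_factor ψ I d' hd'0 hd'I
  have hcard : (I.filter fun i => d' i = 0).card = (Finset.univ.filter fun i => d i = 0).card := by
    rw [hI, Finset.filter_filter, Finset.card_filter, Finset.card_filter, Fin.sum_univ_add]
    simp [hd'1z, hd'1c, hd'2]
  have hprod : ∏ i, (if d' i = 0 then 1 else ψ (-(d' i : ZMod p))) =
      ∏ i, (if d i = 0 then 1 else ψ (-d i)) := by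
    rw [Fin.prod_univ_add]
    simp [hd'1z, hd'1c, hd'2]
  obtain ⟨h, hhP, hhdet, hhw⟩ := weylElement_mul_unipotent I (R := -R)
    (by rw [transpose_neg, hRt]) (by rw [← he, mul_neg, neg_mul, heRe, neg_zero])
  set μ := leviElement V V'ᵀ (by rw [← transpose_mul, mul_eq_one_comm.1 hVV', transpose_one]) with hμ
  set μ' := leviElement Vᵀ V' (by rw [transpose_transpose, hVV']) with hμ'
  set u := unipotentElement (-X) (by rw [transpose_neg, hXt]) with hu
  have hμw : weylElement I * μ⁻¹ = μ' * weylElement I := weylElement_mul_levi I hVV' hf hf'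
  have hμT : (μ : BlockMatrix (j + m) ℤ) * heckeAdjoint p S = heckeAdjoint p S₁ * μ :=
    heckeAdjoint_levi hVV'
  have hμ'C : (μ' : BlockMatrix (j + m) ℤ).toBlocks₂₁ = 0 := by simp [hμ', leviElement]
  have hμ'D : (μ' : BlockMatrix (j + m) ℤ).toBlocks₂₂ = V' := by simp [hμ', leviElement]
  have hhC := mem_siegelParabolic.1 hhP
  have hμΓ : μ ∈ siegelGamma0 (j + m) p := mem_siegelGamma0.2 (by simp [hμ, leviElement])
  have huΓ : u ∈ siegelGamma0 (j + m) p := mem_siegelGamma0.2 (by simp [hu, unipotentElement])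
  refine ⟨μ' * h * H, weylElement (I.filter fun i => d' i = 0) * (κ * u * μ), ?_, ?_, ?_, ?_⟩
  · rw [toBlocks₂₁_mul, toBlocks₂₁_mul, hμ'C, hhC, hHC]; simp
  · rw [toBlocks₂₂_mul, toBlocks₂₁_mul, toBlocks₂₂_mul, hμ'C, hhC, hμ'D, ← hcard, ← hHD]
    simp [hV'det, hhdet]
  · have h1 : (weylElement I : BlockMatrix (j + m) ℤ) * heckeAdjoint p S =
        ((weylElement I * μ⁻¹ : symplecticGroup (Fin (j + m)) ℤ) : BlockMatrix (j + m) ℤ) *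
          (μ * heckeAdjoint p S) := by
      rw [← Matrix.mul_assoc, ← Submonoid.coe_mul, inv_mul_cancel_right]
    rw [cuspElement_eq_weylElement, ← hI, h1, hμw, hμT, hS₁', heckeAdjoint_add _ _ _ hRt hXt]
    have h2 := congrArg (Subtype.val) hhw
    rw [Submonoid.coe_mul, Submonoid.coe_mul] at h2
    rw [Submonoid.coe_mul] at hfac
    rw [Submonoid.coe_mul, Submonoid.coe_mul, Submonoid.coe_mul, Submonoid.coe_mul]
    calc _ = (μ' : BlockMatrix (j + m) ℤ) * ((weylElement I : BlockMatrix (j + m) ℤ) *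
          (unipotentElement (-R) (by rw [transpose_neg, hRt]) : BlockMatrix (j + m) ℤ)) *
          heckeAdjoint p (diagonal d') * u * μ := by
            simp only [Matrix.mul_assoc]
            rfl
      _ = μ' * h * ((weylElement I : BlockMatrix (j + m) ℤ) * heckeAdjoint p (diagonal d')) * u * μ := by
            rw [h2]; simp only [Matrix.mul_assoc]
      _ = _ := by rw [hfac]; simp only [Matrix.mul_assoc]
  · intro r hr
    rw [psiStar_weylElement hψ hr _ (mul_mem (mul_mem hκ huΓ) hμΓ), hcard,
      charDetD_mul ψ (mul_mem hκ huΓ), charDetD_mul ψ hκ, hκψ, hprod]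
    have h1 : charDetD ψ u = 1 := by simp [charDetD, hu, unipotentElement]
    have h2 : charDetD ψ μ = 1 := by simp [charDetD, hμ, leviElement, hV'det]
    rw [h1, h2, mul_one, mul_one]

end Factor

/-! ### Diagonalization of bordered matrices modulo `p` -/

section Bordered

variable {p : ℕ} [Fact p.Prime] {ι κ : Type*} [Fintype ι] [DecidableEq ι] [Fintype κ]
  [DecidableEq κ]

/-- The symmetric matrix obtained from `S` by adding a row and a column. -/
def borderedMatrix {R : Type*} (S : Matrix κ κ R) (β : κ → R) (a : R) :
    Matrix (κ ⊕ Unit) (κ ⊕ Unit) R :=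
  fromBlocks S (replicateCol Unit β) (replicateRow Unit β) (of fun _ _ => a)

theorem borderedMatrix_diagonal {R : Type*} [Zero R] (d : κ → R) (a : R) :
    borderedMatrix (diagonal d) 0 a = diagonal (Sum.elim d fun _ => a) := by
  have h : (of fun _ _ => a : Matrix Unit Unit R) = diagonal fun _ => a := by
    ext i j; simp
  rw [borderedMatrix, h, ← fromBlocks_diagonal]
  rfl

theorem integrallyCongruent_bordered {U U' : Matrix κ κ ℤ} (h : U * U' = 1) (hU : U.det = 1)
    (S : Matrix κ κ (ZMod p)) (β : κ → ZMod p) (a : ZMod p) :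
    IntegrallyCongruent (borderedMatrix S β a)
      (borderedMatrix (matrixMod p U * S * (matrixMod p U)ᵀ) (matrixMod p U *ᵥ β) a) := by
  refine ⟨fromBlocks U 0 0 1, fromBlocks U' 0 0 1, ?_, by simpa using hU, ?_⟩
  · rw [fromBlocks_multiply]
    simp [h]
  · have h1 : matrixMod p (fromBlocks U 0 0 1 : Matrix (κ ⊕ Unit) (κ ⊕ Unit) ℤ) =
        fromBlocks (matrixMod p U) 0 0 1 := by
      ext i j
      rcases i with i | i <;> rcases j with j | j <;> simp [matrixMod_apply]
    rw [h1, borderedMatrix, borderedMatrix, fromBlocks_transpose, fromBlocks_multiply,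
      fromBlocks_multiply, fromBlocks_inj]
    refine ⟨by simp, ?_, ?_, by simp⟩
    · simp [replicateCol_mulVec]
    · ext i j
      simp [mul_apply, mulVec, dotProduct, mul_comm]

/-- The last row and column are modified by the multiples c l of the others; with c l = -β l / d l
this completes the square. -/
theorem integrallyCongruent_addRow (d β c : κ → ZMod p) (a : ZMod p) :
    IntegrallyCongruent (borderedMatrix (diagonal d) β a)
      (borderedMatrix (diagonal d) (fun l => β l + d l * c l)
        (a + ∑ l, c l * (2 * β l + d l * c l))) := by
  refine ⟨fromBlocks 1 0 (replicateRow Unit fun l => ((c l).val : ℤ)) 1,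
    fromBlocks 1 0 (-replicateRow Unit fun l => ((c l).val : ℤ)) 1, ?_, by simp, ?_⟩
  · rw [fromBlocks_multiply]
    simp
  · have h1 : matrixMod p (fromBlocks 1 0 (replicateRow Unit fun l => ((c l).val : ℤ)) 1 :
        Matrix (κ ⊕ Unit) (κ ⊕ Unit) ℤ) = fromBlocks 1 0 (replicateRow Unit c) 1 := by
      ext i j
      rcases i with i | i <;> rcases j with j | j
      · by_cases h : i = j
        · subst h; simp [matrixMod_apply]
        · simp [matrixMod_apply, h]
      · simp [matrixMod_apply]
      · simp [matrixMod_apply]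
      · simp [matrixMod_apply]
    rw [h1, borderedMatrix, borderedMatrix, fromBlocks_transpose, fromBlocks_multiply,
      fromBlocks_multiply, fromBlocks_inj]
    refine ⟨by simp, ?_, ?_, ?_⟩
    · ext i j
      simp [mul_apply, add_comm, diagonal_apply]
    · ext i j
      simp [mul_apply, mul_comm, add_comm, diagonal_apply]
    · ext i j
      simp [mul_apply, diagonal_apply, add_mul, Finset.sum_add_distrib]
      have h2 : ∑ l, c l * (2 * β l + d l * c l) =
          ∑ x, c x * d x * c x + (∑ x, β x * c x + ∑ x, c x * β x) := by
        rw [← Finset.sum_add_distrib, ← Finset.sum_add_distrib]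
        exact Finset.sum_congr rfl fun l _ => by ring
      rw [h2]
      ring

/-- Adding t times the last row and column to those of index l₀ makes an isotropic diagonal entry
nonzero, for a suitable t. -/
theorem integrallyCongruent_addCol (d : κ → ZMod p) (l₀ : κ) (hl₀ : d l₀ = 0) (b a t : ZMod p) :
    IntegrallyCongruent (borderedMatrix (diagonal d) (Pi.single l₀ b) a)
      (borderedMatrix (diagonal (Function.update d l₀ (2 * t * b + t ^ 2 * a)))
        (Pi.single l₀ (b + t * a)) a) := by
  refine ⟨fromBlocks 1 (replicateCol Unit (Pi.single l₀ (t.val : ℤ))) 0 1,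
    fromBlocks 1 (-replicateCol Unit (Pi.single l₀ (t.val : ℤ))) 0 1, ?_, by simp, ?_⟩
  · rw [fromBlocks_multiply]
    simp
  · have h1 : matrixMod p (fromBlocks 1 (replicateCol Unit (Pi.single l₀ (t.val : ℤ))) 0 1 :
        Matrix (κ ⊕ Unit) (κ ⊕ Unit) ℤ) =
        fromBlocks 1 (replicateCol Unit (Pi.single l₀ t)) 0 1 := by
      ext i j
      rcases i with i | i <;> rcases j with j | j
      · by_cases h : i = j
        · subst h; simp [matrixMod_apply]
        · simp [matrixMod_apply, h]
      · by_cases h : i = l₀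
        · subst h; simp [matrixMod_apply]
        · simp [matrixMod_apply, h]
      · simp [matrixMod_apply]
      · simp [matrixMod_apply]
    rw [h1, borderedMatrix, borderedMatrix, fromBlocks_transpose, fromBlocks_multiply,
      fromBlocks_multiply, fromBlocks_inj]
    refine ⟨?_, ?_, ?_, ?_⟩
    · ext i j
      by_cases hi : i = l₀
      · subst hi
        by_cases hj : i = j
        · subst hj
          simp [mul_apply, hl₀]
          ring
        · simp [mul_apply, hj, Ne.symm hj, Pi.single_apply, eq_comm]
      · by_cases hij : i = j
        · subst hij; simp [mul_apply, hi, Function.update_of_ne hi]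
        · simp [mul_apply, hi, hij]
    · ext i j
      by_cases hi : i = l₀
      · subst hi; simp [mul_apply]
      · simp [mul_apply, hi]
    · ext i j
      by_cases hj : j = l₀
      · subst hj; simp [mul_apply, mul_comm]
      · simp [mul_apply, hj]
    · simp

/-- The pivot β l₀ clears the other entries of β. Since d l₀ = 0, the row operations with row l₀
leave the diagonal block unchanged. -/
theorem integrallyCongruent_single (d β : κ → ZMod p) (l₀ : κ) (hl₀ : d l₀ = 0) (hβ : β l₀ ≠ 0)
    (a : ZMod p) :
    IntegrallyCongruent (borderedMatrix (diagonal d) β a)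
      (borderedMatrix (diagonal d) (Pi.single l₀ (β l₀)) a) := by
  set w : κ → ZMod p := fun i => if i = l₀ then 0 else -β i / β l₀ with hw
  set w' : κ → ℤ := fun i => ((w i).val : ℤ) with hw'
  have hw'0 : w' l₀ = 0 := by simp [hw', hw]
  have hrow : replicateRow Unit (Pi.single l₀ (1 : ℤ)) * replicateCol Unit w' = 0 := by
    ext i j
    simp [mul_apply, Pi.single_apply, hw'0]
  -- N has square zero because w' vanishes at l₀, so 1 + N is invertible over ℤ with determinant 1.
  set N := replicateCol Unit w' * replicateRow Unit (Pi.single l₀ (1 : ℤ)) with hN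
  have hNN : N * N = 0 := by
    rw [hN, Matrix.mul_assoc, ← Matrix.mul_assoc (replicateRow _ _), hrow]
    simp
  have hmul : (1 + N) * (1 - N) = 1 := by
    rw [mul_sub, mul_one, add_mul, one_mul, hNN]; abel
  have hdet : (1 + N).det = 1 := by
    rw [hN, det_one_add_replicateCol_mul_replicateRow]
    simp [hw'0]
  have h := integrallyCongruent_bordered hmul hdet (diagonal d) β a
  have hmod : ∀ i k, matrixMod p (1 + N) i k =
      (if i = k then 1 else 0) + w i * (if k = l₀ then 1 else 0) := by
    intro i k
    rw [matrixMod_apply, Matrix.add_apply, hN, mul_apply]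
    simp [one_apply, Pi.single_apply, hw']
  have h1 : matrixMod p (1 + N) * diagonal d = diagonal d := by
    ext i k
    rw [mul_diagonal, hmod]
    by_cases hk : k = l₀
    · subst hk
      simp only [hl₀, mul_zero, diagonal_apply]
      split_ifs with hik
      · rw [hik, hl₀]
      · rfl
    · by_cases hik : i = k
      · subst hik; simp [hk]
      · simp [hk, hik]
  have h2 : matrixMod p (1 + N) * diagonal d * (matrixMod p (1 + N))ᵀ = diagonal d := by
    rw [h1, ← diagonal_transpose d, ← transpose_mul, h1]
  have h3 : matrixMod p (1 + N) *ᵥ β = Pi.single l₀ (β l₀) := by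
    ext i
    simp only [mulVec, dotProduct, hmod, add_mul, Finset.sum_add_distrib]
    by_cases hi : i = l₀
    · subst hi; simp [hw]
    · simp [hw, hi]
      field_simp
      ring
  rwa [h2, h3] at h

/-- The border lies in the column space of the diagonal block, so completing the square splits off
the Schur complement. Division by zero is harmless: β l = 0 whenever d l = 0. -/
theorem integrallyCongruent_of_mem_range (d β : κ → ZMod p) (hβ : ∀ l, d l = 0 → β l = 0)
    (a : ZMod p) :
    IntegrallyCongruent (borderedMatrix (diagonal d) β a)
      (diagonal (Sum.elim d fun _ => a - ∑ l, β l ^ 2 / d l)) := by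
  have h := integrallyCongruent_addRow d β (fun l => -β l / d l) a
  have h1 : (fun l => β l + d l * (-β l / d l)) = 0 := by
    ext l
    by_cases hl : d l = 0
    · simp [hl, hβ l hl]
    · simp; field_simp; ring
  have h2 : a + ∑ l, (-β l / d l) * (2 * β l + d l * (-β l / d l)) = a - ∑ l, β l ^ 2 / d l := by
    rw [sub_eq_add_neg, ← Finset.sum_neg_distrib]
    congr 1
    refine Finset.sum_congr rfl fun l _ => ?_
    by_cases hl : d l = 0
    · simp [hl]
    · field_simp; ring
  rwa [h1, h2, borderedMatrix_diagonal] at h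

/-- A border outside the column space pairs a null vector of the block with the new coordinate. The
plane they span has the form (0, b; b, a₁), of determinant -b²: the rank rises by two, and the new
diagonal entries satisfy xy = -b² whatever the corner entry is. -/
theorem integrallyCongruent_of_notMem_range (hp : p ≠ 2) (d β : κ → ZMod p) {l₁ : κ}
    (hd : d l₁ = 0) (hβ : β l₁ ≠ 0) (a : ZMod p) :
    ∃ l₀ x y b, d l₀ = 0 ∧ b ≠ 0 ∧ x * y = -b ^ 2 ∧
      IntegrallyCongruent (borderedMatrix (diagonal d) β a)
        (diagonal (Sum.elim (Function.update d l₀ x) fun _ => y)) := by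
  have h2 : (2 : ZMod p) ≠ 0 := by
    have := ZMod.ringChar_zmod_n p
    exact Ring.two_ne_zero (by rwa [this])
  have h₁ := integrallyCongruent_addRow d β (fun l => -β l / d l) a
  set a₁ := a + ∑ l, (-β l / d l) * (2 * β l + d l * (-β l / d l)) with ha₁
  set β₁ := fun l => β l + d l * (-β l / d l) with hβ₁
  have hβ₁l : β₁ l₁ = β l₁ := by simp [hβ₁, hd]
  have h₂ := integrallyCongruent_single d β₁ l₁ hd (by rwa [hβ₁l]) a₁
  rw [hβ₁l] at h₂
  set b := β l₁ with hb
  -- One of t = 1, t = -1 works: if both values vanished, their difference 4b would vanish, but p is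
  -- odd and b ≠ 0.
  obtain ⟨t, ht⟩ : ∃ t : ZMod p, 2 * t * b + t ^ 2 * a₁ ≠ 0 := by
    by_contra! hcon
    have e1 := hcon 1
    have e2 := hcon (-1)
    have : 2 * 2 * b = 0 := by linear_combination e1 - e2
    simp [h2, hβ] at this
  have h₃ := integrallyCongruent_addCol d l₁ hd b a₁ t
  set x := 2 * t * b + t ^ 2 * a₁ with hx
  have h₄ := integrallyCongruent_of_mem_range (Function.update d l₁ x)
    (Pi.single l₁ (b + t * a₁)) (fun l hl => by
      by_cases h : l = l₁
      · subst h; rw [Function.update_self] at hl; exact absurd hl ht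
      · simp [h]) a₁
  refine ⟨l₁, x, _, b, hd, hβ, ?_, h₁.trans (h₂.trans (h₃.trans h₄))⟩
  have hsum : ∑ l, (Pi.single l₁ (b + t * a₁) : κ → ZMod p) l ^ 2 / Function.update d l₁ x l =
      (b + t * a₁) ^ 2 / x := by
    rw [Finset.sum_eq_single l₁]
    · simp
    · intro l _ hl
      simp [hl]
    · simp
  rw [hsum, mul_sub, mul_div_cancel₀ _ ht, hx]
  ring

end Bordered

/-! ### Counting symmetric matrices modulo `p` by weight -/

/-- Symmetric matrices. -/
abbrev SymmetricMatrix (κ R : Type*) : Type _ := {S : Matrix κ κ R // Sᵀ = S}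

section Weight

open Polynomial

variable {p : ℕ} [Fact p.Prime] {ι κ : Type*} [Fintype ι] [DecidableEq ι] [Fintype κ]
  [DecidableEq κ]

/-- The weight of a diagonal form: the degree records the rank, the coefficient the character. -/
noncomputable def diagonalWeight (ψ : DirichletCharacter ℂ p) (d : κ → ZMod p) : ℂ[X] :=
  ∏ i, if d i = 0 then 1 else C (ψ (-d i)) * X

variable {ψ : DirichletCharacter ℂ p}

theorem diagonalWeight_eq (d : κ → ZMod p) :
    diagonalWeight ψ d = C (∏ i, (if d i = 0 then 1 else ψ (-d i))) *
      X ^ (Finset.univ.filter fun i => d i ≠ 0).card := by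
  have h : ∀ i, (if d i = 0 then 1 else C (ψ (-d i)) * X : ℂ[X]) =
      C (if d i = 0 then 1 else ψ (-d i)) * (if d i ≠ 0 then X else 1) := by
    intro i
    by_cases hi : d i = 0 <;> simp [hi]
  rw [diagonalWeight, Finset.prod_congr rfl fun i _ => h i, Finset.prod_mul_distrib, ← map_prod,
    ← Finset.prod_filter, Finset.prod_const]

theorem diagonalWeight_coeff (d : κ → ZMod p) {r t : ℕ} (h : r + t = Fintype.card κ) :
    (diagonalWeight ψ d).coeff t = if r = (Finset.univ.filter fun i => d i = 0).card then
      ∏ i, (if d i = 0 then 1 else ψ (-d i)) else 0 := by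
  rw [diagonalWeight_eq, coeff_C_mul, coeff_X_pow]
  have := Finset.card_filter_add_card_filter_not (s := (Finset.univ : Finset κ)) fun i => d i = 0
  rw [Finset.card_univ] at this
  by_cases hr : r = (Finset.univ.filter fun i => d i = 0).card
  · rw [if_pos hr, if_pos (by simp only [ne_eq]; omega), mul_one]
  · rw [if_neg hr, if_neg (by simp only [ne_eq]; omega), mul_zero]

theorem diagonalWeight_coeff_eq_zero (d : κ → ZMod p) {t : ℕ} (h : Fintype.card κ < t) :
    (diagonalWeight ψ d).coeff t = 0 := by
  rw [diagonalWeight_eq, coeff_C_mul, coeff_X_pow, if_neg, mul_zero]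
  exact (lt_of_le_of_lt (Finset.card_le_univ _) h).ne'

theorem diagonalWeight_comp_equiv (d : κ → ZMod p) (e : ι ≃ κ) :
    diagonalWeight ψ (d ∘ e) = diagonalWeight ψ d :=
  Equiv.prod_comp e fun i => if d i = 0 then 1 else C (ψ (-d i)) * X

theorem diagonalWeight_sumElim (d : κ → ZMod p) (a : ZMod p) :
    diagonalWeight ψ (Sum.elim d fun _ : Unit => a) =
      diagonalWeight ψ d * if a = 0 then 1 else C (ψ (-a)) * X := by
  rw [diagonalWeight, Fintype.prod_sum_type]
  simp only [Sum.elim_inl, Sum.elim_inr, Finset.univ_unique, Finset.prod_singleton]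
  rfl

/-- A hyperbolic plane contributes ψ(-x)ψ(-y) = ψ(-b²) = ψ(-1) and raises the rank by two. -/
theorem diagonalWeight_update (hψ : ∀ x : ZMod p, x ≠ 0 → ψ x ^ 2 = 1) (d : κ → ZMod p) {l : κ}
    (hl : d l = 0) {x y b : ZMod p} (hb : b ≠ 0) (hxy : x * y = -b ^ 2) :
    diagonalWeight ψ (Sum.elim (Function.update d l x) fun _ : Unit => y) =
      C (ψ (-1)) * X ^ 2 * diagonalWeight ψ d := by
  have hx : x ≠ 0 := by rintro rfl; simp [hb] at hxy
  have hy : y ≠ 0 := by rintro rfl; simp [hb] at hxy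
  rw [diagonalWeight_sumElim, if_neg hy]
  have h1 : diagonalWeight ψ (Function.update d l x) = C (ψ (-x)) * X * diagonalWeight ψ d := by
    rw [diagonalWeight, diagonalWeight, ← Finset.mul_prod_erase _ _ (Finset.mem_univ l),
      ← Finset.mul_prod_erase (a := l) _ _ (Finset.mem_univ l)]
    rw [if_pos hl, Function.update_self, if_neg hx, one_mul]
    congr 1
    refine Finset.prod_congr rfl fun i hi => ?_
    rw [Function.update_of_ne (Finset.ne_of_mem_erase hi)]
  have h2 : ψ (-x) * ψ (-y) = ψ (-1) := by
    rw [← map_mul, neg_mul_neg, hxy, ← neg_one_mul, map_mul, map_pow, hψ b hb, mul_one]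
  rw [h1, ← h2, C_mul]
  ring

/-- The substitution X ↦ pX records the factor p^rank, which is the number of borders in the column
space (`card_support_le`). -/
theorem diagonalWeight_comp (d : κ → ZMod p) :
    (diagonalWeight ψ d).comp (C (p : ℂ) * X) =
      C ((p : ℂ) ^ (Finset.univ.filter fun i => d i ≠ 0).card) * diagonalWeight ψ d := by
  rw [diagonalWeight_eq]
  simp only [mul_comp, C_comp, pow_comp, X_comp, mul_pow, C_pow]
  ring

theorem card_support_le (d : κ → ZMod p) :
    (Finset.univ.filter fun β : κ → ZMod p => ∀ l, d l = 0 → β l = 0).card =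
      p ^ (Finset.univ.filter fun i => d i ≠ 0).card := by
  have : (Finset.univ.filter fun β : κ → ZMod p => ∀ l, d l = 0 → β l = 0) =
      Fintype.piFinset fun l => if d l = 0 then {0} else Finset.univ := by
    ext β
    simp only [Finset.mem_filter, Finset.mem_univ, true_and, Fintype.mem_piFinset]
    refine forall_congr' fun l => ?_
    by_cases hl : d l = 0 <;> simp [hl]
  rw [this, Fintype.card_piFinset]
  have h : ∀ l, (if d l = 0 then {0} else Finset.univ : Finset (ZMod p)).card =
      if d l ≠ 0 then p else 1 := by
    intro l
    by_cases hl : d l = 0 <;> simp [hl, ZMod.card]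
  rw [Finset.prod_congr rfl fun l _ => h l, Finset.prod_ite]
  simp

/-- A function on matrices which is given by `diagonalWeight` on every diagonalization. -/
def IsDiagonalWeight (ψ : DirichletCharacter ℂ p) (φ : Matrix κ κ (ZMod p) → ℂ[X]) : Prop :=
  ∀ S d, IntegrallyCongruent S (diagonal d) → φ S = diagonalWeight ψ d

/-- A border β in the column space adds the form of rank at most one with entry a - ∑ β² / d, which
runs over 𝔽_p as a does; summing over a gives the factor 1 + (∑ψ)X. Each of the other p^|κ| - p^rank
borders adds a hyperbolic plane, with weight ψ(-1)X², for all p values of a. -/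
theorem sum_bordered (hp : p ≠ 2) (hψ : ∀ x : ZMod p, x ≠ 0 → ψ x ^ 2 = 1)
    {φ : Matrix (κ ⊕ Unit) (κ ⊕ Unit) (ZMod p) → ℂ[X]} (hφ : IsDiagonalWeight ψ φ)
    {S : Matrix κ κ (ZMod p)} {d : κ → ZMod p} (hS : IntegrallyCongruent S (diagonal d)) :
    ∑ β : κ → ZMod p, ∑ a : ZMod p, φ (borderedMatrix S β a) =
      (1 + C (∑ a, ψ a) * X) * (diagonalWeight ψ d).comp (C (p : ℂ) * X) +
        C (ψ (-1)) * X ^ 2 * (C (p : ℂ) * (C ((p : ℂ) ^ Fintype.card κ) * diagonalWeight ψ d -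
          (diagonalWeight ψ d).comp (C (p : ℂ) * X))) := by
  classical
  obtain ⟨U, U', hUU', hU, hUS⟩ := hS
  have hinv : matrixMod p U * matrixMod p U' = 1 := by rw [← map_mul, hUU', map_one]
  have hinv' : matrixMod p U' * matrixMod p U = 1 := mul_eq_one_comm.1 hinv
  let e : (κ → ZMod p) ≃ (κ → ZMod p) :=
    { toFun := fun β => matrixMod p U *ᵥ β
      invFun := fun β => matrixMod p U' *ᵥ β
      left_inv := fun β => by simp [mulVec_mulVec, hinv']
      right_inv := fun β => by simp [mulVec_mulVec, hinv] }
  set good : (κ → ZMod p) → Prop := fun β => ∀ l, d l = 0 → β l = 0 with hgood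
  have key : ∀ β a, φ (borderedMatrix S β a) = if good (e β) then
      diagonalWeight ψ d * (if a - ∑ l, e β l ^ 2 / d l = 0 then 1 else
        C (ψ (-(a - ∑ l, e β l ^ 2 / d l))) * X)
      else C (ψ (-1)) * X ^ 2 * diagonalWeight ψ d := by
    intro β a
    have h₁ := integrallyCongruent_bordered hUU' hU S β a
    rw [hUS] at h₁
    by_cases hβ : good (e β)
    · rw [if_pos hβ, hφ _ _ (h₁.trans (integrallyCongruent_of_mem_range d _ hβ a)),
        diagonalWeight_sumElim]
    · rw [if_neg hβ]
      simp only [hgood, not_forall] at hβ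
      obtain ⟨l, hl, hβl⟩ := hβ
      obtain ⟨l₀, x, y, b, hl₀, hb, hxy, hI⟩ := integrallyCongruent_of_notMem_range hp d (e β) hl hβl a
      rw [hφ _ _ (h₁.trans hI), diagonalWeight_update hψ d hl₀ hb hxy]
  have hsum : ∀ c : ZMod p, ∑ a : ZMod p, (if a - c = 0 then 1 else C (ψ (-(a - c))) * X) =
      (1 + C (∑ a, ψ a) * X : ℂ[X]) := by
    intro c
    -- The substitution a ↦ c - a turns ψ(-(a - c)) into ψ(a).
    rw [← Equiv.sum_comp ((Equiv.neg _).trans (Equiv.addRight c))]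
    simp only [Equiv.trans_apply, Equiv.neg_apply, Equiv.coe_addRight, add_sub_cancel_right,
      neg_neg, neg_eq_zero]
    have h : ∀ a : ZMod p, (if a = 0 then 1 else C (ψ a) * X : ℂ[X]) =
        (if a = 0 then 1 else 0) + C (ψ a) * X := by
      intro a
      by_cases ha : a = 0
      · subst ha
        simp [MulChar.map_zero ψ]
      · simp [ha]
    rw [Finset.sum_congr rfl fun a _ => h a, Finset.sum_add_distrib, map_sum, Finset.sum_mul]
    simp
  simp_rw [key]
  rw [Equiv.sum_comp e fun β => ∑ a : ZMod p, if good β then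
      diagonalWeight ψ d * (if a - ∑ l, β l ^ 2 / d l = 0 then 1 else
        C (ψ (-(a - ∑ l, β l ^ 2 / d l))) * X)
      else C (ψ (-1)) * X ^ 2 * diagonalWeight ψ d]
  have h3 : ∀ β : κ → ZMod p, (∑ a : ZMod p, if good β then
      diagonalWeight ψ d * (if a - ∑ l, β l ^ 2 / d l = 0 then 1 else
        C (ψ (-(a - ∑ l, β l ^ 2 / d l))) * X)
      else C (ψ (-1)) * X ^ 2 * diagonalWeight ψ d) = C (p : ℂ) * (C (ψ (-1)) * X ^ 2 * diagonalWeight ψ d) +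
        if good β then diagonalWeight ψ d * (1 + C (∑ a, ψ a) * X) -
          C (p : ℂ) * (C (ψ (-1)) * X ^ 2 * diagonalWeight ψ d) else 0 := by
    intro β
    by_cases hβ : good β
    · simp only [hβ, if_true]
      rw [← Finset.mul_sum, hsum]
      ring
    · simp [hβ, ZMod.card]
  rw [Finset.sum_congr rfl fun β _ => h3 β, Finset.sum_add_distrib, ← Finset.sum_filter,
    Finset.sum_const, Finset.sum_const, card_support_le, diagonalWeight_comp]
  simp only [Finset.card_univ, Fintype.card_pi, ZMod.card, Finset.prod_const, nsmul_eq_mul,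
    Nat.cast_pow, map_pow, map_natCast]
  ring

/-- Reindexing of symmetric matrices. -/
def symmetricReindex (R : Type*) (e : ι ≃ κ) : SymmetricMatrix ι R ≃ SymmetricMatrix κ R where
  toFun S := ⟨Matrix.reindex e e S.1, by rw [transpose_reindex, S.2]⟩
  invFun S := ⟨Matrix.reindex e.symm e.symm S.1, by rw [transpose_reindex, S.2]⟩
  left_inv S := by simp
  right_inv S := by simp

/-- Symmetric matrices on `κ ⊕ Unit` are bordered symmetric matrices. -/
def borderedEquiv (κ R : Type*) :
    SymmetricMatrix κ R × (κ → R) × R ≃ SymmetricMatrix (κ ⊕ Unit) R where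
  toFun x := ⟨borderedMatrix x.1.1 x.2.1 x.2.2, by
    rw [borderedMatrix, fromBlocks_transpose, x.1.2]; rfl⟩
  invFun S := ⟨⟨S.1.toBlocks₁₁, by
    ext i j; exact congrFun (congrFun S.2 (Sum.inl i)) (Sum.inl j)⟩,
    fun i => S.1 (Sum.inl i) (Sum.inr ()), S.1 (Sum.inr ()) (Sum.inr ())⟩
  left_inv x := by simp [borderedMatrix]
  right_inv S := by
    ext i j
    rcases i with i | i <;> rcases j with j | j
    · rfl
    · rfl
    · exact congrFun (congrFun S.2 (Sum.inr ())) (Sum.inl j)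
    · rfl

/-- The equivalence `Fin j ⊕ Unit ≃ Fin (j + 1)` sending the extra point to the last one. -/
def finSumUnitEquiv (j : ℕ) : Fin j ⊕ Unit ≃ Fin (j + 1) :=
  (Equiv.optionEquivSumPUnit (Fin j)).symm.trans finSuccEquivLast.symm

theorem IntegrallyCongruent.reindex_diagonal {S : Matrix ι ι (ZMod p)} {d : ι → ZMod p}
    (h : IntegrallyCongruent S (diagonal d)) (e : ι ≃ κ) :
    IntegrallyCongruent (Matrix.reindex e e S) (diagonal (d ∘ e.symm)) := by
  have := h.reindex e
  rwa [reindex_apply e e (diagonal d), submatrix_diagonal_equiv] at this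

/-- Induction on the size: after the leading block is diagonalized, the border either lies in its
column space or produces a hyperbolic plane, and both cases have been diagonalized. -/
theorem exists_integrallyCongruent_diagonal (hp : p ≠ 2) {j : ℕ}
    (S : SymmetricMatrix (Fin j) (ZMod p)) : ∃ d, IntegrallyCongruent S.1 (diagonal d) := by
  induction j with
  | zero => exact ⟨fun _ => 0, by rw [Subsingleton.elim S.1 (diagonal _)]; exact .refl _⟩
  | succ j ih =>
    obtain ⟨x, rfl⟩ := ((borderedEquiv _ _).trans
      (symmetricReindex (ZMod p) (finSumUnitEquiv j))).surjective S
    obtain ⟨S, β, a⟩ := x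
    obtain ⟨d, U, U', hUU', hU, hUS⟩ := ih S
    have h := integrallyCongruent_bordered hUU' hU S.1 β a
    rw [hUS] at h
    suffices ∃ d', IntegrallyCongruent (borderedMatrix S.1 β a) (diagonal d') by
      obtain ⟨d', hd'⟩ := this
      exact ⟨_, hd'.reindex_diagonal _⟩
    by_cases hβ : ∀ l, d l = 0 → (matrixMod p U *ᵥ β) l = 0
    · exact ⟨_, h.trans (integrallyCongruent_of_mem_range d _ hβ a)⟩
    · simp only [not_forall] at hβ
      obtain ⟨l, hl, hβl⟩ := hβ
      obtain ⟨l₀, x, y, b, -, -, -, hI⟩ := integrallyCongruent_of_notMem_range hp d _ hl hβl a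
      exact ⟨_, h.trans hI⟩

/-- The generating polynomial of the weights of symmetric `j × j` matrices. -/
noncomputable def weightPolynomial (ψ : DirichletCharacter ℂ p) : ℕ → ℂ[X]
  | 0 => 1
  | j + 1 => (1 + C (∑ a, ψ a) * X) * (weightPolynomial ψ j).comp (C (p : ℂ) * X) +
      C (ψ (-1)) * X ^ 2 * (C (p : ℂ) * (C ((p : ℂ) ^ j) * weightPolynomial ψ j -
        (weightPolynomial ψ j).comp (C (p : ℂ) * X)))

theorem sum_symmetric_weight (hp : p ≠ 2) (hψ : ∀ x : ZMod p, x ≠ 0 → ψ x ^ 2 = 1) {j : ℕ}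
    {φ : Matrix (Fin j) (Fin j) (ZMod p) → ℂ[X]} (hφ : IsDiagonalWeight ψ φ) :
    ∑ S : SymmetricMatrix (Fin j) (ZMod p), φ S.1 = weightPolynomial ψ j := by
  induction j with
  | zero =>
    rw [Fintype.sum_subsingleton _ (⟨0, by simp⟩ : SymmetricMatrix (Fin 0) (ZMod p)), hφ _ 0]
    · simp [diagonalWeight, weightPolynomial]
    · rw [Subsingleton.elim (diagonal _) (0 : Matrix (Fin 0) (Fin 0) (ZMod p))]
      exact .refl _
  | succ j ih =>
    set e := finSumUnitEquiv j
    have hφ' : IsDiagonalWeight ψ fun M => φ (Matrix.reindex e e M) := fun S d h =>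
      (hφ _ _ (h.reindex_diagonal e)).trans (diagonalWeight_comp_equiv d e.symm)
    -- Bordering by zeros adds a zero diagonal entry, of weight 1. It thus yields a weight function
    -- in size j, to which the induction hypothesis applies.
    have hφ'' : IsDiagonalWeight ψ fun M => φ (Matrix.reindex e e (borderedMatrix M 0 0)) := by
      rintro S d ⟨U, U', hUU', hU, hUS⟩
      have h := integrallyCongruent_bordered hUU' hU S 0 0
      rw [hUS, mulVec_zero, borderedMatrix_diagonal] at h
      rw [hφ' _ _ h, diagonalWeight_sumElim, if_pos rfl, mul_one]
    rw [← Equiv.sum_comp ((borderedEquiv _ _).trans (symmetricReindex (ZMod p) e)),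
      Fintype.sum_prod_type, weightPolynomial, ← ih hφ'']
    have h : ∀ S : SymmetricMatrix (Fin j) (ZMod p), _ := fun S =>
      sum_bordered hp hψ hφ' (exists_integrallyCongruent_diagonal hp S).choose_spec
    have h' : ∀ S : SymmetricMatrix (Fin j) (ZMod p), _ := fun S =>
      hφ'' S.1 _ (exists_integrallyCongruent_diagonal hp S).choose_spec
    simp_rw [Fintype.sum_prod_type]
    refine (Finset.sum_congr rfl fun S _ => h S).trans ?_
    simp only [← h']
    simp only [← Polynomial.coe_compRingHom_apply, map_sum, Finset.mul_sum, Finset.sum_add_distrib,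
      Fintype.card_fin, mul_sub, Finset.sum_sub_distrib]

theorem weightPolynomial_coeff_zero (j : ℕ) : (weightPolynomial ψ j).coeff 0 = 1 := by
  induction j with
  | zero => simp [weightPolynomial]
  | succ j ih => simp [weightPolynomial, mul_coeff_zero, comp_C_mul_X_coeff, ih, -map_natCast]

theorem weightPolynomial_coeff_one (j : ℕ) : (weightPolynomial ψ (j + 1)).coeff 1 =
    p * (weightPolynomial ψ j).coeff 1 + ∑ a, ψ a := by
  rw [weightPolynomial, coeff_add, add_mul, one_mul, coeff_add, mul_assoc (C _) X, coeff_C_mul,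
    coeff_X_mul, mul_assoc (C _) (X ^ 2), coeff_C_mul, coeff_X_pow_mul']
  simp only [comp_C_mul_X_coeff, weightPolynomial_coeff_zero, pow_one, pow_zero, mul_one]
  norm_num [mul_comm]

theorem weightPolynomial_coeff_add_two (j r : ℕ) : (weightPolynomial ψ (j + 1)).coeff (r + 2) =
    p ^ (r + 2) * (weightPolynomial ψ j).coeff (r + 2) +
      (∑ a, ψ a) * p ^ (r + 1) * (weightPolynomial ψ j).coeff (r + 1) +
        ψ (-1) * (p * (p ^ j - p ^ r)) * (weightPolynomial ψ j).coeff r := by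
  rw [weightPolynomial, coeff_add, add_mul, one_mul, coeff_add, mul_assoc (C _) X, coeff_C_mul,
    coeff_X_mul, mul_assoc (C _) (X ^ 2), coeff_C_mul, coeff_X_pow_mul, coeff_C_mul, coeff_sub,
    coeff_C_mul]
  simp only [comp_C_mul_X_coeff]
  ring

/-- The product `(q ^ j - 1) (q ^ (j - 1) - 1) ⋯` with `r` factors. -/
noncomputable def fallingProd (q : ℂ) (j r : ℕ) : ℂ := ∏ i ∈ Finset.range r, (q ^ (j - i) - 1)

theorem fallingProd_succ_succ (q : ℂ) (j r : ℕ) :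
    fallingProd q (j + 1) (r + 1) = (q * q ^ j - 1) * fallingProd q j r := by
  rw [fallingProd, Finset.prod_range_succ', fallingProd, mul_comm]
  simp [pow_succ']

theorem fallingProd_succ (q : ℂ) (j r : ℕ) :
    q ^ r * fallingProd q j (r + 1) = fallingProd q j r * (q ^ j - q ^ r) := by
  rw [fallingProd, Finset.prod_range_succ, ← fallingProd]
  rcases le_or_gt r j with h | h
  · obtain ⟨t, rfl⟩ := Nat.exists_eq_add_of_le h
    rw [Nat.add_sub_cancel_left, pow_add]
    ring
  · have : fallingProd q j r = 0 :=
      Finset.prod_eq_zero (Finset.mem_range.2 h) (by simp)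
    rw [this]
    ring

/-- The product `(q ^ 2 - 1) (q ^ 4 - 1) ⋯` with `h` factors. -/
noncomputable def evenProd (q : ℂ) (h : ℕ) : ℂ := ∏ i ∈ Finset.range h, (q ^ (2 * (i + 1)) - 1)

theorem evenProd_succ (q : ℂ) (h : ℕ) :
    evenProd q (h + 1) = evenProd q h * (q ^ (2 * (h + 1)) - 1) :=
  Finset.prod_range_succ _ _

/-- The recursion expresses a coefficient through those of the same degree and of the two preceding
degrees, so both parities are proved together. Multiplying by `evenProd` keeps denominators out of
the induction. -/
theorem weightPolynomial_coeff_trivial (hψ : ψ (-1) = 1) (hs : ∑ a, ψ a = (p : ℂ) - 1) (j h : ℕ) :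
    (weightPolynomial ψ j).coeff (2 * h) * evenProd p h =
        (p : ℂ) ^ (h * (h + 1)) * fallingProd p j (2 * h) ∧
      (weightPolynomial ψ j).coeff (2 * h + 1) * evenProd p h =
        (p : ℂ) ^ (h * (h + 1)) * fallingProd p j (2 * h + 1) := by
  induction j generalizing h with
  | zero =>
    rcases h with _ | h
    · simp [weightPolynomial, evenProd, fallingProd, coeff_one]
    · have h0 : ∀ r, fallingProd (p : ℂ) 0 (r + 1) = 0 := fun r =>
        Finset.prod_eq_zero (Finset.mem_range.2 r.succ_pos) (by simp)
      rw [weightPolynomial, coeff_one, coeff_one, if_neg (by omega), if_neg (by omega), h0,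
        show 2 * (h + 1) = 2 * h + 1 + 1 by ring, h0]
      simp
  | succ j ih =>
    rcases h with _ | m
    · obtain ⟨-, h1⟩ := ih 0
      simp only [mul_zero, zero_add, evenProd, Finset.range_zero, Finset.prod_empty, mul_one,
        zero_mul, pow_zero, one_mul, fallingProd, Finset.prod_range_one, Nat.sub_zero] at h1 ⊢
      refine ⟨weightPolynomial_coeff_zero _, ?_⟩
      rw [weightPolynomial_coeff_one, h1, hs]
      ring
    · obtain ⟨h0, h1⟩ := ih m
      obtain ⟨h2, h3⟩ := ih (m + 1)
      have f0 := fallingProd_succ (p : ℂ) j (2 * m)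
      have f1 := fallingProd_succ (p : ℂ) j (2 * m + 1)
      have f2 := fallingProd_succ (p : ℂ) j (2 * m + 2)
      rw [show 2 * (m + 1) = 2 * m + 2 by ring] at *
      rw [weightPolynomial_coeff_add_two, show 2 * m + 2 + 1 = 2 * m + 1 + 2 by ring,
        weightPolynomial_coeff_add_two, fallingProd_succ_succ, fallingProd_succ_succ, hψ, hs]
      rw [evenProd_succ, show 2 * (m + 1) = 2 * m + 2 by ring] at *
      rw [show 2 * m + 2 + 1 = 2 * m + 1 + 2 by ring, show 2 * m + 1 + 1 = 2 * m + 2 by ring] at *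
      have e : (p : ℂ) ^ ((m + 1) * (m + 1 + 1)) = p ^ (m * (m + 1)) * p ^ (2 * m + 2) := by
        rw [← pow_add]; ring_nf
      have e2 : (p : ℂ) ^ (2 * m + 2) = p ^ 2 * p ^ (2 * m) := by ring
      have e1 : (p : ℂ) ^ (2 * m + 1) = p * p ^ (2 * m) := by ring
      have e3 : (p : ℂ) ^ (2 * m + 1 + 2) = p ^ 3 * p ^ (2 * m) := by ring
      simp only [e, e1, e2, e3] at f0 f1 f2 h0 h1 h2 h3 ⊢
      generalize (p : ℂ) ^ (2 * m) = u at *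
      generalize (p : ℂ) ^ j = Q at *
      generalize (p : ℂ) ^ (m * (m + 1)) = P at *
      generalize fallingProd (p : ℂ) j (2 * m) = F0 at *
      generalize fallingProd (p : ℂ) j (2 * m + 1) = F1 at *
      generalize fallingProd (p : ℂ) j (2 * m + 2) = F2 at *
      generalize fallingProd (p : ℂ) j (2 * m + 1 + 2) = F3 at *
      generalize (p : ℂ) = q at *
      -- The multipliers of h0, h1, h2, h3 are those of the recursion, with the extra factor q²u - 1
      -- of `evenProd` at m + 1 wherever a formula for m is used. The multipliers of f0, f1, f2
      -- relate falling products of consecutive lengths.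
      exact ⟨by linear_combination q ^ 2 * u * h2 + (q - 1) * q * u * (q ^ 2 * u - 1) * h1 +
          q * (Q - u) * (q ^ 2 * u - 1) * h0 + q ^ 3 * u * P * f1 - q * (q ^ 2 * u - 1) * P * f0,
        by linear_combination q ^ 3 * u * h3 + (q - 1) * q ^ 2 * u * h2 +
          q * (Q - q * u) * (q ^ 2 * u - 1) * h1 + q ^ 3 * u * P * f2 -
          q * (q ^ 2 * u - 1) * P * f1⟩

/-- With ∑ψ = 0 the recursion preserves the parity of the degree. It starts from the constant 1, so
odd degrees never occur. -/
theorem weightPolynomial_coeff_quadratic (hs : ∑ a, ψ a = 0) (j h : ℕ) :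
    (weightPolynomial ψ j).coeff (2 * h) * evenProd p h =
        ψ (-1) ^ h * (p : ℂ) ^ (h ^ 2) * fallingProd p j (2 * h) ∧
      (weightPolynomial ψ j).coeff (2 * h + 1) = 0 := by
  induction j generalizing h with
  | zero =>
    rcases h with _ | h
    · simp [weightPolynomial, evenProd, fallingProd, coeff_one]
    · have h0 : ∀ r, fallingProd (p : ℂ) 0 (r + 1) = 0 := fun r =>
        Finset.prod_eq_zero (Finset.mem_range.2 r.succ_pos) (by simp)
      rw [weightPolynomial, coeff_one, coeff_one, if_neg (by omega), if_neg (by omega),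
        show 2 * (h + 1) = 2 * h + 1 + 1 by ring, h0]
      simp
  | succ j ih =>
    rcases h with _ | m
    · obtain ⟨-, h1⟩ := ih 0
      refine ⟨by simp [weightPolynomial_coeff_zero, evenProd, fallingProd], ?_⟩
      rw [mul_zero, zero_add] at h1 ⊢
      rw [weightPolynomial_coeff_one, h1, hs]
      ring
    · obtain ⟨h0, h1⟩ := ih m
      obtain ⟨h2, h3⟩ := ih (m + 1)
      have f0 := fallingProd_succ (p : ℂ) j (2 * m)
      have f1 := fallingProd_succ (p : ℂ) j (2 * m + 1)
      rw [show 2 * (m + 1) = 2 * m + 2 by ring] at *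
      rw [weightPolynomial_coeff_add_two, show 2 * m + 2 + 1 = 2 * m + 1 + 2 by ring,
        weightPolynomial_coeff_add_two, fallingProd_succ_succ, hs]
      rw [show 2 * m + 2 + 1 = 2 * m + 1 + 2 by ring] at h3
      refine ⟨?_, by rw [h3, h1]; ring⟩
      rw [evenProd_succ, show 2 * (m + 1) = 2 * m + 2 by ring] at *
      rw [show 2 * m + 1 + 1 = 2 * m + 2 by ring] at *
      have e : (p : ℂ) ^ ((m + 1) ^ 2) = p ^ (m ^ 2) * p ^ (2 * m + 1) := by
        rw [← pow_add]; ring_nf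
      have e2 : (p : ℂ) ^ (2 * m + 2) = p ^ 2 * p ^ (2 * m) := by ring
      have e1 : (p : ℂ) ^ (2 * m + 1) = p * p ^ (2 * m) := by ring
      simp only [e, e1, e2, pow_succ (ψ (-1))] at f0 f1 h0 h2 ⊢
      generalize (p : ℂ) ^ (2 * m) = u at *
      generalize (p : ℂ) ^ j = Q at *
      generalize (p : ℂ) ^ (m ^ 2) = P at *
      generalize fallingProd (p : ℂ) j (2 * m) = F0 at *
      generalize fallingProd (p : ℂ) j (2 * m + 1) = F1 at *
      generalize fallingProd (p : ℂ) j (2 * m + 2) = F2 at *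
      generalize (p : ℂ) = q at *
      generalize ψ (-1) ^ m = c at *
      generalize ψ (-1) = c' at *
      linear_combination q ^ 2 * u * h2 + c' * q * (Q - u) * (q ^ 2 * u - 1) * h0 +
        c * c' * q ^ 2 * u * P * f1 - c * c' * q * (q ^ 2 * u - 1) * P * f0

end Weight

/-! ### Restriction of sums over symmetric matrices to leading blocks -/

section Average

variable {ι κ R : Type*} [Fintype ι] [Fintype κ] [Fintype R] [DecidableEq ι] [DecidableEq κ]
  [DecidableEq R]

/-- Symmetric block matrices. -/
def symmetricBlockEquiv (ι κ R : Type*) :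
    SymmetricMatrix ι R × Matrix ι κ R × SymmetricMatrix κ R ≃ SymmetricMatrix (ι ⊕ κ) R where
  toFun x := ⟨fromBlocks x.1.1 x.2.1 x.2.1ᵀ x.2.2.1, by
    rw [fromBlocks_transpose, x.1.2, x.2.2.2, transpose_transpose]⟩
  invFun S := ⟨⟨S.1.toBlocks₁₁, by
    ext i j; exact congrFun (congrFun S.2 (Sum.inl i)) (Sum.inl j)⟩, S.1.toBlocks₁₂,
    ⟨S.1.toBlocks₂₂, by ext i j; exact congrFun (congrFun S.2 (Sum.inr i)) (Sum.inr j)⟩⟩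
  left_inv x := by simp
  right_inv S := by
    ext i j
    rcases i with i | i <;> rcases j with j | j
    · rfl
    · rfl
    · exact congrFun (congrFun S.2 (Sum.inr i)) (Sum.inl j)
    · rfl

/-- Every leading block extends to a symmetric matrix in the same number of ways. -/
theorem card_mul_sum_submatrix {j m : ℕ} (f : Matrix (Fin j) (Fin j) R → ℂ) :
    (Fintype.card (SymmetricMatrix (Fin j) R) : ℂ) * ∑ S : SymmetricMatrix (Fin (j + m)) R,
        f (S.1.submatrix (Fin.castAdd m) (Fin.castAdd m)) =
      Fintype.card (SymmetricMatrix (Fin (j + m)) R) *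
        ∑ S : SymmetricMatrix (Fin j) R, f S.1 := by
  set e := (symmetricBlockEquiv (Fin j) (Fin m) R).trans (symmetricReindex R finSumFinEquiv) with he
  rw [← Fintype.card_congr e, ← Equiv.sum_comp e, Fintype.sum_prod_type, Fintype.card_prod]
  have h : ∀ x y, f ((e (x, y)).1.submatrix (Fin.castAdd m) (Fin.castAdd m)) = f x.1 := by
    intro x y
    congr 1
    ext a b
    simp [he, symmetricReindex, symmetricBlockEquiv]
  simp_rw [h]
  simp only [Finset.sum_const, Finset.card_univ, nsmul_eq_mul, ← Finset.mul_sum]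
  push_cast
  ring

theorem card_symmetricMatrix (j : ℕ) :
    Fintype.card (SymmetricMatrix (Fin j) R) = Fintype.card R ^ (j * (j + 1) / 2) := by
  induction j with
  | zero =>
    rw [Fintype.card_eq_one_iff.2 ⟨⟨of fun i => i.elim0, Subsingleton.elim _ _⟩, fun S => Subsingleton.elim _ _⟩]
    simp
  | succ j ih =>
    rw [← Fintype.card_congr ((borderedEquiv _ _).trans
      (symmetricReindex R (finSumUnitEquiv j))), Fintype.card_prod, Fintype.card_prod, ih,
      Fintype.card_fun, Fintype.card_fin, ← pow_succ, ← pow_add]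
    congr 1
    have : (j + 1) * (j + 1 + 1) = j * (j + 1) + (j + 1) * 2 := by ring
    rw [this, Nat.add_mul_div_right _ _ two_pos]

end Average

/-! ### Independence of the weight from the diagonalization -/

section CanonicalWeight

open Polynomial

variable {p : ℕ} [Fact p.Prime] {ψ : DirichletCharacter ℂ p}

/-- The two elements differ by some η in P with det D_η = ±1. Positivity of both determinants
excludes the sign -1, which ψ might detect. -/
theorem psiStar_eq_of_triangular {n : ℕ} (hψ : ∀ x : ZMod p, x ≠ 0 → ψ x ^ 2 = 1)
    {H H' : BlockMatrix n ℤ}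
    {g g' : symplecticGroup (Fin n) ℤ} (hC : H.toBlocks₂₁ = 0) (hC' : H'.toBlocks₂₁ = 0)
    (hD : 0 < H.toBlocks₂₂.det) (hD' : 0 < H'.toBlocks₂₂.det) (h : H * g = H' * g') (r : ℕ) :
    psiStar ψ r g = psiStar ψ r g' := by
  obtain ⟨η, hη, rfl, hηD⟩ := parabolic_of_triangular_mul hC hC' hD.ne' h
  rw [psiStar_mul_left hψ r hη]
  have h1 := congrArg det hηD
  rw [det_mul] at h1
  rcases det_parabolic hη with h2 | h2
  · rw [charDetD, h2]
    simp
  · rw [h2] at h1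
    linarith

/-- Classification of quadratic forms over 𝔽_p is not needed. Each diagonalization of S factors the
same matrix w_j(p, -S; 0, 1), and ψ* of the symplectic factor, which does not depend on the
factorization, reads off every coefficient of the weight. -/
theorem diagonalWeight_unique (hψ : ∀ x : ZMod p, x ≠ 0 → ψ x ^ 2 = 1) {j : ℕ}
    {S : Matrix (Fin j) (Fin j) (ZMod p)} {d d' : Fin j → ZMod p}
    (h : IntegrallyCongruent S (diagonal d)) (h' : IntegrallyCongruent S (diagonal d')) :
    diagonalWeight ψ d = diagonalWeight ψ d' := by
  have hS : Sᵀ = S := by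
    obtain ⟨U, U', hUU', hU, hUS⟩ := h
    have hinv : matrixMod p U' * matrixMod p U = 1 := by
      rw [← map_mul, mul_eq_one_comm.1 hUU', map_one]
    have hinv' : (matrixMod p U)ᵀ * (matrixMod p U')ᵀ = 1 := by
      rw [← transpose_mul, hinv, transpose_one]
    have : S = matrixMod p U' * diagonal d * (matrixMod p U')ᵀ := by
      rw [← hUS]
      calc S = (matrixMod p U' * matrixMod p U) * S * ((matrixMod p U)ᵀ * (matrixMod p U')ᵀ) := by
            rw [hinv, hinv', Matrix.one_mul, Matrix.mul_one]
        _ = _ := by simp only [Matrix.mul_assoc]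
    rw [this, transpose_mul, transpose_mul, diagonal_transpose, transpose_transpose,
      Matrix.mul_assoc]
  have hL : (matrixLift S)ᵀ = matrixLift S := matrixLift_transpose hS
  have hsub : (matrixMod p (matrixLift S)).submatrix (Fin.castAdd 0) (Fin.castAdd 0) = S := by
    rw [matrixMod_matrixLift]; rfl
  rw [← hsub] at h h'
  -- With m = 0 the leading block is the whole matrix.
  obtain ⟨H, γ, hC, hD, hH, hγ⟩ := exists_triangular_factor hψ (m := 0) hL h
  obtain ⟨H', γ', hC', hD', hH', hγ'⟩ := exists_triangular_factor hψ (m := 0) hL h'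
  have hp : (0 : ℤ) < p := mod_cast (Fact.out : p.Prime).pos
  have key := psiStar_eq_of_triangular hψ hC hC' (hD ▸ pow_pos hp _) (hD' ▸ pow_pos hp _)
    (hH.symm.trans hH')
  ext t
  rcases le_or_gt t j with ht | ht
  · rw [diagonalWeight_coeff d (r := j - t) (by simp; omega),
      diagonalWeight_coeff d' (r := j - t) (by simp; omega), ← hγ _ (by omega), key,
      hγ' _ (by omega)]
  · rw [diagonalWeight_coeff_eq_zero, diagonalWeight_coeff_eq_zero] <;> simpa

open Classical in
/-- The weight of a symmetric matrix. -/
noncomputable def symmetricWeight (ψ : DirichletCharacter ℂ p) {j : ℕ}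
    (S : Matrix (Fin j) (Fin j) (ZMod p)) : ℂ[X] :=
  if h : ∃ d, IntegrallyCongruent S (diagonal d) then diagonalWeight ψ h.choose else 0

theorem isDiagonalWeight_symmetricWeight (hψ : ∀ x : ZMod p, x ≠ 0 → ψ x ^ 2 = 1) (j : ℕ) :
    IsDiagonalWeight ψ (symmetricWeight ψ (j := j)) := by
  intro S d h
  have h' : ∃ d, IntegrallyCongruent S (diagonal d) := ⟨d, h⟩
  rw [symmetricWeight, dif_pos h']
  exact diagonalWeight_unique hψ h'.choose_spec h

/-- The exponent e is the corank of the leading block. The last clause allows p^e to be replaced by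
p^r in every term that survives, so the power of p does not depend on S. -/
theorem exists_triangular_factor_symmetricWeight (hp : p ≠ 2)
    (hψ : ∀ x : ZMod p, x ≠ 0 → ψ x ^ 2 = 1) {j m : ℕ}
    {S : Matrix (Fin (j + m)) (Fin (j + m)) ℤ} (hS : Sᵀ = S) :
    ∃ (H : BlockMatrix (j + m) ℤ) (γ : symplecticGroup (Fin (j + m)) ℤ) (e : ℕ),
      H.toBlocks₂₁ = 0 ∧ H.toBlocks₂₂.det = (p : ℤ) ^ e ∧
      (cuspElement (j + m) j : BlockMatrix (j + m) ℤ) * heckeAdjoint p S = H * γ ∧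
      ∀ r ≤ j + m, (psiStar ψ r γ = if r ≤ j then (symmetricWeight ψ
        ((matrixMod p S).submatrix (Fin.castAdd m) (Fin.castAdd m))).coeff (j - r) else 0) ∧
        (psiStar ψ r γ ≠ 0 → r = e) := by
  obtain ⟨d, hd⟩ := exists_integrallyCongruent_diagonal hp
    (⟨(matrixMod p S).submatrix (Fin.castAdd m) (Fin.castAdd m), by
      rw [transpose_submatrix, ← matrixMod_transpose, hS]⟩ : SymmetricMatrix (Fin j) (ZMod p))
  obtain ⟨H, γ, hC, hD, hH, hγ⟩ := exists_triangular_factor hψ hS hd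
  refine ⟨H, γ, _, hC, hD, hH, fun r hr => ⟨?_, fun h => ?_⟩⟩
  · rw [hγ r hr]
    split_ifs with h1 h2 h3
    · rw [isDiagonalWeight_symmetricWeight hψ j _ d hd,
        diagonalWeight_coeff d (r := r) (by simp; omega), if_pos h1]
    · have := Finset.card_le_univ (Finset.univ.filter fun i => d i = 0)
      simp only [Fintype.card_fin] at this
      omega
    · rw [isDiagonalWeight_symmetricWeight hψ j _ d hd,
        diagonalWeight_coeff d (r := r) (by simp; omega), if_neg h1]
    · rfl
  · by_contra hne
    rw [hγ r hr, if_neg hne] at h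
    exact h rfl

end CanonicalWeight

/-! ### The correspondence on the parabolic quotient -/

section Correspondence

open Polynomial

variable {n p : ℕ} [Fact p.Prime] {ψ : DirichletCharacter ℂ p}

theorem exists_triangular_cuspElement (hp : p ≠ 2) (hψ : ∀ x : ZMod p, x ≠ 0 → ψ x ^ 2 = 1) {j : ℕ}
    (hj : j ≤ n) {S : Matrix (Fin n) (Fin n) ℤ} (hS : Sᵀ = S) :
    ∃ (H : BlockMatrix n ℤ) (γ : symplecticGroup (Fin n) ℤ) (e : ℕ),
      H.toBlocks₂₁ = 0 ∧ H.toBlocks₂₂.det = (p : ℤ) ^ e ∧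
      (cuspElement n j : BlockMatrix n ℤ) * heckeAdjoint p S = H * γ ∧
      ∀ r ≤ n, (psiStar ψ r γ = if r ≤ j then (symmetricWeight ψ
        ((matrixMod p S).submatrix (Fin.castLE hj) (Fin.castLE hj))).coeff (j - r) else 0) ∧
        (psiStar ψ r γ ≠ 0 → r = e) := by
  obtain ⟨m, rfl⟩ := Nat.exists_eq_add_of_le hj
  exact exists_triangular_factor_symmetricWeight hp hψ hS

/-- The elements `γ'`, `γ` are related if `γ' (p, -S; 0, 1) γ⁻¹` is block upper triangular. -/
def HeckeRelated (p : ℕ) (S : Matrix (Fin n) (Fin n) ℤ) (γ' γ : symplecticGroup (Fin n) ℤ) : Prop :=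
  ∃ H : BlockMatrix n ℤ, H.toBlocks₂₁ = 0 ∧ H.toBlocks₂₂.det ≠ 0 ∧
    (γ' : BlockMatrix n ℤ) * heckeAdjoint p S = H * γ

variable {S : Matrix (Fin n) (Fin n) ℤ} {γ₁ γ₂ γ : symplecticGroup (Fin n) ℤ}

theorem det_parabolic_ne_zero {η : symplecticGroup (Fin n) ℤ} (hη : η ∈ siegelParabolic n) :
    (η : BlockMatrix n ℤ).toBlocks₂₂.det ≠ 0 := by
  rcases det_parabolic hη with h | h <;> rw [h] <;> norm_num

theorem HeckeRelated.mul_left (h : HeckeRelated p S γ₁ γ) {η : symplecticGroup (Fin n) ℤ}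
    (hη : η ∈ siegelParabolic n) : HeckeRelated p S (η * γ₁) γ := by
  obtain ⟨H, hC, hD, hH⟩ := h
  refine ⟨η * H, ?_, ?_, ?_⟩
  · rw [toBlocks₂₁_mul, hC, mem_siegelParabolic.1 hη]; simp
  · rw [toBlocks₂₂_mul, mem_siegelParabolic.1 hη, Matrix.zero_mul, zero_add, det_mul]
    exact mul_ne_zero (det_parabolic_ne_zero hη) hD
  · rw [Submonoid.coe_mul, Matrix.mul_assoc, hH, Matrix.mul_assoc]

theorem HeckeRelated.mul_right (h : HeckeRelated p S γ₁ γ) {η : symplecticGroup (Fin n) ℤ}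
    (hη : η ∈ siegelParabolic n) : HeckeRelated p S γ₁ (η * γ) := by
  obtain ⟨H, hC, hD, hH⟩ := h
  have hη' := inv_mem hη
  refine ⟨H * ((η⁻¹ : symplecticGroup (Fin n) ℤ) : BlockMatrix n ℤ), ?_, ?_, ?_⟩
  · rw [toBlocks₂₁_mul, hC, mem_siegelParabolic.1 hη']; simp
  · rw [toBlocks₂₂_mul, hC, Matrix.zero_mul, zero_add, det_mul]
    exact mul_ne_zero hD (det_parabolic_ne_zero hη')
  · rw [Matrix.mul_assoc, ← Submonoid.coe_mul, inv_mul_cancel_left, hH]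

theorem HeckeRelated.right_unique (h₁ : HeckeRelated p S γ γ₁) (h₂ : HeckeRelated p S γ γ₂) :
    ∃ η ∈ siegelParabolic n, γ₁ = η * γ₂ := by
  obtain ⟨H₁, hC₁, hD₁, hH₁⟩ := h₁
  obtain ⟨H₂, hC₂, hD₂, hH₂⟩ := h₂
  obtain ⟨η, hη, h, -⟩ := parabolic_of_triangular_mul hC₁ hC₂ hD₁ (hH₁.symm.trans hH₂)
  exact ⟨η, hη, h⟩

theorem coe_mul_inv (γ : symplecticGroup (Fin n) ℤ) :
    (γ : BlockMatrix n ℤ) * ((γ⁻¹ : symplecticGroup (Fin n) ℤ) : BlockMatrix n ℤ) = 1 := by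
  rw [← Submonoid.coe_mul, mul_inv_cancel, Submonoid.coe_one]

theorem coe_inv_mul (γ : symplecticGroup (Fin n) ℤ) :
    ((γ⁻¹ : symplecticGroup (Fin n) ℤ) : BlockMatrix n ℤ) * (γ : BlockMatrix n ℤ) = 1 := by
  rw [← Submonoid.coe_mul, inv_mul_cancel, Submonoid.coe_one]

theorem lower_eq_zero_of_mul_eq_smul_one {H K : BlockMatrix n ℤ} (hC : H.toBlocks₂₁ = 0)
    (hD : H.toBlocks₂₂.det ≠ 0) (h : H * K = (p : ℤ) • (1 : BlockMatrix n ℤ)) :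
    K.toBlocks₂₁ = 0 ∧ K.toBlocks₂₂.det ≠ 0 := by
  have h₁ := congrArg toBlocks₂₁ h
  have h₂ := congrArg toBlocks₂₂ h
  rw [toBlocks₂₁_mul, hC, Matrix.zero_mul, zero_add] at h₁
  rw [toBlocks₂₂_mul, hC, Matrix.zero_mul, zero_add] at h₂
  have e₁ : ((p : ℤ) • (1 : BlockMatrix n ℤ)).toBlocks₂₁ = 0 := by
    ext i j; simp [toBlocks₂₁]
  have e₂ : ((p : ℤ) • (1 : BlockMatrix n ℤ)).toBlocks₂₂ = (p : ℤ) • 1 := by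
    ext i j; simp [toBlocks₂₂, Matrix.one_apply]
  refine ⟨?_, fun h0 => ?_⟩
  · have h₃ := congrArg (H.toBlocks₂₂.adjugate * ·) (h₁.trans e₁)
    simp only [← Matrix.mul_assoc, adjugate_mul, Matrix.mul_zero, Matrix.smul_mul,
      Matrix.one_mul] at h₃
    exact (smul_eq_zero.1 h₃).resolve_left hD
  · have h₃ := congrArg det (h₂.trans e₂)
    rw [det_mul, h0, mul_zero, det_smul, det_one, mul_one] at h₃
    exact pow_ne_zero _ (Int.natCast_ne_zero.2 (Fact.out : p.Prime).ne_zero) h₃.symm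

/-- The matrix K = γ(1, S; 0, p)γ₂⁻¹ equals pH₂⁻¹ and so is again block upper triangular. The
relation pγ₁ = H₁Kγ₂ then has the form treated in `parabolic_of_triangular_mul`. -/
theorem HeckeRelated.left_unique (h₁ : HeckeRelated p S γ₁ γ) (h₂ : HeckeRelated p S γ₂ γ) :
    ∃ η ∈ siegelParabolic n, γ₁ = η * γ₂ := by
  obtain ⟨H₁, hC₁, -, hH₁⟩ := h₁
  obtain ⟨H₂, hC₂, hD₂, hH₂⟩ := h₂
  set K : BlockMatrix n ℤ := γ * heckeUpper p S * ((γ₂⁻¹ : symplecticGroup (Fin n) ℤ) :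
    BlockMatrix n ℤ) with hK
  have hH₂K : H₂ * K = (p : ℤ) • (1 : BlockMatrix n ℤ) := by
    rw [hK, ← Matrix.mul_assoc, ← Matrix.mul_assoc, ← hH₂, Matrix.mul_assoc _ _ (heckeUpper p S),
      heckeAdjoint_mul_heckeUpper, Matrix.mul_smul, Matrix.mul_one, Matrix.smul_mul, coe_mul_inv]
  have hKγ : K * γ₂ = γ * heckeUpper p S := by
    rw [hK, Matrix.mul_assoc, coe_inv_mul, Matrix.mul_one]
  have hKC := (lower_eq_zero_of_mul_eq_smul_one hC₂ hD₂ hH₂K).1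
  have e₁ : ((p : ℤ) • (1 : BlockMatrix n ℤ)).toBlocks₂₁ = 0 := by
    ext i j; simp [toBlocks₂₁]
  have e₂ : ((p : ℤ) • (1 : BlockMatrix n ℤ)).toBlocks₂₂ = (p : ℤ) • 1 := by
    ext i j; simp [toBlocks₂₂, Matrix.one_apply]
  obtain ⟨η, hη, h, -⟩ := parabolic_of_triangular_mul (H' := H₁ * K) (g := γ₁) (g' := γ₂) e₁
    (by rw [toBlocks₂₁_mul, hC₁, hKC]; simp)
    (by
      rw [e₂, det_smul, det_one, mul_one]
      exact pow_ne_zero _ (Int.natCast_ne_zero.2 (Fact.out : p.Prime).ne_zero))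
    (by
      rw [Matrix.mul_assoc, hKγ, ← Matrix.mul_assoc, ← hH₁, Matrix.mul_assoc,
        heckeAdjoint_mul_heckeUpper]
      simp only [Matrix.smul_mul, Matrix.mul_smul, Matrix.one_mul, Matrix.mul_one])
  exact ⟨η, hη, h⟩

/-- The factor κ is moved across (p, -S; 0, 1), which changes S and costs a factor ψ(det D_κ); η is
absorbed into H, whose determinant takes up the sign of det D_η. -/
theorem exists_heckeRelated_of_decomposition (hp : p ≠ 2) (hψ : ∀ x : ZMod p, x ≠ 0 → ψ x ^ 2 = 1)
    {j : ℕ} (hj : j ≤ n) {η κ : symplecticGroup (Fin n) ℤ} (hη : η ∈ siegelParabolic n)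
    (hκ : κ ∈ siegelGamma0 n p) (hS : Sᵀ = S) :
    ∃ (H : BlockMatrix n ℤ) (γ : symplecticGroup (Fin n) ℤ) (e : ℕ), H.toBlocks₂₁ = 0 ∧
      H.toBlocks₂₂.det = (η : BlockMatrix n ℤ).toBlocks₂₂.det * (p : ℤ) ^ e ∧
      ((η * cuspElement n j * κ : symplecticGroup (Fin n) ℤ) : BlockMatrix n ℤ) * heckeAdjoint p S =
        H * γ ∧
      ∀ r ≤ n, (psiStar ψ r γ = (if r ≤ j then (symmetricWeight ψ
        ((matrixMod p ((κ : BlockMatrix n ℤ).toBlocks₁₁ * S * (κ : BlockMatrix n ℤ).toBlocks₁₁ᵀ -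
          (κ : BlockMatrix n ℤ).toBlocks₁₂ * (κ : BlockMatrix n ℤ).toBlocks₁₁ᵀ)).submatrix
          (Fin.castLE hj) (Fin.castLE hj))).coeff (j - r) else 0) * charDetD ψ κ) ∧
        (psiStar ψ r γ ≠ 0 → r = e) := by
  obtain ⟨S', hS', hSS', κ', hκ', hψκ, hκκ'⟩ := gamma0_mul_heckeAdjoint ψ hκ hS
  obtain ⟨H, γ, e, hC, hD, hH, hγ⟩ := exists_triangular_cuspElement hp hψ hj hS'
  refine ⟨η * H, γ * κ', e, ?_, ?_, ?_, fun r hr => ?_⟩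
  · rw [toBlocks₂₁_mul, hC, mem_siegelParabolic.1 hη]; simp
  · rw [toBlocks₂₂_mul, mem_siegelParabolic.1 hη, Matrix.zero_mul, zero_add, det_mul, hD]
  · rw [Submonoid.coe_mul, Submonoid.coe_mul, Submonoid.coe_mul, Matrix.mul_assoc, hκκ',
      Matrix.mul_assoc, ← Matrix.mul_assoc (cuspElement n j : BlockMatrix n ℤ), hH]
    simp only [Matrix.mul_assoc]
  · rw [psiStar_mul_right hψ r γ hκ', hψκ, ← hSS']
    exact ⟨by rw [(hγ r hr).1], fun h => (hγ r hr).2 (left_ne_zero_of_mul h)⟩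

theorem exists_heckeRelated_right (hp : p ≠ 2) (γ' : symplecticGroup (Fin n) ℤ) (hS : Sᵀ = S) :
    ∃ γ, HeckeRelated p S γ' γ := by
  obtain ⟨j, hj, η, hη, κ, hκ, rfl⟩ := exists_cusp_decomposition (p := p) γ'
  -- The factorization itself involves no character; the trivial one serves to quote the lemma.
  have h1 : ∀ x : ZMod p, x ≠ 0 → (1 : DirichletCharacter ℂ p) x ^ 2 = 1 := fun x hx => by
    rw [MulChar.one_apply hx.isUnit, one_pow]
  obtain ⟨H, γ, e, hC, hD, hH, -⟩ := exists_heckeRelated_of_decomposition hp h1 hj hη hκ hS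
  refine ⟨γ, H, hC, ?_, hH⟩
  rw [hD]
  exact mul_ne_zero (det_parabolic_ne_zero hη)
    (pow_ne_zero _ (Int.natCast_ne_zero.2 (Fact.out : p.Prime).ne_zero))

/-- `J` as an element of `Sp(n, ℤ)`. -/
def weylJ (n : ℕ) : symplecticGroup (Fin n) ℤ := ⟨J (Fin n) ℤ, SymplecticGroup.J_mem _ _⟩

theorem heckeAdjoint_zero_mul_J :
    heckeAdjoint p (0 : Matrix (Fin n) (Fin n) ℤ) * J (Fin n) ℤ =
      J (Fin n) ℤ * heckeUpper p (0 : Matrix (Fin n) (Fin n) ℤ) := by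
  rw [heckeAdjoint, heckeUpper, J, fromBlocks_multiply, fromBlocks_multiply, fromBlocks_inj]
  simp

theorem heckeUpper_zero_mul_unipotent (hS : Sᵀ = S) :
    heckeUpper p 0 * (unipotentElement S hS : BlockMatrix n ℤ) = heckeUpper p S := by
  rw [heckeUpper, heckeUpper, unipotentElement, fromBlocks_multiply, fromBlocks_inj]
  simp

/-- Conjugation by J exchanges (p, 0; 0, 1) and (1, 0; 0, p), so the existence already proved for S
= 0 also factors γ(1, S; 0, p) as H₀γ'. Taking adjoints turns this into the required relation, with
H = pH₀⁻¹. -/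
theorem exists_heckeRelated_left (hp : p ≠ 2) (γ : symplecticGroup (Fin n) ℤ) (hS : Sᵀ = S) :
    ∃ γ', HeckeRelated p S γ' γ := by
  obtain ⟨γ₀, H₀, hC, hD, hH⟩ := exists_heckeRelated_right (p := p) hp (γ * (weylJ n)⁻¹)
    (transpose_zero : (0 : Matrix (Fin n) (Fin n) ℤ)ᵀ = 0)
  set γ' := γ₀ * weylJ n * unipotentElement S hS with hγ'
  have h₁ : H₀ * γ' = γ * heckeUpper p S := by
    rw [hγ', Submonoid.coe_mul, Submonoid.coe_mul, ← Matrix.mul_assoc, ← Matrix.mul_assoc, ← hH,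
      Matrix.mul_assoc _ (heckeAdjoint p 0)]
    change _ * (heckeAdjoint p 0 * J (Fin n) ℤ) * _ = _
    rw [heckeAdjoint_zero_mul_J, Submonoid.coe_mul, Matrix.mul_assoc, Matrix.mul_assoc,
      Matrix.mul_assoc, heckeUpper_zero_mul_unipotent, ← Matrix.mul_assoc (((weylJ n)⁻¹ :
        symplecticGroup (Fin n) ℤ) : BlockMatrix n ℤ)]
    change _ * (_ * (weylJ n : BlockMatrix n ℤ) * _) = _
    rw [coe_inv_mul, Matrix.one_mul]
  set H : BlockMatrix n ℤ := γ' * heckeAdjoint p S * ((γ⁻¹ : symplecticGroup (Fin n) ℤ) :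
    BlockMatrix n ℤ) with hHdef
  have h₂ : H₀ * H = (p : ℤ) • (1 : BlockMatrix n ℤ) := by
    rw [hHdef, ← Matrix.mul_assoc, ← Matrix.mul_assoc, h₁, Matrix.mul_assoc _ (heckeUpper p S),
      heckeUpper_mul_heckeAdjoint, Matrix.mul_smul, Matrix.mul_one, Matrix.smul_mul, coe_mul_inv]
  obtain ⟨h₃, h₄⟩ := lower_eq_zero_of_mul_eq_smul_one hC hD h₂
  exact ⟨γ', H, h₃, h₄, by rw [hHdef, Matrix.mul_assoc, coe_inv_mul, Matrix.mul_one]⟩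

/-- The quotient of `Sp(n, ℤ)` by the Siegel parabolic. -/
abbrev ParabolicQuotient (n : ℕ) : Type :=
  MulAction.orbitRel.Quotient (siegelParabolic n) (symplecticGroup (Fin n) ℤ)

theorem parabolicQuotient_mk_eq {g g' : symplecticGroup (Fin n) ℤ} :
    (Quotient.mk'' g : ParabolicQuotient n) = Quotient.mk'' g' ↔
      ∃ η ∈ siegelParabolic n, g = η * g' := by
  rw [Quotient.eq'', MulAction.orbitRel_apply, MulAction.mem_orbit_iff]
  exact ⟨fun ⟨η, h⟩ => ⟨η, η.2, h.symm⟩, fun ⟨η, hη, h⟩ => ⟨⟨η, hη⟩, h.symm⟩⟩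

theorem exists_out_eq (g : symplecticGroup (Fin n) ℤ) :
    ∃ η ∈ siegelParabolic n, (Quotient.mk'' g : ParabolicQuotient n).out = η * g :=
  parabolicQuotient_mk_eq.1 (Quotient.out_eq' _)

/-- The permutation of the parabolic quotient attached to `(p, -S; 0, 1)`. -/
theorem exists_heckePerm (hp : p ≠ 2) (hS : Sᵀ = S) :
    ∃ e : ParabolicQuotient n ≃ ParabolicQuotient n, ∀ x γ,
      HeckeRelated p S x.out γ → e x = Quotient.mk'' γ := by
  choose f hf using fun γ' => exists_heckeRelated_right (p := p) hp γ' hS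
  have key : ∀ (x : ParabolicQuotient n) γ, HeckeRelated p S x.out γ →
      (Quotient.mk'' (f x.out) : ParabolicQuotient n) = Quotient.mk'' γ := fun x γ h =>
    parabolicQuotient_mk_eq.2 ((hf x.out).right_unique h)
  refine ⟨Equiv.ofBijective (fun x => Quotient.mk'' (f x.out)) ⟨fun x y hxy => ?_, fun z => ?_⟩, key⟩
  · obtain ⟨η, hη, h⟩ := parabolicQuotient_mk_eq.1 hxy
    rw [← Quotient.out_eq' x, ← Quotient.out_eq' y]
    refine parabolicQuotient_mk_eq.2 ((hf x.out).left_unique (γ := f x.out) ?_)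
    rw [h]
    exact (hf y.out).mul_right hη
  · obtain ⟨γ', h⟩ := exists_heckeRelated_left (p := p) hp z.out hS
    refine ⟨Quotient.mk'' γ', ?_⟩
    obtain ⟨η, hη, h'⟩ := exists_out_eq γ'
    have := key (Quotient.mk'' γ') z.out (h' ▸ h.mul_left hη)
    exact this.trans (Quotient.out_eq' z)

/-- An affine map with linear part S ↦ ASAᵀ, A invertible modulo p. Being injective on a finite set,
it is a permutation, so sums over S do not depend on κ. -/
theorem symmetricAction_bijective {κ : symplecticGroup (Fin n) ℤ} (hκ : κ ∈ siegelGamma0 n p) :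
    ∃ e : SymmetricMatrix (Fin n) (ZMod p) ≃ SymmetricMatrix (Fin n) (ZMod p), ∀ S,
      (e S).1 = matrixMod p ((κ : BlockMatrix n ℤ).toBlocks₁₁ * matrixLift S.1 *
        (κ : BlockMatrix n ℤ).toBlocks₁₁ᵀ -
          (κ : BlockMatrix n ℤ).toBlocks₁₂ * (κ : BlockMatrix n ℤ).toBlocks₁₁ᵀ) := by
  set A := (κ : BlockMatrix n ℤ).toBlocks₁₁ with hA
  set B := (κ : BlockMatrix n ℤ).toBlocks₁₂ with hB
  let f : SymmetricMatrix (Fin n) (ZMod p) → SymmetricMatrix (Fin n) (ZMod p) := fun S =>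
    ⟨matrixMod p (A * matrixLift S.1 * Aᵀ - B * Aᵀ), by
      rw [← matrixMod_transpose, transpose_sub, transpose_mul, transpose_mul, transpose_mul,
        transpose_transpose, matrixLift_transpose S.2,
        (mul_transpose_eq_of_mem_symplectic κ.2).1, Matrix.mul_assoc]⟩
  have hinj : Function.Injective f := by
    intro S T h
    have h' := congrArg Subtype.val h
    simp only [f, map_sub, map_mul, matrixMod_matrixLift, sub_left_inj] at h'
    have h₂ : (matrixMod p (κ : BlockMatrix n ℤ).toBlocks₂₂)ᵀ * matrixMod p A = 1 := by
      have := congrArg transpose (gamma0_transpose_mul hκ)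
      rwa [transpose_mul, transpose_transpose, transpose_one] at this
    apply Subtype.ext
    have h₃ := congrArg (fun M => (matrixMod p (κ : BlockMatrix n ℤ).toBlocks₂₂)ᵀ * M *
      matrixMod p (κ : BlockMatrix n ℤ).toBlocks₂₂) h'
    have h₄ : ∀ M, (matrixMod p (κ : BlockMatrix n ℤ).toBlocks₂₂)ᵀ * (matrixMod p A * M *
        matrixMod p Aᵀ) * matrixMod p (κ : BlockMatrix n ℤ).toBlocks₂₂ = M := fun M => by
      calc _ = ((matrixMod p (κ : BlockMatrix n ℤ).toBlocks₂₂)ᵀ * matrixMod p A) * M *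
            ((matrixMod p A)ᵀ * matrixMod p (κ : BlockMatrix n ℤ).toBlocks₂₂) := by
              simp only [Matrix.mul_assoc, matrixMod_transpose]
        _ = M := by rw [h₂, gamma0_transpose_mul hκ, Matrix.one_mul, Matrix.mul_one]
    simpa only [h₄] using h₃
  exact ⟨Equiv.ofBijective f (Finite.injective_iff_bijective.1 hinj), fun S => rfl⟩

end Correspondence

/-! ### Representatives of the Hecke cosets -/

section HeckeCosets

variable {n p : ℕ} [Fact p.Prime]

/-- S is taken congruent to DᵀB ≡ A⁻¹B. Then κ carries (p, -S; 0, 1) to (p, -S'; 0, 1) with S'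
divisible by p, and τ_p times the latter is p times a unipotent element of Γ₀(p). -/
theorem exists_heckeTau_mul {κ : symplecticGroup (Fin n) ℤ} (hκ : κ ∈ siegelGamma0 n p) :
    ∃ S : SymmetricMatrix (Fin n) (ZMod p), ∃ δ ∈ siegelGamma0 n p,
      heckeTau n p * (κ : BlockMatrix n ℤ) = δ * heckeUpper p (matrixLift S.1) := by
  set A := (κ : BlockMatrix n ℤ).toBlocks₁₁ with hA
  set B := (κ : BlockMatrix n ℤ).toBlocks₁₂ with hB
  set D := (κ : BlockMatrix n ℤ).toBlocks₂₂ with hD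
  have hS : (matrixMod p (Dᵀ * B))ᵀ = matrixMod p (Dᵀ * B) := by
    rw [← matrixMod_transpose, transpose_mul, transpose_transpose,
      (transpose_mul_eq_of_mem_symplectic κ.2).2.1]
  have hAD : matrixMod p A * matrixMod p Dᵀ = 1 := by
    have := congrArg transpose (mul_eq_one_comm.1 (gamma0_transpose_mul hκ))
    rwa [transpose_mul, transpose_transpose, transpose_one] at this
  refine ⟨⟨_, hS⟩, ?_⟩
  obtain ⟨S', hS', hSS', κ', hκ', -, hκκ'⟩ :=
    gamma0_mul_heckeAdjoint (1 : DirichletCharacter ℂ p) hκ (matrixLift_transpose hS)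
  have h0 : matrixMod p S' = 0 := by
    rw [hSS', ← hA, ← hB, map_sub, map_mul, map_mul, map_mul, matrixMod_matrixLift, map_mul,
      ← Matrix.mul_assoc, hAD, Matrix.one_mul, sub_self]
  obtain ⟨X, hX⟩ := (matrixMod_eq_iff p S' 0).1 (by rw [h0, map_zero])
  rw [zero_add] at hX
  have hp0 : (p : ℤ) ≠ 0 := Int.natCast_ne_zero.2 (Fact.out : p.Prime).ne_zero
  have hXt : (-X)ᵀ = -X := by
    rw [hX, transpose_smul] at hS'
    rw [transpose_neg, smul_right_injective _ hp0 hS']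
  refine ⟨unipotentElement (-X) hXt * κ', mul_mem ?_ hκ', ?_⟩
  · rw [mem_siegelGamma0, unipotentElement, toBlocks_fromBlocks₂₁, map_zero]
  · have h₁ : heckeTau n p * heckeAdjoint p S' =
        (p : ℤ) • (unipotentElement (-X) hXt : BlockMatrix n ℤ) := by
      rw [heckeTau, heckeAdjoint, unipotentElement, fromBlocks_multiply, fromBlocks_smul, hX]
      simp only [Matrix.one_mul, Matrix.mul_zero, Matrix.zero_mul, Matrix.mul_one, add_zero,
        zero_add, smul_zero, smul_neg]
    refine smul_right_injective _ hp0 ?_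
    change (p : ℤ) • (heckeTau n p * (κ : BlockMatrix n ℤ)) = (p : ℤ) • _
    calc (p : ℤ) • (heckeTau n p * (κ : BlockMatrix n ℤ))
        = heckeTau n p * (κ * heckeAdjoint p (matrixLift (matrixMod p (Dᵀ * B)))) *
            heckeUpper p (matrixLift (matrixMod p (Dᵀ * B))) := by
          rw [Matrix.mul_assoc, Matrix.mul_assoc, heckeAdjoint_mul_heckeUpper, Matrix.mul_smul,
            Matrix.mul_one, Matrix.mul_smul]
      _ = _ := by
          rw [hκκ', ← Matrix.mul_assoc, h₁, Submonoid.coe_mul, Matrix.smul_mul, Matrix.smul_mul]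

theorem exists_heckeUpper_of_mem {M : BlockMatrix n ℤ} (hM : M ∈ heckeDoubleCoset n p) :
    ∃ S : SymmetricMatrix (Fin n) (ZMod p), ∃ δ ∈ siegelGamma0 n p,
      M = δ * heckeUpper p (matrixLift S.1) := by
  obtain ⟨_, ⟨κ₁, hκ₁, rfl⟩, _, ⟨κ₂, hκ₂, rfl⟩, rfl⟩ := DoubleCoset.mem_doubleCoset.1 hM
  obtain ⟨S, δ, hδ, h⟩ := exists_heckeTau_mul hκ₂
  refine ⟨S, κ₁ * δ, mul_mem hκ₁ hδ, ?_⟩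
  rw [Matrix.mul_assoc, h, Submonoid.coe_mul, Matrix.mul_assoc]

theorem heckeUpper_mem {S : Matrix (Fin n) (Fin n) ℤ} (hS : Sᵀ = S) :
    heckeUpper p S ∈ heckeDoubleCoset n p := by
  refine DoubleCoset.mem_doubleCoset.2 ⟨1, ⟨1, one_mem _, rfl⟩, unipotentElement S hS,
    ⟨_, ?_, rfl⟩, ?_⟩
  · change _ ∈ siegelGamma0 n p
    rw [mem_siegelGamma0, unipotentElement, toBlocks_fromBlocks₂₁, map_zero]
  · rw [Matrix.one_mul, ← heckeUpper_zero_mul_unipotent hS]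
    rfl

theorem heckeUpper_unique {S T : SymmetricMatrix (Fin n) (ZMod p)} {δ : symplecticGroup (Fin n) ℤ}
    (h : (δ : BlockMatrix n ℤ) * heckeUpper p (matrixLift S.1) = heckeUpper p (matrixLift T.1)) :
    S = T := by
  have h₁ := congrArg toBlocks₁₁ h
  have h₂ := congrArg toBlocks₁₂ h
  rw [toBlocks₁₁_mul] at h₁
  rw [toBlocks₁₂_mul] at h₂
  simp only [heckeUpper, toBlocks_fromBlocks₁₁, toBlocks_fromBlocks₁₂, toBlocks_fromBlocks₂₁,
    toBlocks_fromBlocks₂₂, Matrix.mul_one, Matrix.mul_zero, add_zero] at h₁ h₂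
  rw [h₁, Matrix.one_mul, Matrix.mul_smul, Matrix.mul_one] at h₂
  have h₃ := (matrixMod_eq_iff p _ _).2 ⟨_, h₂.symm⟩
  rw [matrixMod_matrixLift, matrixMod_matrixLift] at h₃
  exact Subtype.ext h₃.symm

theorem heckeCosets_mk_eq {M N : heckeDoubleCoset n p} :
    (Quotient.mk'' M : HeckeCosets n p) = Quotient.mk'' N ↔
      ∃ δ ∈ siegelGamma0 n p, M.1 = (δ : BlockMatrix n ℤ) * N.1 := by
  rw [Quotient.eq'']
  change MulAction.orbitRel _ _ _ _ ↔ _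
  rw [MulAction.orbitRel_apply, MulAction.mem_orbit_iff]
  exact ⟨fun ⟨η, h⟩ => ⟨η, η.2, h.symm⟩, fun ⟨η, hη, h⟩ => ⟨⟨η, hη⟩, h.symm⟩⟩

theorem exists_heckeCosets_equiv (n p : ℕ) [Fact p.Prime] :
    ∃ e : HeckeCosets n p ≃ SymmetricMatrix (Fin n) (ZMod p), ∀ c, ∃ δ ∈ siegelGamma0 n p,
      c.out.val = (δ : BlockMatrix n ℤ) * heckeUpper p (matrixLift (e c).1) := by
  choose f hf using fun c : HeckeCosets n p => exists_heckeUpper_of_mem c.out.2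
  refine ⟨Equiv.ofBijective f ⟨fun c c' h => ?_, fun S => ?_⟩, hf⟩
  · obtain ⟨δ, hδ, h₁⟩ := hf c
    obtain ⟨δ', hδ', h₂⟩ := hf c'
    rw [← Quotient.out_eq' c, ← Quotient.out_eq' c']
    refine heckeCosets_mk_eq.2 ⟨δ * δ'⁻¹, mul_mem hδ (inv_mem hδ'), ?_⟩
    rw [h₁, h₂, h, ← Matrix.mul_assoc, ← Submonoid.coe_mul, inv_mul_cancel_right]
  · refine ⟨Quotient.mk'' ⟨_, heckeUpper_mem (matrixLift_transpose S.2)⟩, ?_⟩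
    set c : HeckeCosets n p := Quotient.mk'' ⟨_, heckeUpper_mem (matrixLift_transpose S.2)⟩ with hc
    obtain ⟨δ, hδ, h₁⟩ := hf c
    obtain ⟨δ', hδ', h₂⟩ := heckeCosets_mk_eq.1 (Quotient.out_eq' c)
    refine heckeUpper_unique (δ := δ'⁻¹ * δ) ?_
    rw [Submonoid.coe_mul, Matrix.mul_assoc, ← h₁, h₂, ← Matrix.mul_assoc, coe_inv_mul,
      Matrix.one_mul]

end HeckeCosets

/-! ### The action of similitudes on the Siegel upper half space -/

section Action

open scoped ComplexOrder MatrixOrder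

variable {n : ℕ}

theorem toComplexMatrix_mul (M N : Matrix (Fin n) (Fin n) ℝ) :
    toComplexMatrix (M * N) = toComplexMatrix M * toComplexMatrix N :=
  map_mul Complex.ofRealHom.mapMatrix M N

theorem toComplexMatrix_add (M N : Matrix (Fin n) (Fin n) ℝ) :
    toComplexMatrix (M + N) = toComplexMatrix M + toComplexMatrix N :=
  map_add Complex.ofRealHom.mapMatrix M N

theorem toComplexMatrix_sub (M N : Matrix (Fin n) (Fin n) ℝ) :
    toComplexMatrix (M - N) = toComplexMatrix M - toComplexMatrix N :=
  map_sub Complex.ofRealHom.mapMatrix M N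

theorem toComplexMatrix_one : toComplexMatrix (1 : Matrix (Fin n) (Fin n) ℝ) = 1 :=
  map_one Complex.ofRealHom.mapMatrix

theorem toComplexMatrix_zero : toComplexMatrix (0 : Matrix (Fin n) (Fin n) ℝ) = 0 :=
  map_zero Complex.ofRealHom.mapMatrix

theorem toComplexMatrix_smul (a : ℝ) (M : Matrix (Fin n) (Fin n) ℝ) :
    toComplexMatrix (a • M) = (a : ℂ) • toComplexMatrix M := by
  ext i j; simp [toComplexMatrix]

theorem toComplexMatrix_det (M : Matrix (Fin n) (Fin n) ℝ) :
    (toComplexMatrix M).det = (M.det : ℂ) :=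
  (Complex.ofRealHom.map_det M).symm

theorem toComplexMatrix_conjTranspose (M : Matrix (Fin n) (Fin n) ℝ) :
    (toComplexMatrix M)ᴴ = toComplexMatrix Mᵀ := by
  ext i j; simp [toComplexMatrix]

theorem toComplexMatrix_transpose (M : Matrix (Fin n) (Fin n) ℝ) :
    (toComplexMatrix M)ᵀ = toComplexMatrix Mᵀ := rfl

theorem exists_eq_transpose_mul_self {Y : Matrix (Fin n) (Fin n) ℝ} (hY : Y.PosDef) :
    ∃ B B' : Matrix (Fin n) (Fin n) ℝ, B * B' = 1 ∧ Y = Bᵀ * B := by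
  obtain ⟨B, hB⟩ := CStarAlgebra.nonneg_iff_eq_star_mul_self.mp hY.posSemidef.nonneg
  rw [star_eq_conjTranspose, conjTranspose_eq_transpose_of_trivial] at hB
  refine ⟨B, B⁻¹, mul_nonsing_inv B ?_, hB⟩
  have := hY.det_pos
  rw [hB, det_mul, det_transpose] at this
  exact isUnit_iff_ne_zero.2 fun h => by simp [h] at this

theorem posDef_toComplexMatrix {Y : Matrix (Fin n) (Fin n) ℝ} (hY : Y.PosDef) :
    (toComplexMatrix Y).PosDef := by
  obtain ⟨B, B', hB, rfl⟩ := exists_eq_transpose_mul_self hY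
  rw [toComplexMatrix_mul, ← toComplexMatrix_conjTranspose]
  refine PosDef.conjTranspose_mul_self _ (mulVec_injective_iff_isUnit.2 ?_)
  exact IsUnit.of_mul_eq_one _ (by rw [← toComplexMatrix_mul, hB, toComplexMatrix_one])

theorem posDef_of_toComplexMatrix {Y : Matrix (Fin n) (Fin n) ℝ}
    (hY : (toComplexMatrix Y).PosDef) : Y.PosDef := by
  refine PosDef.of_dotProduct_mulVec_pos ?_ fun x hx => ?_
  · have := hY.1
    ext i j
    have h := congrFun (congrFun this i) j
    simpa [toComplexMatrix] using h
  · have h := hY.dotProduct_mulVec_pos (x := fun i => (x i : ℂ))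
      (fun h => hx (funext fun i => by simpa using congrFun h i))
    have e : star (fun i => (x i : ℂ)) ⬝ᵥ (toComplexMatrix Y *ᵥ fun i => (x i : ℂ)) =
        ((star x ⬝ᵥ (Y *ᵥ x) : ℝ) : ℂ) := by
      simp [dotProduct, mulVec, toComplexMatrix]
    rw [e] at h
    exact_mod_cast h

/-- The numerator `AZ + B`. -/
def siegelNumer (g : BlockMatrix n ℝ) (Z : Matrix (Fin n) (Fin n) ℂ) : Matrix (Fin n) (Fin n) ℂ :=
  toComplexMatrix g.toBlocks₁₁ * Z + toComplexMatrix g.toBlocks₁₂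

/-- The denominator `CZ + D`. -/
def siegelDenom (g : BlockMatrix n ℝ) (Z : Matrix (Fin n) (Fin n) ℂ) : Matrix (Fin n) (Fin n) ℂ :=
  toComplexMatrix g.toBlocks₂₁ * Z + toComplexMatrix g.toBlocks₂₂

theorem similitude_relations {g : BlockMatrix n ℝ} {μ : ℝ}
    (hg : gᵀ * J (Fin n) ℝ * g = μ • J (Fin n) ℝ) :
    g.toBlocks₁₁ᵀ * g.toBlocks₂₁ - g.toBlocks₂₁ᵀ * g.toBlocks₁₁ = 0 ∧
      g.toBlocks₁₁ᵀ * g.toBlocks₂₂ - g.toBlocks₂₁ᵀ * g.toBlocks₁₂ = μ • 1 ∧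
      g.toBlocks₁₂ᵀ * g.toBlocks₂₁ - g.toBlocks₂₂ᵀ * g.toBlocks₁₁ = -(μ • 1) ∧
      g.toBlocks₁₂ᵀ * g.toBlocks₂₂ - g.toBlocks₂₂ᵀ * g.toBlocks₁₂ = 0 := by
  rw [← fromBlocks_toBlocks g, J, fromBlocks_transpose, fromBlocks_multiply, fromBlocks_multiply,
    fromBlocks_smul, fromBlocks_inj] at hg
  simp only [Matrix.mul_zero, Matrix.mul_one, Matrix.mul_neg, zero_add, add_zero, Matrix.neg_mul,
    smul_zero, smul_neg] at hg
  obtain ⟨h₁, h₂, h₃, h₄⟩ := hg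
  refine ⟨?_, ?_, ?_, ?_⟩
  · rw [← neg_eq_zero, ← h₁]; abel
  · rw [← neg_inj, ← h₂]; abel
  · rw [← h₃]; abel
  · rw [← neg_eq_zero, ← h₄]; abel

/-- A polarized form of the similitude relation: U = Zᴴ gives the formula for the imaginary part of
g⟨Z⟩, and U = Z its symmetry. -/
theorem siegelNumer_mul_sub {g : BlockMatrix n ℝ} {μ : ℝ}
    (hg : gᵀ * J (Fin n) ℝ * g = μ • J (Fin n) ℝ) (U V : Matrix (Fin n) (Fin n) ℂ) :
    (U * toComplexMatrix g.toBlocks₁₁ᵀ + toComplexMatrix g.toBlocks₁₂ᵀ) * siegelDenom g V -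
      (U * toComplexMatrix g.toBlocks₂₁ᵀ + toComplexMatrix g.toBlocks₂₂ᵀ) * siegelNumer g V =
        (μ : ℂ) • (U - V) := by
  obtain ⟨h₁, h₂, h₃, h₄⟩ := similitude_relations hg
  apply_fun toComplexMatrix at h₁ h₂ h₃ h₄
  simp only [toComplexMatrix_sub, toComplexMatrix_mul, toComplexMatrix_zero] at h₁ h₂ h₃ h₄
  rw [toComplexMatrix_smul, toComplexMatrix_one] at h₂
  rw [show -(μ • (1 : Matrix (Fin n) (Fin n) ℝ)) = (-μ) • 1 from (neg_smul _ _).symm,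
    toComplexMatrix_smul, toComplexMatrix_one] at h₃
  rw [siegelDenom, siegelNumer]
  calc _ = U * (toComplexMatrix g.toBlocks₁₁ᵀ * toComplexMatrix g.toBlocks₂₁ -
          toComplexMatrix g.toBlocks₂₁ᵀ * toComplexMatrix g.toBlocks₁₁) * V +
        U * (toComplexMatrix g.toBlocks₁₁ᵀ * toComplexMatrix g.toBlocks₂₂ -
          toComplexMatrix g.toBlocks₂₁ᵀ * toComplexMatrix g.toBlocks₁₂) +
        (toComplexMatrix g.toBlocks₁₂ᵀ * toComplexMatrix g.toBlocks₂₁ -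
          toComplexMatrix g.toBlocks₂₂ᵀ * toComplexMatrix g.toBlocks₁₁) * V +
        (toComplexMatrix g.toBlocks₁₂ᵀ * toComplexMatrix g.toBlocks₂₂ -
          toComplexMatrix g.toBlocks₂₂ᵀ * toComplexMatrix g.toBlocks₁₂) := by noncomm_ring
    _ = _ := by
      rw [h₁, h₂, h₃, h₄, Matrix.mul_zero, Matrix.zero_mul, zero_add, add_zero, Matrix.mul_smul,
        Matrix.mul_one, Matrix.smul_mul, Matrix.one_mul, smul_sub, Complex.ofReal_neg, neg_smul,
        sub_eq_add_neg]

theorem conjTranspose_sub_self {Z : Matrix (Fin n) (Fin n) ℂ} (hZ : Zᵀ = Z) :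
    Zᴴ - Z = (-2 * Complex.I) • toComplexMatrix (Z.map Complex.im) := by
  have : Zᴴ = Z.map star := by rw [conjTranspose, hZ]
  rw [this]
  ext i j
  apply Complex.ext <;> simp [toComplexMatrix]
  ring

variable {g : BlockMatrix n ℝ} {μ : ℝ} {Z : Matrix (Fin n) (Fin n) ℂ}

theorem numer_denom_hermitian (hg : gᵀ * J (Fin n) ℝ * g = μ • J (Fin n) ℝ) (hZ : Zᵀ = Z) :
    (siegelNumer g Z)ᴴ * siegelDenom g Z - (siegelDenom g Z)ᴴ * siegelNumer g Z =
      (μ : ℂ) • (-2 * Complex.I) • toComplexMatrix (Z.map Complex.im) := by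
  rw [← conjTranspose_sub_self hZ, ← siegelNumer_mul_sub hg]
  congr 2 <;>
  · simp only [siegelNumer, siegelDenom, conjTranspose_add, conjTranspose_mul,
      toComplexMatrix_conjTranspose]

theorem numer_denom_symmetric (hg : gᵀ * J (Fin n) ℝ * g = μ • J (Fin n) ℝ) (hZ : Zᵀ = Z) :
    (siegelNumer g Z)ᵀ * siegelDenom g Z = (siegelDenom g Z)ᵀ * siegelNumer g Z := by
  rw [← sub_eq_zero, ← smul_zero (μ : ℂ), ← sub_self Z, ← siegelNumer_mul_sub hg]
  congr 2 <;>
  · simp only [siegelNumer, siegelDenom, transpose_add, transpose_mul,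
      toComplexMatrix_transpose, hZ]

/-- Evaluating `numer_denom_hermitian` on a null vector of CZ + D gives zero on the left and a
nonzero multiple of the positive definite form Y on the right. -/
theorem siegelDenom_det_ne_zero (hg : gᵀ * J (Fin n) ℝ * g = μ • J (Fin n) ℝ) (hμ : μ ≠ 0)
    (hZ : Z ∈ siegelUpperHalfSpace n) : (siegelDenom g Z).det ≠ 0 := by
  intro h0
  obtain ⟨v, hv, hv0⟩ := exists_mulVec_eq_zero_iff.2 h0
  have h := congrArg (fun M => star v ⬝ᵥ (M *ᵥ v)) (numer_denom_hermitian hg hZ.1)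
  simp only [sub_mulVec, ← mulVec_mulVec, hv0, mulVec_zero, dotProduct_sub, smul_mulVec,
    dotProduct_smul, dotProduct_zero, zero_sub] at h
  rw [dotProduct_neg, dotProduct_mulVec _ (siegelDenom g Z)ᴴ, ← star_mulVec, hv0, star_zero,
    zero_dotProduct, neg_zero] at h
  have hpos := (posDef_toComplexMatrix hZ.2).dotProduct_mulVec_pos hv
  have := hpos.ne'
  simp [hμ, this] at h

theorem siegelAction_eq : siegelAction g Z = siegelNumer g Z * (siegelDenom g Z)⁻¹ := rfl

theorem toComplexMatrix_im_siegelAction (hg : gᵀ * J (Fin n) ℝ * g = μ • J (Fin n) ℝ) (hμ : μ ≠ 0)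
    (hZ : Z ∈ siegelUpperHalfSpace n) : (siegelAction g Z)ᵀ = siegelAction g Z ∧
    toComplexMatrix ((siegelAction g Z).map Complex.im) =
      (μ : ℂ) • (((siegelDenom g Z)⁻¹)ᴴ * toComplexMatrix (Z.map Complex.im) *
        (siegelDenom g Z)⁻¹) := by
  have hdet := isUnit_iff_ne_zero.2 (siegelDenom_det_ne_zero hg hμ hZ)
  have hinv := mul_nonsing_inv _ hdet
  set M := siegelDenom g Z with hM
  set N := siegelNumer g Z with hN
  have hinvT : (M⁻¹)ᵀ * Mᵀ = 1 := by rw [← transpose_mul, hinv, transpose_one]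
  have hinvH : (M⁻¹)ᴴ * Mᴴ = 1 := by rw [← conjTranspose_mul, hinv, conjTranspose_one]
  have hsym : (siegelAction g Z)ᵀ = siegelAction g Z := by
    rw [siegelAction_eq, transpose_mul]
    calc (M⁻¹)ᵀ * Nᵀ = (M⁻¹)ᵀ * (Nᵀ * M) * M⁻¹ := by
          rw [Matrix.mul_assoc, Matrix.mul_assoc Nᵀ, hinv, Matrix.mul_one]
      _ = (M⁻¹)ᵀ * Mᵀ * (N * M⁻¹) := by
          rw [numer_denom_symmetric hg hZ.1]; simp only [Matrix.mul_assoc, hM, hN]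
      _ = _ := by rw [hinvT, Matrix.one_mul]
  refine ⟨hsym, ?_⟩
  have h₁ : (siegelAction g Z)ᴴ - siegelAction g Z =
      (M⁻¹)ᴴ * ((μ : ℂ) • (-2 * Complex.I) • toComplexMatrix (Z.map Complex.im)) * M⁻¹ := by
    rw [← numer_denom_hermitian hg hZ.1, ← hM, ← hN, siegelAction_eq, ← hM, ← hN,
      conjTranspose_mul]
    calc (M⁻¹)ᴴ * Nᴴ - N * M⁻¹ = (M⁻¹)ᴴ * Nᴴ * (M * M⁻¹) - ((M⁻¹)ᴴ * Mᴴ) * (N * M⁻¹) := by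
          rw [hinv, hinvH, Matrix.mul_one, Matrix.one_mul]
      _ = _ := by noncomm_ring
  rw [conjTranspose_sub_self hsym] at h₁
  have h2I : (-2 * Complex.I) ≠ 0 := by simp
  refine smul_right_injective _ h2I ?_
  change (-2 * Complex.I) • _ = (-2 * Complex.I) • _
  rw [h₁, smul_comm, Matrix.mul_smul, Matrix.mul_smul, Matrix.smul_mul, Matrix.smul_mul]

theorem siegelAction_mem (hg : gᵀ * J (Fin n) ℝ * g = μ • J (Fin n) ℝ) (hμ : 0 < μ)
    (hZ : Z ∈ siegelUpperHalfSpace n) : siegelAction g Z ∈ siegelUpperHalfSpace n := by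
  obtain ⟨h₁, h₂⟩ := toComplexMatrix_im_siegelAction hg hμ.ne' hZ
  refine ⟨h₁, posDef_of_toComplexMatrix ?_⟩
  rw [h₂]
  have hdet := isUnit_iff_ne_zero.2 (siegelDenom_det_ne_zero hg hμ.ne' hZ)
  refine PosDef.smul ((posDef_toComplexMatrix hZ.2).conjTranspose_mul_mul_same
    (mulVec_injective_iff_isUnit.2 ?_)) (by exact_mod_cast hμ)
  exact IsUnit.of_mul_eq_one _ (nonsing_inv_mul _ hdet)

theorem det_im_siegelAction (hg : gᵀ * J (Fin n) ℝ * g = μ • J (Fin n) ℝ) (hμ : 0 < μ)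
    (hZ : Z ∈ siegelUpperHalfSpace n) : ((siegelAction g Z).map Complex.im).det =
      μ ^ n * (Z.map Complex.im).det / ‖(siegelDenom g Z).det‖ ^ 2 := by
  have h := congrArg det (toComplexMatrix_im_siegelAction hg hμ.ne' hZ).2
  rw [toComplexMatrix_det, det_smul, det_mul, det_mul, det_conjTranspose, toComplexMatrix_det,
    det_nonsing_inv, Ring.inverse_eq_inv', Fintype.card_fin] at h
  have hn : ((‖(siegelDenom g Z).det‖ ^ 2 : ℝ) : ℂ) =
      star (siegelDenom g Z).det * (siegelDenom g Z).det := by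
    rw [← Complex.normSq_eq_norm_sq, Complex.normSq_eq_conj_mul_self]; rfl
  apply Complex.ofReal_injective
  rw [h, Complex.ofReal_div, hn]
  push_cast
  rw [star_inv₀]
  field_simp

theorem siegelDenom_mul {g' : BlockMatrix n ℝ} (h : (siegelDenom g Z).det ≠ 0) :
    siegelDenom (g' * g) Z = siegelDenom g' (siegelAction g Z) * siegelDenom g Z := by
  have hinv := nonsing_inv_mul _ (isUnit_iff_ne_zero.2 h)
  rw [siegelDenom, toBlocks₂₁_mul, toBlocks₂₂_mul, siegelDenom, siegelAction_eq, Matrix.add_mul,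
    Matrix.mul_assoc, Matrix.mul_assoc (siegelNumer g Z), hinv, Matrix.mul_one, siegelNumer,
    siegelDenom]
  simp only [toComplexMatrix_add, toComplexMatrix_mul]
  noncomm_ring

end Action

/-! ### The summands of the Eisenstein series -/

section Summand

variable {n : ℕ}

theorem toRealBlock_mul (M N : BlockMatrix n ℤ) :
    toRealBlock (M * N) = toRealBlock M * toRealBlock N :=
  map_mul (Int.castRingHom ℝ).mapMatrix M N

theorem toRealBlock_similitude {M : BlockMatrix n ℤ} {m : ℤ}
    (h : Mᵀ * J (Fin n) ℤ * M = m • J (Fin n) ℤ) :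
    (toRealBlock M)ᵀ * J (Fin n) ℝ * toRealBlock M = (m : ℝ) • J (Fin n) ℝ := by
  have hJ : toRealBlock (J (Fin n) ℤ) = J (Fin n) ℝ := map_J (Fin n) (Int.castRingHom ℝ)
  have h' := congrArg toRealBlock h
  rw [toRealBlock_mul, toRealBlock_mul, hJ] at h'
  rw [← hJ]
  rw [← hJ] at h'
  refine h'.trans ?_
  ext i j
  change (((m • J (Fin n) ℤ) i j : ℤ) : ℝ) = (m : ℝ) * ((J (Fin n) ℤ i j : ℤ) : ℝ)
  rw [Matrix.smul_apply, smul_eq_mul, Int.cast_mul]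

theorem toRealBlock_symplectic (γ : symplecticGroup (Fin n) ℤ) :
    (toRealBlock (γ : BlockMatrix n ℤ))ᵀ * J (Fin n) ℝ * toRealBlock (γ : BlockMatrix n ℤ) =
      (1 : ℝ) • J (Fin n) ℝ := by
  have := toRealBlock_similitude (M := (γ : BlockMatrix n ℤ)) (m := 1)
    (by rw [one_smul]; exact SymplecticGroup.mem_iff'.1 γ.2)
  simpa using this

theorem autFactor_eq {g : BlockMatrix n ℝ} {μ : ℝ}
    (hg : gᵀ * J (Fin n) ℝ * g = μ • J (Fin n) ℝ) (Z : Matrix (Fin n) (Fin n) ℂ) :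
    autFactor g Z = ((μ ^ (-(n : ℝ) / 2) : ℝ) : ℂ) * (siegelDenom g Z).det := by
  have h : similitude g ^ (-(n : ℝ) / 2) = μ ^ (-(n : ℝ) / 2) := by
    -- For n = 0 the similitude factor is undetermined, but the exponent is 0. For n > 0 an entry of
    -- J determines it.
    rcases Nat.eq_zero_or_pos n with rfl | hn
    · simp
    · have h₁ : gᵀ * J (Fin n) ℝ * g = similitude g • J (Fin n) ℝ :=
        Classical.epsilon_spec (p := fun μ : ℝ => gᵀ * J (Fin n) ℝ * g = μ • J (Fin n) ℝ) ⟨μ, hg⟩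
      have h₂ := congrFun (congrFun (h₁.symm.trans hg) (Sum.inr ⟨0, hn⟩)) (Sum.inl ⟨0, hn⟩)
      have h₃ : similitude g = μ := by simpa [J] using h₂
      rw [h₃]
  rw [autFactor, h]
  rfl

/-- The function `w ↦ w ^ (-k) |w| ^ (-2 s + k)`. -/
noncomputable def eisensteinTerm (k : ℤ) (s w : ℂ) : ℂ :=
  w ^ (-k) * ((‖w‖ : ℝ) : ℂ) ^ (-2 * s + (k : ℂ))

theorem eisensteinTerm_mul (k : ℤ) (s w w' : ℂ) :
    eisensteinTerm k s (w * w') = eisensteinTerm k s w * eisensteinTerm k s w' := by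
  rw [eisensteinTerm, eisensteinTerm, eisensteinTerm, mul_zpow, norm_mul, Complex.ofReal_mul,
    Complex.mul_cpow_ofReal_nonneg (norm_nonneg _) (norm_nonneg _)]
  ring

theorem eisensteinTerm_ofReal (k : ℤ) (s : ℂ) {x : ℝ} (hx : 0 < x) :
    eisensteinTerm k s x = (x : ℂ) ^ (-2 * s) := by
  have hx' : (x : ℂ) ≠ 0 := by exact_mod_cast hx.ne'
  rw [eisensteinTerm, Complex.norm_of_nonneg hx.le, ← Complex.cpow_intCast, ← Complex.cpow_add _ _ hx']
  congr 1
  push_cast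
  ring

theorem eisensteinTerm_one (k : ℤ) (s : ℂ) : eisensteinTerm k s 1 = 1 := by
  simp [eisensteinTerm]

theorem eisensteinTerm_neg_one (k : ℤ) (s : ℂ) : eisensteinTerm k s (-1) = (-1) ^ k := by
  rw [eisensteinTerm, norm_neg, norm_one, Complex.ofReal_one, Complex.one_cpow, mul_one,
    _root_.zpow_neg, ← _root_.inv_zpow, inv_neg, inv_one]

theorem norm_eisensteinTerm (k : ℤ) (s : ℂ) {w : ℂ} (hw : w ≠ 0) :
    ‖eisensteinTerm k s w‖ = ‖w‖ ^ (-2 * s.re) := by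
  have h := norm_pos_iff.2 hw
  rw [eisensteinTerm, norm_mul, norm_zpow, Complex.norm_cpow_eq_rpow_re_of_pos h,
    ← Real.rpow_intCast, ← Real.rpow_add h]
  congr 1
  simp

/-- The summand of the Eisenstein series at `Z`, without the character. -/
noncomputable def autTerm (k : ℤ) (s : ℂ) (Z : Matrix (Fin n) (Fin n) ℂ) (M : BlockMatrix n ℤ) :
    ℂ :=
  eisensteinTerm k s (siegelDenom (toRealBlock M) Z).det

theorem autTerm_triangular_mul (k : ℤ) (s : ℂ) (Z : Matrix (Fin n) (Fin n) ℂ)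
    {H : BlockMatrix n ℤ} (hH : H.toBlocks₂₁ = 0) (M : BlockMatrix n ℤ) :
    autTerm k s Z (H * M) = eisensteinTerm k s (H.toBlocks₂₂.det : ℂ) * autTerm k s Z M := by
  have h : siegelDenom (toRealBlock (H * M)) Z =
      toComplexMatrix (toRealBlock H).toBlocks₂₂ * siegelDenom (toRealBlock M) Z := by
    have h0 : (toRealBlock H).toBlocks₂₁ = 0 := by
      have : (toRealBlock H).toBlocks₂₁ = H.toBlocks₂₁.map (Int.cast : ℤ → ℝ) := rfl
      rw [this, hH]
      ext i j; simp
    rw [toRealBlock_mul, siegelDenom, siegelDenom, toBlocks₂₁_mul, toBlocks₂₂_mul, h0,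
      Matrix.zero_mul, Matrix.zero_mul, zero_add, zero_add, toComplexMatrix_mul,
      toComplexMatrix_mul, Matrix.mul_add, Matrix.mul_assoc]
  have hd : (toComplexMatrix (toRealBlock H).toBlocks₂₂).det = (H.toBlocks₂₂.det : ℂ) := by
    rw [toComplexMatrix_det]
    have : (toRealBlock H).toBlocks₂₂ = (Int.castRingHom ℝ).mapMatrix H.toBlocks₂₂ := rfl
    rw [this, ← RingHom.map_det]
    simp
  rw [autTerm, h, det_mul, hd, eisensteinTerm_mul]
  rfl

theorem siegelDenom_sympl_det_ne_zero {Z : Matrix (Fin n) (Fin n) ℂ}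
    (hZ : Z ∈ siegelUpperHalfSpace n) (γ : symplecticGroup (Fin n) ℤ) :
    (siegelDenom (toRealBlock (γ : BlockMatrix n ℤ)) Z).det ≠ 0 :=
  siegelDenom_det_ne_zero (toRealBlock_symplectic γ) one_ne_zero hZ

/-! ### Comparison of det(CZ + D) at two points, uniformly in γ -/

section Bound

/-- The diagonal entry of the hypothesis says that the squared norms in row a add up to -Im V a a,
which is at most ‖V a a‖. Hence ‖V a a‖ ≤ 1, and then every entry of the row is bounded by 1. -/
theorem norm_entries_le_one {V : Matrix (Fin n) (Fin n) ℂ}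
    (hV : V - Vᴴ = (-2 * Complex.I) • (V * Vᴴ)) (a b : Fin n) : ‖V a b‖ ≤ 1 := by
  have h := congrFun (congrFun hV a) a
  rw [Matrix.sub_apply, Matrix.smul_apply, mul_apply, conjTranspose_apply] at h
  have h₁ : ∑ j, V a j * Vᴴ j a = ((∑ j, ‖V a j‖ ^ 2 : ℝ) : ℂ) := by
    rw [Complex.ofReal_sum]
    refine Finset.sum_congr rfl fun j _ => ?_
    rw [conjTranspose_apply, ← Complex.normSq_eq_norm_sq, ← Complex.mul_conj]
    rfl
  rw [h₁] at h
  have him : (V a a).im = -∑ j, ‖V a j‖ ^ 2 := by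
    have := congrArg Complex.im h
    simp at this
    norm_cast at this
    linarith
  have hle : ∀ j, ‖V a j‖ ^ 2 ≤ ‖V a a‖ := fun j => by
    calc ‖V a j‖ ^ 2 ≤ ∑ j, ‖V a j‖ ^ 2 :=
          Finset.single_le_sum (f := fun j => ‖V a j‖ ^ 2) (fun _ _ => by positivity)
            (Finset.mem_univ j)
      _ = -(V a a).im := by rw [him, neg_neg]
      _ ≤ |(V a a).im| := neg_le_abs _
      _ ≤ ‖V a a‖ := Complex.abs_im_le_norm _
  have ha : ‖V a a‖ ≤ 1 := by nlinarith [hle a, norm_nonneg (V a a)]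
  nlinarith [hle b, norm_nonneg (V a b)]

/-- The matrix (CZ + D)⁻¹C, normalized by a square root B of Y, satisfies the hypothesis of
`norm_entries_le_one`, thanks to the relation CDᵀ = DCᵀ. -/
theorem denom_inv_mul_bound {Z : Matrix (Fin n) (Fin n) ℂ} (hZ : Z ∈ siegelUpperHalfSpace n)
    {B : Matrix (Fin n) (Fin n) ℝ} (hB : Z.map Complex.im = Bᵀ * B)
    (γ : symplecticGroup (Fin n) ℤ) (a b : Fin n) :
    ‖(toComplexMatrix B * (siegelDenom (toRealBlock (γ : BlockMatrix n ℤ)) Z)⁻¹ *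
      toComplexMatrix (toRealBlock (γ : BlockMatrix n ℤ)).toBlocks₂₁ * toComplexMatrix Bᵀ) a b‖ ≤
        1 := by
  have hinv := nonsing_inv_mul _ (isUnit_iff_ne_zero.2 (siegelDenom_sympl_det_ne_zero hZ γ))
  have hrel : (toRealBlock (γ : BlockMatrix n ℤ)).toBlocks₂₁ *
      (toRealBlock (γ : BlockMatrix n ℤ)).toBlocks₂₂ᵀ =
      (toRealBlock (γ : BlockMatrix n ℤ)).toBlocks₂₂ *
        (toRealBlock (γ : BlockMatrix n ℤ)).toBlocks₂₁ᵀ :=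
    (mul_transpose_eq_of_mem_symplectic (SymplecticGroup.map_mem γ.2 (Int.castRingHom ℝ))).2.1
  have hrel' := congrArg toComplexMatrix hrel
  rw [toComplexMatrix_mul, toComplexMatrix_mul] at hrel'
  set N := siegelDenom (toRealBlock (γ : BlockMatrix n ℤ)) Z with hN
  set C := (toRealBlock (γ : BlockMatrix n ℤ)).toBlocks₂₁ with hC
  set D := (toRealBlock (γ : BlockMatrix n ℤ)).toBlocks₂₂ with hD
  have hinvH : Nᴴ * (N⁻¹)ᴴ = 1 := by rw [← conjTranspose_mul, hinv, conjTranspose_one]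
  refine norm_entries_le_one ?_ a b
  have hY : Z - Zᴴ = (2 * Complex.I) • (toComplexMatrix Bᵀ * toComplexMatrix B) := by
    rw [← toComplexMatrix_mul, ← hB, ← neg_sub, conjTranspose_sub_self hZ.1, ← neg_smul]
    simp
  have h₁ : toComplexMatrix C * Nᴴ - N * toComplexMatrix Cᵀ =
      (-2 * Complex.I) • (toComplexMatrix C * toComplexMatrix Bᵀ * toComplexMatrix B *
        toComplexMatrix Cᵀ) := by
    rw [hN, siegelDenom, conjTranspose_add, conjTranspose_mul, toComplexMatrix_conjTranspose,
      toComplexMatrix_conjTranspose, ← hC, ← hD]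
    calc _ = -(toComplexMatrix C * (Z - Zᴴ) * toComplexMatrix Cᵀ) +
          (toComplexMatrix C * toComplexMatrix Dᵀ - toComplexMatrix D * toComplexMatrix Cᵀ) := by
            noncomm_ring
      _ = _ := by
        rw [hrel', sub_self, add_zero, hY, Matrix.mul_smul, Matrix.smul_mul, neg_mul, neg_smul]
        simp only [Matrix.mul_assoc]
  rw [conjTranspose_mul, conjTranspose_mul, conjTranspose_mul, toComplexMatrix_conjTranspose,
    toComplexMatrix_conjTranspose, toComplexMatrix_conjTranspose, transpose_transpose]
  calc _ = toComplexMatrix B * N⁻¹ * toComplexMatrix C * (Nᴴ * (N⁻¹)ᴴ) * toComplexMatrix Bᵀ -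
        toComplexMatrix B * (N⁻¹ * N) * toComplexMatrix Cᵀ * (N⁻¹)ᴴ * toComplexMatrix Bᵀ := by
          rw [hinvH, hinv, Matrix.mul_one, Matrix.mul_one]
          simp only [Matrix.mul_assoc]
    _ = toComplexMatrix B * N⁻¹ * (toComplexMatrix C * Nᴴ - N * toComplexMatrix Cᵀ) *
        (N⁻¹)ᴴ * toComplexMatrix Bᵀ := by noncomm_ring
    _ = _ := by
      rw [h₁]
      simp only [Matrix.mul_smul, Matrix.smul_mul, Matrix.mul_assoc]

theorem isCompact_norm_entries_le_one :
    IsCompact {V : Matrix (Fin n) (Fin n) ℂ | ∀ a b, ‖V a b‖ ≤ 1} := by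
  have h : IsCompact (Set.pi Set.univ fun _ : Fin n => Set.pi Set.univ fun _ : Fin n =>
      Metric.closedBall (0 : ℂ) 1) :=
    isCompact_univ_pi fun _ => isCompact_univ_pi fun _ => isCompact_closedBall _ _
  have e : ({V | ∀ a b, ‖V a b‖ ≤ 1} : Set (Fin n → Fin n → ℂ)) = Set.pi Set.univ fun _ =>
      Set.pi Set.univ fun _ => Metric.closedBall (0 : ℂ) 1 := by
    ext V
    simp [Set.mem_pi]
  rw [← e] at h
  exact h

/-- CZ + D = N(1 + N⁻¹C(Z - Z')) with N = CZ' + D, and N⁻¹C stays in a compact set independent of γ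
by `denom_inv_mul_bound`. -/
theorem exists_det_bound {Z Z' : Matrix (Fin n) (Fin n) ℂ} (hZ' : Z' ∈ siegelUpperHalfSpace n) :
    ∃ c : ℝ, 0 < c ∧ ∀ γ : symplecticGroup (Fin n) ℤ,
      ‖(siegelDenom (toRealBlock (γ : BlockMatrix n ℤ)) Z).det‖ ≤
        c * ‖(siegelDenom (toRealBlock (γ : BlockMatrix n ℤ)) Z').det‖ := by
  obtain ⟨B, B', hBB', hB⟩ := exists_eq_transpose_mul_self hZ'.2
  have hcont : Continuous fun V : Matrix (Fin n) (Fin n) ℂ => (1 + toComplexMatrix B' * V *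
      toComplexMatrix B'ᵀ * (Z - Z')).det :=
    (continuous_const.add (((continuous_const.matrix_mul continuous_id).matrix_mul
      continuous_const).matrix_mul continuous_const)).matrix_det
  obtain ⟨c, hc⟩ := isCompact_norm_entries_le_one.exists_bound_of_continuousOn
    hcont.continuousOn
  refine ⟨max c 1, lt_max_of_lt_right one_pos, fun γ => ?_⟩
  have hinv := mul_nonsing_inv _ (isUnit_iff_ne_zero.2 (siegelDenom_sympl_det_ne_zero hZ' γ))
  have hb := denom_inv_mul_bound hZ' hB γ
  set N := siegelDenom (toRealBlock (γ : BlockMatrix n ℤ)) Z' with hN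
  set C := toComplexMatrix (toRealBlock (γ : BlockMatrix n ℤ)).toBlocks₂₁ with hC
  have hB'B : B' * B = 1 := mul_eq_one_comm.1 hBB'
  have h1 : toComplexMatrix B' * toComplexMatrix B = 1 := by
    rw [← toComplexMatrix_mul, hB'B, toComplexMatrix_one]
  have h2 : toComplexMatrix Bᵀ * toComplexMatrix B'ᵀ = 1 := by
    rw [← toComplexMatrix_mul, ← transpose_mul, hB'B, transpose_one, toComplexMatrix_one]
  have h3 : toComplexMatrix B' * (toComplexMatrix B * N⁻¹ * C * toComplexMatrix Bᵀ) *
      toComplexMatrix B'ᵀ = N⁻¹ * C := by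
    calc _ = (toComplexMatrix B' * toComplexMatrix B) * (N⁻¹ * C) *
          (toComplexMatrix Bᵀ * toComplexMatrix B'ᵀ) := by simp only [Matrix.mul_assoc]
      _ = _ := by rw [h1, h2, Matrix.one_mul, Matrix.mul_one]
  have h4 : siegelDenom (toRealBlock (γ : BlockMatrix n ℤ)) Z =
      N * (1 + N⁻¹ * C * (Z - Z')) := by
    rw [Matrix.mul_add, Matrix.mul_one, ← Matrix.mul_assoc, ← Matrix.mul_assoc, hinv,
      Matrix.one_mul, hN, siegelDenom, siegelDenom, ← hC, Matrix.mul_sub]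
    abel
  have h5 := hc _ hb
  rw [h3] at h5
  rw [h4, det_mul, norm_mul, mul_comm]
  exact mul_le_mul_of_nonneg_right (h5.trans (le_max_left _ _)) (norm_nonneg _)

end Bound

end Summand

/-! ### Eisenstein series as sums over the parabolic quotient -/

section Eisenstein

variable {n p : ℕ} [Fact p.Prime] {ψ : DirichletCharacter ℂ p} {k : ℤ} {s : ℂ}
  {Z : Matrix (Fin n) (Fin n) ℂ}

/-- The permutation of the parabolic quotient induced by right multiplication. -/
def parabolicRightMul (g : symplecticGroup (Fin n) ℤ) :
    ParabolicQuotient n ≃ ParabolicQuotient n where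
  toFun := Quotient.map' (· * g) fun a b h => by
    obtain ⟨η, hη⟩ := h
    have h' : (η : symplecticGroup (Fin n) ℤ) * b = a := hη
    exact ⟨η, show (η : symplecticGroup (Fin n) ℤ) * (b * g) = a * g by rw [← h', mul_assoc]⟩
  invFun := Quotient.map' (· * g⁻¹) fun a b h => by
    obtain ⟨η, hη⟩ := h
    have h' : (η : symplecticGroup (Fin n) ℤ) * b = a := hη
    exact ⟨η, show (η : symplecticGroup (Fin n) ℤ) * (b * g⁻¹) = a * g⁻¹ by rw [← h', mul_assoc]⟩
  left_inv x := by
    induction x using Quotient.inductionOn'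
    simp [Quotient.map'_mk'']
  right_inv x := by
    induction x using Quotient.inductionOn'
    simp [Quotient.map'_mk'']

/-- Invariance under left multiplication by the parabolic. -/
def IsParabolicInvariant {α : Type*} (f : symplecticGroup (Fin n) ℤ → α) : Prop :=
  ∀ η ∈ siegelParabolic n, ∀ γ, f (η * γ) = f γ

theorem IsParabolicInvariant.apply_out {α : Type*} {f : symplecticGroup (Fin n) ℤ → α}
    (hf : IsParabolicInvariant f) (γ : symplecticGroup (Fin n) ℤ) :
    f (Quotient.mk'' γ : ParabolicQuotient n).out = f γ := by
  obtain ⟨η, hη, h⟩ := exists_out_eq γ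
  rw [h, hf η hη]

theorem IsParabolicInvariant.apply_rightMul_out {α : Type*} {f : symplecticGroup (Fin n) ℤ → α}
    (hf : IsParabolicInvariant f) (g : symplecticGroup (Fin n) ℤ) (x : ParabolicQuotient n) :
    f (parabolicRightMul g x).out = f (x.out * g) := by
  have : parabolicRightMul g x = Quotient.mk'' (x.out * g) := by
    conv_lhs => rw [← Quotient.out_eq' x]
    rfl
  rw [this, hf.apply_out]

/-- The parity condition on ψ enters here: det D_η = -1 changes ψ* by ψ(-1) and the automorphy term
by (-1)^k, and these cancel. -/
theorem charDetD_mul_eisensteinTerm (hk : ψ (-1) = (-1) ^ k) {η : symplecticGroup (Fin n) ℤ}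
    (hη : η ∈ siegelParabolic n) :
    charDetD ψ η * eisensteinTerm k s ((η : BlockMatrix n ℤ).toBlocks₂₂.det : ℂ) = 1 := by
  rcases det_parabolic hη with h | h
  · rw [charDetD, h]
    simp [eisensteinTerm_one]
  · rw [charDetD, h]
    simp only [Int.cast_neg, Int.cast_one, eisensteinTerm_neg_one, hk]
    rw [← mul_zpow]
    simp

/-- The summand of the Eisenstein series, translated by `M`. -/
noncomputable def eisensteinSummand (ψ : DirichletCharacter ℂ p) (k : ℤ) (s : ℂ)
    (Z : Matrix (Fin n) (Fin n) ℂ) (r : ℕ) (M : BlockMatrix n ℤ) (γ : symplecticGroup (Fin n) ℤ) :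
    ℂ :=
  psiStar ψ r γ * autTerm k s Z ((γ : BlockMatrix n ℤ) * M)

theorem isParabolicInvariant_eisensteinSummand (hψ : ∀ x : ZMod p, x ≠ 0 → ψ x ^ 2 = 1)
    (hk : ψ (-1) = (-1) ^ k) (r : ℕ) (M : BlockMatrix n ℤ) :
    IsParabolicInvariant (eisensteinSummand ψ k s Z r M) := by
  intro η hη γ
  rw [eisensteinSummand, eisensteinSummand, psiStar_mul_left hψ r hη, Submonoid.coe_mul,
    Matrix.mul_assoc, autTerm_triangular_mul k s Z (mem_siegelParabolic.1 hη)]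
  linear_combination psiStar ψ r γ * autTerm k s Z ((γ : BlockMatrix n ℤ) * M) *
    charDetD_mul_eisensteinTerm hk hη

theorem autFactor_symplectic (γ : symplecticGroup (Fin n) ℤ) :
    autFactor (toRealBlock (γ : BlockMatrix n ℤ)) Z =
      (siegelDenom (toRealBlock (γ : BlockMatrix n ℤ)) Z).det := by
  rw [autFactor_eq (toRealBlock_symplectic γ), Real.one_rpow]
  simp

theorem cuspCosets_mk_eq {r : ℕ} {M N : cuspDoubleCoset n p r} :
    (Quotient.mk'' M : CuspCosets n p r) = Quotient.mk'' N ↔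
      ∃ η ∈ siegelParabolic n, M.1 = η * N.1 := by
  rw [Quotient.eq'']
  change MulAction.orbitRel _ _ _ _ ↔ _
  rw [MulAction.orbitRel_apply, MulAction.mem_orbit_iff]
  exact ⟨fun ⟨η, h⟩ => ⟨η, η.2, h.symm⟩, fun ⟨η, hη, h⟩ => ⟨⟨η, hη⟩, h.symm⟩⟩

theorem siegelEisenstein_eq (hψ : ∀ x : ZMod p, x ≠ 0 → ψ x ^ 2 = 1) (hk : ψ (-1) = (-1) ^ k)
    (r : ℕ) : siegelEisenstein n ψ k r Z s =
      (((Z.map Complex.im).det : ℝ) : ℂ) ^ (s - (k : ℂ) / 2) *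
        ∑' x : ParabolicQuotient n, eisensteinSummand ψ k s Z r 1 x.out := by
  have hinv := isParabolicInvariant_eisensteinSummand (s := s) (Z := Z) hψ hk r 1
  let ι : CuspCosets n p r → ParabolicQuotient n := fun c => Quotient.mk'' c.out.val
  have hι : Function.Injective ι := by
    intro c c' h
    rw [← Quotient.out_eq' c, ← Quotient.out_eq' c']
    exact cuspCosets_mk_eq.2 (parabolicQuotient_mk_eq.1 h)
  have hsupp : Function.support (fun x : ParabolicQuotient n =>
      eisensteinSummand ψ k s Z r 1 x.out) ⊆ Set.range ι := by
    intro x hx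
    have hx' : psiStar ψ r x.out ≠ 0 := left_ne_zero_of_mul hx
    have hmem : x.out ∈ cuspDoubleCoset n p r := by
      by_contra hcon
      refine hx' (psiStar_eq_zero ?_)
      rintro ⟨η, hη, κ, hκ, h⟩
      exact hcon (DoubleCoset.mem_doubleCoset.2 ⟨η, hη, κ, hκ, h⟩)
    refine ⟨Quotient.mk'' ⟨x.out, hmem⟩, ?_⟩
    conv_rhs => rw [← Quotient.out_eq' x]
    exact parabolicQuotient_mk_eq.2 (cuspCosets_mk_eq.1 (Quotient.out_eq'
      (Quotient.mk'' (⟨x.out, hmem⟩ : cuspDoubleCoset n p r) : CuspCosets n p r)))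
  rw [siegelEisenstein, ← hι.tsum_eq hsupp]
  congr 1
  refine tsum_congr fun c => ?_
  rw [hinv.apply_out, eisensteinSummand, Matrix.mul_one, autTerm, eisensteinTerm,
    autFactor_symplectic, mul_assoc]

theorem autTerm_mul {M : BlockMatrix n ℤ} (hM : (siegelDenom (toRealBlock M) Z).det ≠ 0)
    (N : BlockMatrix n ℤ) :
    autTerm k s Z (N * M) = autTerm k s (siegelAction (toRealBlock M) Z) N * autTerm k s Z M := by
  rw [autTerm, toRealBlock_mul, siegelDenom_mul hM, det_mul, eisensteinTerm_mul]
  rfl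

/-- The determinant of the imaginary part changes by |j|⁻², which turns the factor j^(-k) of the
slash operator into the full term j^(-k)|j|^(-2s + k). The cocycle relation then moves it inside the
series. -/
theorem siegelSlash_siegelEisenstein (hψ : ∀ x : ZMod p, x ≠ 0 → ψ x ^ 2 = 1)
    (hk : ψ (-1) = (-1) ^ k) (r : ℕ) {M : BlockMatrix n ℤ}
    (hM : Mᵀ * J (Fin n) ℤ * M = (p : ℤ) • J (Fin n) ℤ) (hZ : Z ∈ siegelUpperHalfSpace n) :
    siegelSlash k (fun W => siegelEisenstein n ψ k r W s) (toRealBlock M) Z =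
      (((Z.map Complex.im).det : ℝ) : ℂ) ^ (s - (k : ℂ) / 2) *
        (eisensteinTerm k s (((p : ℝ) ^ (-(n : ℝ) / 2) : ℝ) : ℂ) *
          ∑' x : ParabolicQuotient n, eisensteinSummand ψ k s Z r M x.out) := by
  have hp : (0 : ℝ) < p := mod_cast (Fact.out : p.Prime).pos
  have hM' := toRealBlock_similitude hM
  rw [Int.cast_natCast] at hM'
  have hden := siegelDenom_det_ne_zero hM' hp.ne' hZ
  have hY := hZ.2.det_pos
  have hj := autFactor_eq hM' Z
  set j := autFactor (toRealBlock M) Z with hjdef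
  set W := siegelAction (toRealBlock M) Z with hW
  have hq : (0 : ℝ) < (p : ℝ) ^ (-(n : ℝ) / 2) := Real.rpow_pos_of_pos hp _
  have hqq : ((p : ℝ) ^ (-(n : ℝ) / 2)) ^ 2 = ((p : ℝ) ^ n)⁻¹ := by
    rw [← Real.rpow_natCast, ← Real.rpow_mul hp.le]
    have : -(n : ℝ) / 2 * ((2 : ℕ) : ℝ) = -(n : ℝ) := by push_cast; ring
    rw [this, Real.rpow_neg hp.le, Real.rpow_natCast]
  have hj0 : 0 < ‖j‖ := by
    rw [hj, norm_pos_iff]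
    exact mul_ne_zero (by exact_mod_cast hq.ne') hden
  have hdet : (W.map Complex.im).det = (Z.map Complex.im).det * (‖j‖ ^ 2)⁻¹ := by
    rw [hW, det_im_siegelAction hM' hp hZ, hj, norm_mul, Complex.norm_of_nonneg hq.le, mul_pow, hqq]
    field_simp
  rw [siegelSlash, siegelEisenstein_eq hψ hk, ← hjdef, ← hW, hdet, Complex.ofReal_mul,
    Complex.mul_cpow_ofReal_nonneg hY.le (by positivity)]
  have h₁ : (((‖j‖ ^ 2)⁻¹ : ℝ) : ℂ) ^ (s - (k : ℂ) / 2) = ((‖j‖ : ℝ) : ℂ) ^ (-2 * s + (k : ℂ)) := by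
    have : (‖j‖ ^ 2)⁻¹ = ‖j‖ ^ (-2 : ℝ) := by
      rw [Real.rpow_neg hj0.le, ← Real.rpow_natCast]
      norm_num
    -- The branch conditions hold because -2 log ‖j‖ is real.
    rw [this, Complex.ofReal_cpow hj0.le, ← Complex.cpow_mul]
    · congr 1; push_cast; ring
    · rw [← Complex.ofReal_log hj0.le, ← Complex.ofReal_mul, Complex.ofReal_im]
      linarith [Real.pi_pos]
    · rw [← Complex.ofReal_log hj0.le, ← Complex.ofReal_mul, Complex.ofReal_im]
      linarith [Real.pi_pos]
  rw [h₁]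
  have h₂ : ∑' x : ParabolicQuotient n, eisensteinSummand ψ k s Z r M x.out =
      autTerm k s Z M * ∑' x : ParabolicQuotient n, eisensteinSummand ψ k s W r 1 x.out := by
    rw [← tsum_mul_left]
    refine tsum_congr fun x => ?_
    rw [eisensteinSummand, eisensteinSummand, autTerm_mul hden, Matrix.mul_one]
    ring
  have h₃ : j ^ (-k) * ((‖j‖ : ℝ) : ℂ) ^ (-2 * s + (k : ℂ)) =
      eisensteinTerm k s (((p : ℝ) ^ (-(n : ℝ) / 2) : ℝ) : ℂ) * autTerm k s Z M := by
    rw [autTerm, ← eisensteinTerm_mul, ← hj, eisensteinTerm]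
  rw [h₂, ← mul_assoc (eisensteinTerm k s _), ← h₃]
  ring

end Eisenstein

/-! ### Convergence at one point implies convergence everywhere -/

section Summability

variable {n p : ℕ} [Fact p.Prime] {ψ : DirichletCharacter ℂ p} {k : ℤ} {s : ℂ}
  {Z : Matrix (Fin n) (Fin n) ℂ}

/-- Only the residue of γ modulo p matters, and there are finitely many. Finitely many right
translations therefore suffice to bring every element into P w_r Γ. -/
theorem exists_finset_mul_mem (n p : ℕ) [Fact p.Prime] (r : ℕ) :
    ∃ F : Finset (symplecticGroup (Fin n) ℤ), ∀ γ, ∃ g ∈ F, ∃ κ ∈ siegelGamma0 n p,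
      γ * g = cuspElement n r * κ := by
  classical
  let f : symplecticGroup (Fin n) ℤ → BlockMatrix n (ZMod p) := fun g => matrixMod p g
  have hfin : (Set.range f).Finite := Set.toFinite _
  choose! v hv using fun m (hm : m ∈ Set.range f) => hm
  refine ⟨hfin.toFinset.image v, fun γ => ?_⟩
  set g := γ⁻¹ * cuspElement n r with hg
  have hmem : f g ∈ Set.range f := ⟨g, rfl⟩
  refine ⟨v (f g), Finset.mem_image_of_mem _ (hfin.mem_toFinset.2 hmem),
    (cuspElement n r)⁻¹ * γ * v (f g), ?_, by group⟩
  have h₁ : matrixMod p ((g⁻¹ * v (f g) : symplecticGroup (Fin n) ℤ) : BlockMatrix n ℤ) = 1 := by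
    have : matrixMod p (v (f g) : BlockMatrix n ℤ) = matrixMod p (g : BlockMatrix n ℤ) :=
      hv (f g) hmem
    rw [Submonoid.coe_mul, map_mul, this, ← map_mul, coe_inv_mul, map_one]
  have h₂ := mem_gamma0_of_matrixMod_eq_one h₁ 1
  simpa [hg, mul_assoc] using h₂

theorem norm_psiStar_le (hψ : ∀ x : ZMod p, x ≠ 0 → ψ x ^ 2 = 1) (r : ℕ)
    (γ : symplecticGroup (Fin n) ℤ) : ‖psiStar ψ r γ‖ ≤ 1 := by
  by_cases h : ∃ η ∈ siegelParabolic n, ∃ κ ∈ siegelGamma0 n p, γ = η * cuspElement n r * κ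
  · obtain ⟨η, hη, κ, hκ, rfl⟩ := h
    rw [psiStar_apply hψ r hη hκ, norm_mul]
    exact mul_le_one₀ (DirichletCharacter.norm_le_one _ _) (norm_nonneg _)
      (DirichletCharacter.norm_le_one _ _)
  · rw [psiStar_eq_zero h]
    simp

theorem norm_psiStar_cuspElement (hψ : ∀ x : ZMod p, x ≠ 0 → ψ x ^ 2 = 1) (r : ℕ)
    {κ : symplecticGroup (Fin n) ℤ} (hκ : κ ∈ siegelGamma0 n p) :
    ‖psiStar ψ r (cuspElement n r * κ)‖ = 1 := by
  have h := psiStar_apply (ψ := ψ) hψ r (one_mem (siegelParabolic n)) hκ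
  rw [one_mul, charDetD_one, one_mul] at h
  rw [h, ← sq_eq_sq₀ (norm_nonneg _) zero_le_one, ← norm_pow, sq, charDetD_sq hψ hκ]
  simp

theorem exists_norm_autTerm_le (k : ℤ) (hs : 0 ≤ s.re) {Z Z' : Matrix (Fin n) (Fin n) ℂ}
    (hZ : Z ∈ siegelUpperHalfSpace n) (hZ' : Z' ∈ siegelUpperHalfSpace n) :
    ∃ c : ℝ, 0 < c ∧ ∀ γ : symplecticGroup (Fin n) ℤ,
      ‖autTerm k s Z (γ : BlockMatrix n ℤ)‖ ≤ c * ‖autTerm k s Z' (γ : BlockMatrix n ℤ)‖ := by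
  obtain ⟨c, hc, h⟩ := exists_det_bound (Z := Z') hZ
  refine ⟨c ^ (2 * s.re), Real.rpow_pos_of_pos hc _, fun γ => ?_⟩
  have h₁ := siegelDenom_sympl_det_ne_zero hZ γ
  have h₂ := siegelDenom_sympl_det_ne_zero hZ' γ
  rw [autTerm, autTerm, norm_eisensteinTerm k s h₁, norm_eisensteinTerm k s h₂]
  have hp₁ := norm_pos_iff.2 h₁
  have hp₂ := norm_pos_iff.2 h₂
  rw [neg_mul, Real.rpow_neg hp₁.le, Real.rpow_neg hp₂.le, ← div_eq_mul_inv,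
    inv_le_iff_one_le_mul₀ (by positivity), div_mul_eq_mul_div, le_div_iff₀ (by positivity),
    one_mul, ← Real.mul_rpow hc.le hp₁.le]
  exact Real.rpow_le_rpow hp₂.le (h γ) (by linarith)

/-- Every coset is moved by some g in a finite set into the double coset on which |ψ*| = 1. The
untwisted series at Z' is thus dominated by finitely many translates of the given one, after
comparing Z' with g⟨Z⟩ by `exists_norm_autTerm_le`. -/
theorem summable_autTerm (hψ : ∀ x : ZMod p, x ≠ 0 → ψ x ^ 2 = 1) (hk : ψ (-1) = (-1) ^ k)
    (hs : 0 ≤ s.re) {Z Z' : Matrix (Fin n) (Fin n) ℂ} (hZ : Z ∈ siegelUpperHalfSpace n)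
    (hZ' : Z' ∈ siegelUpperHalfSpace n) {r : ℕ}
    (h : Summable fun x : ParabolicQuotient n => eisensteinSummand ψ k s Z r 1 x.out) :
    Summable fun x : ParabolicQuotient n => autTerm k s Z' (x.out : BlockMatrix n ℤ) := by
  obtain ⟨F, hF⟩ := exists_finset_mul_mem n p r
  have hinv := isParabolicInvariant_eisensteinSummand (s := s) (Z := Z) hψ hk r 1
  have hact : ∀ g : symplecticGroup (Fin n) ℤ,
      siegelAction (toRealBlock (g : BlockMatrix n ℤ)) Z ∈ siegelUpperHalfSpace n := fun g =>
    siegelAction_mem (toRealBlock_symplectic g) one_pos hZ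
  choose c hc hcb using fun g : symplecticGroup (Fin n) ℤ =>
    exists_norm_autTerm_le k hs hZ' (hact g)
  have hne : ∀ g : symplecticGroup (Fin n) ℤ, 0 < ‖autTerm k s Z (g : BlockMatrix n ℤ)‖ := by
    intro g
    have := siegelDenom_sympl_det_ne_zero hZ g
    rw [autTerm, norm_eisensteinTerm k s this]
    exact Real.rpow_pos_of_pos (norm_pos_iff.2 this) _
  have hsum : Summable fun x : ParabolicQuotient n => ∑ g ∈ F,
      c g * ‖autTerm k s Z (g : BlockMatrix n ℤ)‖⁻¹ *
        ‖eisensteinSummand ψ k s Z r 1 (parabolicRightMul g x).out‖ :=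
    summable_sum fun g _ => ((parabolicRightMul g).summable_iff.2 h.norm).mul_left _
  refine Summable.of_norm_bounded hsum fun x => ?_
  obtain ⟨g, hg, κ, hκ, hgκ⟩ := hF x.out
  refine le_trans ?_ (Finset.single_le_sum (fun g _ => mul_nonneg (mul_nonneg (hc g).le
    (inv_nonneg.2 (norm_nonneg _))) (norm_nonneg _)) hg)
  rw [hinv.apply_rightMul_out, eisensteinSummand, Matrix.mul_one, norm_mul, hgκ,
    norm_psiStar_cuspElement hψ r hκ, one_mul, ← hgκ, Submonoid.coe_mul,
    autTerm_mul (siegelDenom_sympl_det_ne_zero hZ g), norm_mul]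
  have := hcb g x.out
  calc _ ≤ _ := this
    _ = _ := by
      have := (hne g).ne'
      field_simp

end Summability

/-! ### The transfer coefficients -/

section Main

open Polynomial

variable {n p : ℕ} [Fact p.Prime] {ψ : DirichletCharacter ℂ p} {k : ℤ} {s : ℂ}
  {Z : Matrix (Fin n) (Fin n) ℂ}

/-- The sum of the weights of the leading `j × j` blocks in degree `j - i`. -/
noncomputable def transferCoeff (ψ : DirichletCharacter ℂ p) (n i j : ℕ) : ℂ :=
  if h : i ≤ j ∧ j ≤ n then ∑ S : SymmetricMatrix (Fin n) (ZMod p),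
    (symmetricWeight ψ (S.1.submatrix (Fin.castLE h.2) (Fin.castLE h.2))).coeff (j - i) else 0

/-- The heart of the proof, an identity for each coset x before any infinite summation. If x lies in
P w_j Γ, only the term of index j survives on the right, and the bijection σ removes the dependence
on κ. -/
theorem sum_eisensteinSummand_transfer (hp : p ≠ 2) (hψ : ∀ x : ZMod p, x ≠ 0 → ψ x ^ 2 = 1)
    (hk : ψ (-1) = (-1) ^ k) {i : ℕ} (hi : i ≤ n)
    (e : SymmetricMatrix (Fin n) (ZMod p) → ParabolicQuotient n ≃ ParabolicQuotient n)
    (he : ∀ S x γ, HeckeRelated p (matrixLift S.1) x.out γ → e S x = Quotient.mk'' γ)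
    (x : ParabolicQuotient n) :
    eisensteinTerm k s ((p : ℂ) ^ i) * ∑ S : SymmetricMatrix (Fin n) (ZMod p),
        eisensteinSummand ψ k s Z i (heckeUpper p (matrixLift S.1)) (e S x).out =
      eisensteinTerm k s ((p : ℂ) ^ n) * ∑ j ∈ Finset.range (n + 1),
        transferCoeff ψ n i j * eisensteinSummand ψ k s Z j 1 x.out := by
  obtain ⟨j, hj, η, hη, κ, hκ, hx⟩ := exists_cusp_decomposition (p := p) x.out
  obtain ⟨σ, hσ⟩ := symmetricAction_bijective hκ
  have hp0 : (p : ℤ) ≠ 0 := Int.natCast_ne_zero.2 (Fact.out : p.Prime).ne_zero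
  set w : SymmetricMatrix (Fin n) (ZMod p) → ℂ := fun S => if i ≤ j then
    (symmetricWeight ψ (S.1.submatrix (Fin.castLE hj) (Fin.castLE hj))).coeff (j - i) else 0 with hw
  have key : ∀ S : SymmetricMatrix (Fin n) (ZMod p), eisensteinTerm k s ((p : ℂ) ^ i) *
      eisensteinSummand ψ k s Z i (heckeUpper p (matrixLift S.1)) (e S x).out =
      eisensteinTerm k s ((p : ℂ) ^ n) * (w (σ S) * (charDetD ψ κ * charDetD ψ η *
        autTerm k s Z (x.out : BlockMatrix n ℤ))) := by
    intro S
    obtain ⟨H, γ, a, hC, hD, hH, hγ⟩ := exists_heckeRelated_of_decomposition (ψ := ψ) hp hψ hj hη hκ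
      (matrixLift_transpose S.2)
    obtain ⟨hγ₁, hγ₂⟩ := hγ i hi
    have hinv := isParabolicInvariant_eisensteinSummand (s := s) (Z := Z) hψ hk i
      (heckeUpper p (matrixLift S.1))
    rw [← hx] at hH
    rw [he S x γ ⟨H, hC, by
      rw [hD]; exact mul_ne_zero (det_parabolic_ne_zero hη) (pow_ne_zero _ hp0), hH⟩,
      hinv.apply_out, eisensteinSummand]
    have hw' : psiStar ψ i γ = w (σ S) * charDetD ψ κ := by
      rw [hγ₁, hw]
      simp only [hσ S]
    -- This computes the automorphy term of γ(1, S; 0, p) from that of x: the determinants of the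
    -- lower right blocks are det D_η p^a on the left and p^n on the right.
    have h₁ : H * (γ * heckeUpper p (matrixLift S.1)) = ((p : ℤ) • (1 : BlockMatrix n ℤ)) * x.out := by
      rw [← Matrix.mul_assoc, ← hH, Matrix.mul_assoc, heckeAdjoint_mul_heckeUpper, Matrix.mul_smul,
        Matrix.mul_one, Matrix.smul_mul, Matrix.one_mul]
    have e₁ : ((p : ℤ) • (1 : BlockMatrix n ℤ)).toBlocks₂₁ = 0 := by
      ext i j; simp [toBlocks₂₁]
    have e₂ : ((p : ℤ) • (1 : BlockMatrix n ℤ)).toBlocks₂₂ = (p : ℤ) • 1 := by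
      ext i j; simp [toBlocks₂₂, Matrix.one_apply]
    have h₂ := congrArg (autTerm k s Z) h₁
    rw [autTerm_triangular_mul k s Z hC, autTerm_triangular_mul k s Z e₁, e₂, hD, det_smul, det_one,
      Fintype.card_fin, mul_one] at h₂
    simp only [Int.cast_mul, Int.cast_pow, Int.cast_natCast] at h₂
    rw [eisensteinTerm_mul] at h₂
    have h₃ := charDetD_mul_eisensteinTerm (s := s) hk hη
    -- The exponent a equals i only when ψ*(γ) ≠ 0; otherwise both sides vanish.
    by_cases h0 : psiStar ψ i γ = 0
    · rw [h0, zero_mul, mul_zero]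
      rw [h0] at hw'
      linear_combination eisensteinTerm k s ((p : ℂ) ^ n) * charDetD ψ η *
        autTerm k s Z (x.out : BlockMatrix n ℤ) * hw'
    · rw [← hγ₂ h0] at h₂
      linear_combination psiStar ψ i γ * charDetD ψ η * h₂ +
        eisensteinTerm k s ((p : ℂ) ^ n) * charDetD ψ η *
          autTerm k s Z (x.out : BlockMatrix n ℤ) * hw' -
        psiStar ψ i γ * eisensteinTerm k s ((p : ℂ) ^ i) *
          autTerm k s Z (γ * heckeUpper p (matrixLift S.1)) * h₃
  rw [Finset.mul_sum, Finset.sum_congr rfl fun S _ => key S, ← Finset.mul_sum, ← Finset.sum_mul,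
    Equiv.sum_comp σ w, Finset.sum_eq_single j]
  · congr 1
    have h₁ : ∑ S, w S = transferCoeff ψ n i j := by
      rw [transferCoeff]
      by_cases hij : i ≤ j
      · rw [dif_pos ⟨hij, hj⟩]
        simp [hw, hij]
      · rw [dif_neg (fun h => hij h.1)]
        simp [hw, hij]
    have h₂ : psiStar ψ j x.out = charDetD ψ η * charDetD ψ κ := by
      rw [hx, psiStar_apply hψ j hη hκ]
    rw [h₁, eisensteinSummand, h₂, Matrix.mul_one]
    ring
  · intro j' hj' hne
    have : psiStar ψ j' x.out = 0 := by
      rw [hx]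
      exact psiStar_of_ne (by simpa [Nat.lt_succ_iff] using hj') hj hne hη hκ
    rw [eisensteinSummand, this, zero_mul, mul_zero]
  · intro h
    exact absurd (Finset.mem_range.2 (Nat.lt_succ_of_le hj)) h

end Main

/-! ### U(p) applied to the Eisenstein series -/

section HeckeOperator

variable {n p : ℕ} [Fact p.Prime] {ψ : DirichletCharacter ℂ p} {k : ℤ} {s : ℂ}
  {Z : Matrix (Fin n) (Fin n) ℂ}

theorem charDetA_mul_charDetD {δ : symplecticGroup (Fin n) ℤ} (hδ : δ ∈ siegelGamma0 n p) :
    ψ (((δ : BlockMatrix n ℤ).toBlocks₁₁.det : ℤ) : ZMod p) * charDetD ψ δ = 1 := by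
  have h := congrArg det (gamma0_transpose_mul hδ)
  rw [det_mul, det_transpose, det_one, matrixMod_det, matrixMod_det] at h
  rw [charDetD, ← map_mul, h, map_one]

theorem tsum_eisensteinSummand_gamma0_mul (hψ : ∀ x : ZMod p, x ≠ 0 → ψ x ^ 2 = 1)
    (hk : ψ (-1) = (-1) ^ k) (r : ℕ) {δ : symplecticGroup (Fin n) ℤ} (hδ : δ ∈ siegelGamma0 n p)
    (M : BlockMatrix n ℤ) :
    ∑' x : ParabolicQuotient n, eisensteinSummand ψ k s Z r ((δ : BlockMatrix n ℤ) * M) x.out =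
      charDetD ψ δ * ∑' x : ParabolicQuotient n, eisensteinSummand ψ k s Z r M x.out := by
  have hinv := isParabolicInvariant_eisensteinSummand (s := s) (Z := Z) hψ hk r M
  rw [← (parabolicRightMul δ).tsum_eq fun x => eisensteinSummand ψ k s Z r M x.out,
    ← tsum_mul_left]
  refine tsum_congr fun x => ?_
  rw [hinv.apply_rightMul_out, eisensteinSummand, eisensteinSummand, psiStar_mul_right hψ r _ hδ,
    Submonoid.coe_mul, Matrix.mul_assoc]
  linear_combination (-psiStar ψ r x.out * autTerm k s Z
    ((x.out : BlockMatrix n ℤ) * ((δ : BlockMatrix n ℤ) * M))) * charDetD_sq hψ hδ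

instance finite_heckeCosets (n p : ℕ) [Fact p.Prime] : Finite (HeckeCosets n p) :=
  Finite.of_equiv _ (exists_heckeCosets_equiv n p).choose.symm

theorem heckeCosets_out_similitude (c : HeckeCosets n p) :
    (c.out.val)ᵀ * J (Fin n) ℤ * c.out.val = (p : ℤ) • J (Fin n) ℤ := by
  obtain ⟨e, he⟩ := exists_heckeCosets_equiv n p
  obtain ⟨δ, -, h⟩ := he c
  have hδ := SymplecticGroup.mem_iff'.1 δ.2
  rw [h, transpose_mul]
  calc _ = (heckeUpper p (matrixLift (e c).1))ᵀ * ((δ : BlockMatrix n ℤ)ᵀ * J (Fin n) ℤ * δ) *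
        heckeUpper p (matrixLift (e c).1) := by simp only [Matrix.mul_assoc]
    _ = _ := by rw [hδ, heckeUpper_similitude (matrixLift_transpose (e c).2)]

theorem siegelAction_heckeCosets_mem (c : HeckeCosets n p) (hZ : Z ∈ siegelUpperHalfSpace n) :
    siegelAction (toRealBlock c.out.val) Z ∈ siegelUpperHalfSpace n := by
  have h := toRealBlock_similitude (heckeCosets_out_similitude c)
  rw [Int.cast_natCast] at h
  exact siegelAction_mem h (mod_cast (Fact.out : p.Prime).pos) hZ

/-- The chosen representative of a coset is δ(1, S; 0, p) with δ in Γ₀(p). The series contributes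
ψ(det D_δ), and the factor ψ(det A) in U(p) cancels it. -/
theorem heckeU_siegelEisenstein_eq_sum (hψ : ∀ x : ZMod p, x ≠ 0 → ψ x ^ 2 = 1)
    (hk : ψ (-1) = (-1) ^ k) (i : ℕ) (hZ : Z ∈ siegelUpperHalfSpace n) :
    heckeU n ψ k (fun W => siegelEisenstein n ψ k i W s) Z =
      (((p : ℝ) ^ ((n : ℝ) * (k : ℝ) / 2 - (n : ℝ) * ((n : ℝ) + 1) / 2) : ℝ) : ℂ) *
        ((((Z.map Complex.im).det : ℝ) : ℂ) ^ (s - (k : ℂ) / 2) *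
          (eisensteinTerm k s (((p : ℝ) ^ (-(n : ℝ) / 2) : ℝ) : ℂ) *
            ∑ S : SymmetricMatrix (Fin n) (ZMod p), ∑' x : ParabolicQuotient n,
              eisensteinSummand ψ k s Z i (heckeUpper p (matrixLift S.1)) x.out)) := by
  obtain ⟨e, he⟩ := exists_heckeCosets_equiv n p
  have hfin : ∀ f : HeckeCosets n p → ℂ, ∑ᶠ c, f c = ∑ S, f (e.symm S) := fun f => by
    rw [← finsum_eq_sum_of_fintype]
    exact (finsum_comp_equiv e.symm).symm
  rw [heckeU, hfin]
  congr 1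
  rw [Finset.mul_sum, Finset.mul_sum]
  refine Finset.sum_congr rfl fun S _ => ?_
  rw [siegelSlash_siegelEisenstein hψ hk i (heckeCosets_out_similitude _) hZ]
  obtain ⟨δ, hδ, h⟩ := he (e.symm S)
  rw [e.apply_symm_apply] at h
  have hA : ((e.symm S).out.val).toBlocks₁₁ = (δ : BlockMatrix n ℤ).toBlocks₁₁ := by
    rw [h, toBlocks₁₁_mul, heckeUpper, toBlocks_fromBlocks₁₁, toBlocks_fromBlocks₂₁]
    simp
  rw [hA, h, tsum_eisensteinSummand_gamma0_mul hψ hk i hδ]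
  linear_combination (((Z.map Complex.im).det : ℝ) : ℂ) ^ (s - (k : ℂ) / 2) *
    (eisensteinTerm k s (((p : ℝ) ^ (-(n : ℝ) / 2) : ℝ) : ℂ) *
      ∑' x : ParabolicQuotient n,
        eisensteinSummand ψ k s Z i (heckeUpper p (matrixLift S.1)) x.out) *
    charDetA_mul_charDetD (ψ := ψ) hδ

theorem summable_eisensteinSummand_of_autTerm (hψ : ∀ x : ZMod p, x ≠ 0 → ψ x ^ 2 = 1) (r : ℕ)
    {M : BlockMatrix n ℤ} (hM : (siegelDenom (toRealBlock M) Z).det ≠ 0)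
    (h : Summable fun x : ParabolicQuotient n =>
      autTerm k s (siegelAction (toRealBlock M) Z) (x.out : BlockMatrix n ℤ)) :
    Summable fun x : ParabolicQuotient n => eisensteinSummand ψ k s Z r M x.out := by
  refine Summable.of_norm_bounded (h.norm.mul_right ‖autTerm k s Z M‖) fun x => ?_
  rw [eisensteinSummand, autTerm_mul hM, norm_mul, norm_mul]
  exact mul_le_of_le_one_left (by positivity) (norm_psiStar_le hψ r _)

theorem siegelEisenstein_eq_zero_of_not_summable (hψ : ∀ x : ZMod p, x ≠ 0 → ψ x ^ 2 = 1)
    (hk : ψ (-1) = (-1) ^ k) (hs : 0 ≤ s.re) {Z' : Matrix (Fin n) (Fin n) ℂ}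
    (hZ' : Z' ∈ siegelUpperHalfSpace n)
    (h : ¬ Summable fun x : ParabolicQuotient n => autTerm k s Z' (x.out : BlockMatrix n ℤ)) (r : ℕ)
    {W : Matrix (Fin n) (Fin n) ℂ} (hW : W ∈ siegelUpperHalfSpace n) :
    siegelEisenstein n ψ k r W s = 0 := by
  rw [siegelEisenstein_eq hψ hk, tsum_eq_zero_of_not_summable, mul_zero]
  exact fun hsum => h (summable_autTerm hψ hk hs hW hZ' hsum)

/-- The transfer formula for `U(p)`, in terms of absolutely convergent series. Should
`∑ j(γ, Z) ^ (-k) |j(γ, Z)| ^ (k - 2 s)` fail to converge absolutely, all the series vanish by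
convention, so that no range of `s` has to be singled out here. -/
theorem heckeU_siegelEisenstein (hp : p ≠ 2) (hψ : ∀ x : ZMod p, x ≠ 0 → ψ x ^ 2 = 1)
    (hk : ψ (-1) = (-1) ^ k) (hs : 0 ≤ s.re) {i : ℕ} (hi : i ≤ n)
    (hZ : Z ∈ siegelUpperHalfSpace n) :
    eisensteinTerm k s ((p : ℂ) ^ i) *
        heckeU n ψ k (fun W => siegelEisenstein n ψ k i W s) Z =
      (((p : ℝ) ^ ((n : ℝ) * (k : ℝ) / 2 - (n : ℝ) * ((n : ℝ) + 1) / 2) : ℝ) : ℂ) *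
        (eisensteinTerm k s (((p : ℝ) ^ (-(n : ℝ) / 2) : ℝ) : ℂ) *
          eisensteinTerm k s ((p : ℂ) ^ n)) *
        ∑ j ∈ Finset.range (n + 1), transferCoeff ψ n i j * siegelEisenstein n ψ k j Z s := by
  by_cases hsum : Summable fun x : ParabolicQuotient n => autTerm k s Z (x.out : BlockMatrix n ℤ)
  · have hall : ∀ {W : Matrix (Fin n) (Fin n) ℂ}, W ∈ siegelUpperHalfSpace n →
        Summable fun x : ParabolicQuotient n => autTerm k s W (x.out : BlockMatrix n ℤ) := by
      intro W hW
      obtain ⟨c, -, hc⟩ := exists_norm_autTerm_le k hs hW hZ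
      exact Summable.of_norm_bounded (hsum.norm.mul_left c) fun x => hc x.out
    have hpos : (0 : ℝ) < p := mod_cast (Fact.out : p.Prime).pos
    have hS : ∀ {M : BlockMatrix n ℤ} {m : ℤ}, 0 < m → Mᵀ * J (Fin n) ℤ * M = m • J (Fin n) ℤ →
        ∀ r, Summable fun x : ParabolicQuotient n => eisensteinSummand ψ k s Z r M x.out := by
      intro M m hm hM r
      have hM' := toRealBlock_similitude hM
      have hm' : (0 : ℝ) < m := by exact_mod_cast hm
      exact summable_eisensteinSummand_of_autTerm hψ r (siegelDenom_det_ne_zero hM' hm'.ne' hZ)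
        (hall (siegelAction_mem hM' hm' hZ))
    choose e he using fun S : SymmetricMatrix (Fin n) (ZMod p) =>
      exists_heckePerm hp (matrixLift_transpose S.2)
    -- Each S has its own permutation of the cosets; after reindexing, the finite sum moves inside
    -- the series.
    have h₁ : ∑ S : SymmetricMatrix (Fin n) (ZMod p), ∑' x : ParabolicQuotient n,
        eisensteinSummand ψ k s Z i (heckeUpper p (matrixLift S.1)) x.out =
        ∑' x : ParabolicQuotient n, ∑ S : SymmetricMatrix (Fin n) (ZMod p),
          eisensteinSummand ψ k s Z i (heckeUpper p (matrixLift S.1)) (e S x).out := by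
      rw [Summable.tsum_finsetSum]
      · refine Finset.sum_congr rfl fun S _ => ?_
        exact ((e S).tsum_eq fun x =>
          eisensteinSummand ψ k s Z i (heckeUpper p (matrixLift S.1)) x.out).symm
      · intro S _
        exact (e S).summable_iff.2 (hS (mod_cast (Fact.out : p.Prime).pos)
          (heckeUpper_similitude (matrixLift_transpose S.2)) i)
    have h₂ : eisensteinTerm k s ((p : ℂ) ^ i) * ∑ S : SymmetricMatrix (Fin n) (ZMod p),
        ∑' x : ParabolicQuotient n,
          eisensteinSummand ψ k s Z i (heckeUpper p (matrixLift S.1)) x.out =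
        eisensteinTerm k s ((p : ℂ) ^ n) * ∑ j ∈ Finset.range (n + 1), transferCoeff ψ n i j *
          ∑' x : ParabolicQuotient n, eisensteinSummand ψ k s Z j 1 x.out := by
      rw [h₁, ← tsum_mul_left]
      simp_rw [sum_eisensteinSummand_transfer hp hψ hk hi e he, ← tsum_mul_left]
      rw [tsum_mul_left, Summable.tsum_finsetSum]
      exact fun j _ => (hS one_pos (by simp) j).mul_left _
    rw [heckeU_siegelEisenstein_eq_sum hψ hk i hZ]
    simp_rw [siegelEisenstein_eq hψ hk]
    have h₃ : ∑ j ∈ Finset.range (n + 1), transferCoeff ψ n i j *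
        ((((Z.map Complex.im).det : ℝ) : ℂ) ^ (s - (k : ℂ) / 2) *
          ∑' x : ParabolicQuotient n, eisensteinSummand ψ k s Z j 1 x.out) =
        (((Z.map Complex.im).det : ℝ) : ℂ) ^ (s - (k : ℂ) / 2) *
          ∑ j ∈ Finset.range (n + 1), transferCoeff ψ n i j *
            ∑' x : ParabolicQuotient n, eisensteinSummand ψ k s Z j 1 x.out := by
      rw [Finset.mul_sum]
      exact Finset.sum_congr rfl fun j _ => by ring
    rw [h₃]
    linear_combination (((p : ℝ) ^ ((n : ℝ) * (k : ℝ) / 2 - (n : ℝ) * ((n : ℝ) + 1) / 2) : ℝ) : ℂ) *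
      (((Z.map Complex.im).det : ℝ) : ℂ) ^ (s - (k : ℂ) / 2) *
        eisensteinTerm k s (((p : ℝ) ^ (-(n : ℝ) / 2) : ℝ) : ℂ) * h₂
  · have h0 := fun r {W : Matrix (Fin n) (Fin n) ℂ} (hW : W ∈ siegelUpperHalfSpace n) =>
      siegelEisenstein_eq_zero_of_not_summable (ψ := ψ) hψ hk hs hZ hsum r hW
    rw [Finset.sum_eq_zero fun j _ => by rw [h0 j hZ, mul_zero], mul_zero, heckeU,
      finsum_eq_zero_of_forall_eq_zero, mul_zero, mul_zero]
    intro c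
    rw [siegelSlash, h0 i (siegelAction_heckeCosets_mem c hZ), mul_zero, mul_zero]

end HeckeOperator

/-! ### Identities between meromorphic functions -/

section Meromorphic

open Filter Topology

/-- The order of f - g is finite at every point of the plane or at none, and it is infinite at a +
1. -/
theorem Meromorphic.eventually_eq_nhdsNE {f g : ℂ → ℂ} (hf : Meromorphic f) (hg : Meromorphic g)
    {a : ℝ} (h : ∀ s : ℂ, a < s.re → f s = g s) (x : ℂ) : ∀ᶠ z in 𝓝[≠] x, f z = g z := by
  have hfg : Meromorphic fun z => f z - g z := hf.fun_sub hg
  have htop : meromorphicOrderAt (fun z => f z - g z) x = ⊤ := by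
    by_contra hx
    have hall := hfg.exists_meromorphicOrderAt_ne_top_iff_forall.1 ⟨x, hx⟩ ((a + 1 : ℝ) : ℂ)
    refine hall (meromorphicOrderAt_eq_top_iff.2 (eventually_nhdsWithin_of_eventually_nhds ?_))
    have hopen : IsOpen {z : ℂ | a < z.re} := isOpen_lt continuous_const Complex.continuous_re
    filter_upwards [hopen.mem_nhds (show a < (((a + 1 : ℝ) : ℂ)).re by simp)] with z hz
    rw [h z hz, sub_self]
  filter_upwards [meromorphicOrderAt_eq_top_iff.1 htop] with z hz
  exact sub_eq_zero.1 hz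

theorem Meromorphic.eventuallyEq_codiscrete {f g : ℂ → ℂ} (hf : Meromorphic f)
    (hg : Meromorphic g) {a : ℝ} (h : ∀ s : ℂ, a < s.re → f s = g s) :
    f =ᶠ[codiscrete ℂ] g := by
  refine mem_codiscrete.2 fun x => ?_
  rw [disjoint_principal_right, compl_compl]
  exact hf.eventually_eq_nhdsNE hg h x

theorem Meromorphic.eq_of_continuousAt {f g : ℂ → ℂ} (hf : Meromorphic f) (hg : Meromorphic g)
    {a : ℝ} (h : ∀ s : ℂ, a < s.re → f s = g s) {x : ℂ} (hfx : ContinuousAt f x)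
    (hgx : ContinuousAt g x) : f x = g x := by
  have h₁ : Tendsto f (𝓝[≠] x) (𝓝 (f x)) := hfx.tendsto.mono_left nhdsWithin_le_nhds
  have h₂ : Tendsto f (𝓝[≠] x) (𝓝 (g x)) :=
    (hgx.tendsto.mono_left nhdsWithin_le_nhds).congr'
      ((hf.eventually_eq_nhdsNE hg h x).mono fun z hz => hz.symm)
  exact tendsto_nhds_unique h₁ h₂

variable {n p : ℕ} [Fact p.Prime] {ψ : DirichletCharacter ℂ p} {k : ℤ}
  {Z : Matrix (Fin n) (Fin n) ℂ}

theorem heckeU_congr {f g : Matrix (Fin n) (Fin n) ℂ → ℂ}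
    (h : ∀ W ∈ siegelUpperHalfSpace n, f W = g W) (hZ : Z ∈ siegelUpperHalfSpace n) :
    heckeU n ψ k f Z = heckeU n ψ k g Z := by
  rw [heckeU, heckeU]
  congr 1
  refine finsum_congr fun c => ?_
  rw [siegelSlash, siegelSlash, h _ (siegelAction_heckeCosets_mem c hZ)]

theorem meromorphic_heckeU {F : Matrix (Fin n) (Fin n) ℂ → ℂ → ℂ}
    (hF : ∀ W ∈ siegelUpperHalfSpace n, Meromorphic (F W)) (hZ : Z ∈ siegelUpperHalfSpace n) :
    Meromorphic fun s => heckeU n ψ k (fun W => F W s) Z := by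
  have := Fintype.ofFinite (HeckeCosets n p)
  simp only [heckeU, finsum_eq_sum_of_fintype, siegelSlash]
  exact (Meromorphic.const _).fun_mul (Meromorphic.fun_sum fun c _ =>
    (Meromorphic.const _).fun_mul ((Meromorphic.const _).fun_mul
      (hF _ (siegelAction_heckeCosets_mem c hZ))))

theorem continuousAt_heckeU {F : Matrix (Fin n) (Fin n) ℂ → ℂ → ℂ} {s : ℂ}
    (hF : ∀ W ∈ siegelUpperHalfSpace n, ContinuousAt (F W) s) (hZ : Z ∈ siegelUpperHalfSpace n) :
    ContinuousAt (fun s => heckeU n ψ k (fun W => F W s) Z) s := by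
  have := Fintype.ofFinite (HeckeCosets n p)
  simp only [heckeU, finsum_eq_sum_of_fintype, siegelSlash]
  exact continuousAt_const.mul (tendsto_finsetSum _ fun c _ =>
    continuousAt_const.mul (continuousAt_const.mul
      (hF _ (siegelAction_heckeCosets_mem c hZ))))

/-- For fixed Z the operator U(p) is a finite sum over points of the upper half space that do not
depend on s. Both sides are therefore meromorphic in s, and continuous wherever all the
continuations are holomorphic. -/
theorem heckeU_continuation {i : ℕ} (hi : i ≤ n) {m : ℕ → ℂ → ℂ} {q : ℂ → ℂ}
    (hm : ∀ j, Differentiable ℂ (m j)) (hq : Differentiable ℂ q)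
    (h : ∀ s : ℂ, (n : ℝ) + 1 < 2 * s.re → ∀ Z ∈ siegelUpperHalfSpace n,
      heckeU n ψ k (fun W => siegelEisenstein n ψ k i W s) Z =
        q s * ∑ j ∈ Finset.Icc i n, m j s * siegelEisenstein n ψ k j Z s)
    {F : ℕ → Matrix (Fin n) (Fin n) ℂ → ℂ → ℂ} (hF : IsEisensteinContinuation n ψ k F) :
    (∀ Z ∈ siegelUpperHalfSpace n,
      (fun s : ℂ => heckeU n ψ k (fun W => F i W s) Z) =ᶠ[codiscrete ℂ]
        (fun s : ℂ => q s * ∑ j ∈ Finset.Icc i n, m j s * F j Z s)) ∧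
    (∀ s : ℂ, (∀ j ≤ n, ∀ W ∈ siegelUpperHalfSpace n, AnalyticAt ℂ (F j W) s) →
      ∀ Z ∈ siegelUpperHalfSpace n, heckeU n ψ k (fun W => F i W s) Z =
        q s * ∑ j ∈ Finset.Icc i n, m j s * F j Z s) := by
  have hmer : ∀ {f : ℂ → ℂ}, Differentiable ℂ f → Meromorphic f := fun hf x =>
    (hf.analyticAt x).meromorphicAt
  have h₁ : ∀ Z ∈ siegelUpperHalfSpace n,
      Meromorphic fun s : ℂ => heckeU n ψ k (fun W => F i W s) Z := fun Z hZ =>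
    meromorphic_heckeU (fun W hW => (hF i hi W hW).1) hZ
  have h₂ : ∀ Z ∈ siegelUpperHalfSpace n,
      Meromorphic fun s : ℂ => q s * ∑ j ∈ Finset.Icc i n, m j s * F j Z s := fun Z hZ =>
    (hmer hq).fun_mul (Meromorphic.fun_sum fun j hj =>
      (hmer (hm j)).fun_mul (hF j (Finset.mem_Icc.1 hj).2 Z hZ).1)
  have h₃ : ∀ Z ∈ siegelUpperHalfSpace n, ∀ s : ℂ, ((n : ℝ) + 1) / 2 < s.re →
      heckeU n ψ k (fun W => F i W s) Z = q s * ∑ j ∈ Finset.Icc i n, m j s * F j Z s := by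
    intro Z hZ s hs
    have hs' : (n : ℝ) + 1 < 2 * s.re := by linarith
    rw [heckeU_congr (fun W hW => (hF i hi W hW).2 s hs') hZ, h s hs' Z hZ]
    congr 1
    exact Finset.sum_congr rfl fun j hj => by rw [(hF j (Finset.mem_Icc.1 hj).2 Z hZ).2 s hs']
  refine ⟨fun Z hZ => (h₁ Z hZ).eventuallyEq_codiscrete (h₂ Z hZ) (h₃ Z hZ), fun s hs Z hZ => ?_⟩
  refine (h₁ Z hZ).eq_of_continuousAt (h₂ Z hZ) (h₃ Z hZ)
    (continuousAt_heckeU (fun W hW => (hs i hi W hW).continuousAt) hZ) ?_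
  exact hq.continuous.continuousAt.mul (tendsto_finsetSum _ fun j hj =>
    ((hm j).continuous.continuousAt.mul (hs j (Finset.mem_Icc.1 hj).2 Z hZ).continuousAt))

end Meromorphic

/-! ### The coefficients -/

section Coefficients

open Polynomial

variable {n p : ℕ} [Fact p.Prime] {ψ : DirichletCharacter ℂ p} {k : ℤ}

theorem card_mul_transferCoeff (hp : p ≠ 2) (hψ : ∀ x : ZMod p, x ≠ 0 → ψ x ^ 2 = 1) {i j : ℕ}
    (hij : i ≤ j) (hj : j ≤ n) :
    (p : ℂ) ^ (j * (j + 1) / 2) * transferCoeff ψ n i j =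
      (p : ℂ) ^ (n * (n + 1) / 2) * (weightPolynomial ψ j).coeff (j - i) := by
  obtain ⟨m, rfl⟩ := Nat.exists_eq_add_of_le hj
  have h := card_mul_sum_submatrix (j := j) (m := m) (R := ZMod p)
    fun S => (symmetricWeight ψ S).coeff (j - i)
  have h' : ∑ S : SymmetricMatrix (Fin j) (ZMod p), (symmetricWeight ψ S.1).coeff (j - i) =
      (weightPolynomial ψ j).coeff (j - i) := by
    rw [← Polynomial.finsetSum_coeff,
      sum_symmetric_weight hp hψ (isDiagonalWeight_symmetricWeight hψ j)]
  rw [h', card_symmetricMatrix, card_symmetricMatrix, ZMod.card] at h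
  rw [transferCoeff, dif_pos ⟨hij, hj⟩]
  exact_mod_cast h

theorem natCast_cpow_triangle (p j : ℕ) :
    (p : ℂ) ^ ((j : ℂ) * ((j : ℂ) + 1) / 2) = (p : ℂ) ^ (j * (j + 1) / 2) := by
  rw [← Complex.cpow_natCast]
  congr 1
  rw [Nat.cast_div (Nat.even_mul_succ_self j).two_dvd (by norm_num)]
  push_cast
  ring

/-- The coefficient of `E(w_j)` in `U(p) E(w_i)`, up to the common factor `p ^ (n (k / 2 - s))`. -/
noncomputable def heckeCoeff (ψ : DirichletCharacter ℂ p) (i j : ℕ) (s : ℂ) : ℂ :=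
  (p : ℂ) ^ (2 * s * (i : ℂ) - (j : ℂ) * ((j : ℂ) + 1) / 2) *
    (weightPolynomial ψ j).coeff (j - i)

/-- Bookkeeping of powers of p: the normalization of U(p) gives nk/2 - n(n+1)/2, the automorphy
terms give sn - 2sn + 2si, and extending leading j × j blocks to n × n matrices gives n(n+1)/2 -
j(j+1)/2. -/
theorem heckeU_eq_heckeCoeff (hp : p ≠ 2) (hψ : ∀ x : ZMod p, x ≠ 0 → ψ x ^ 2 = 1)
    (hk : ψ (-1) = (-1) ^ k) {i : ℕ} (hi : i ≤ n) {s : ℂ} (hs : (n : ℝ) + 1 < 2 * s.re)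
    {Z : Matrix (Fin n) (Fin n) ℂ} (hZ : Z ∈ siegelUpperHalfSpace n) :
    heckeU n ψ k (fun W => siegelEisenstein n ψ k i W s) Z =
      (p : ℂ) ^ ((n : ℂ) * ((k : ℂ) / 2 - s)) *
        ∑ j ∈ Finset.Icc i n, heckeCoeff ψ i j s * siegelEisenstein n ψ k j Z s := by
  have hs0 : 0 ≤ s.re := by
    have : (0 : ℝ) ≤ n := n.cast_nonneg
    linarith
  have hpos : (0 : ℝ) < p := mod_cast (Fact.out : p.Prime).pos
  have hp0 : (p : ℂ) ≠ 0 := by exact_mod_cast hpos.ne'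
  have h := heckeU_siegelEisenstein hp hψ hk hs0 hi hZ
  have hterm : ∀ a : ℕ, eisensteinTerm k s ((p : ℂ) ^ a) = (p : ℂ) ^ (-2 * s * a) := by
    intro a
    have : ((p : ℂ) ^ a) = (((p : ℝ) ^ a : ℝ) : ℂ) := by push_cast; rfl
    rw [this, eisensteinTerm_ofReal k s (by positivity), Complex.ofReal_pow, Complex.ofReal_natCast,
      ← Complex.natCast_cpow_natCast_mul]
    congr 1
    ring
  have hterm' : eisensteinTerm k s (((p : ℝ) ^ (-(n : ℝ) / 2) : ℝ) : ℂ) = (p : ℂ) ^ (s * n) := by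
    rw [eisensteinTerm_ofReal k s (by positivity), Complex.ofReal_cpow hpos.le,
      Complex.ofReal_natCast, ← Complex.cpow_mul]
    · congr 1; push_cast; ring
    · rw [← Complex.natCast_log, ← Complex.ofReal_mul, Complex.ofReal_im]
      linarith [Real.pi_pos]
    · rw [← Complex.natCast_log, ← Complex.ofReal_mul, Complex.ofReal_im]
      linarith [Real.pi_pos]
  have hpre : (((p : ℝ) ^ ((n : ℝ) * (k : ℝ) / 2 - (n : ℝ) * ((n : ℝ) + 1) / 2) : ℝ) : ℂ) =
      (p : ℂ) ^ ((n : ℂ) * (k : ℂ) / 2 - (n : ℂ) * ((n : ℂ) + 1) / 2) := by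
    rw [Complex.ofReal_cpow hpos.le]
    push_cast
    rfl
  rw [hterm, hterm, hterm', hpre] at h
  have hsub : ∑ j ∈ Finset.range (n + 1), transferCoeff ψ n i j * siegelEisenstein n ψ k j Z s =
      ∑ j ∈ Finset.Icc i n, transferCoeff ψ n i j * siegelEisenstein n ψ k j Z s := by
    symm
    refine Finset.sum_subset (fun j hj => ?_) fun j _ hj => ?_
    · rw [Finset.mem_Icc] at hj
      exact Finset.mem_range.2 (by omega)
    · rw [transferCoeff, dif_neg fun h => hj (Finset.mem_Icc.2 h), zero_mul]
  rw [hsub] at h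
  have hcoeff : ∀ j ∈ Finset.Icc i n, transferCoeff ψ n i j =
      (p : ℂ) ^ ((n : ℂ) * ((n : ℂ) + 1) / 2 - 2 * s * i) * heckeCoeff ψ i j s := by
    intro j hj
    rw [Finset.mem_Icc] at hj
    have h₁ := card_mul_transferCoeff (n := n) hp hψ hj.1 hj.2
    rw [← natCast_cpow_triangle, ← natCast_cpow_triangle] at h₁
    have h₂ : (p : ℂ) ^ ((j : ℂ) * ((j : ℂ) + 1) / 2) ≠ 0 := by
      simp [Complex.cpow_eq_zero_iff, hp0]
    apply mul_left_cancel₀ h₂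
    rw [h₁, heckeCoeff, ← mul_assoc, ← mul_assoc, ← Complex.cpow_add _ _ hp0,
      ← Complex.cpow_add _ _ hp0]
    congr 2
    ring
  rw [Finset.sum_congr rfl fun j hj => by rw [hcoeff j hj, mul_assoc], ← Finset.mul_sum] at h
  have h₃ : (p : ℂ) ^ (-2 * s * (i : ℂ)) ≠ 0 := by simp [Complex.cpow_eq_zero_iff, hp0]
  apply mul_left_cancel₀ h₃
  rw [h, ← mul_assoc, ← mul_assoc, ← mul_assoc ((p : ℂ) ^ (-2 * s * (i : ℂ))),
    ← Complex.cpow_add _ _ hp0, ← Complex.cpow_add _ _ hp0, ← Complex.cpow_add _ _ hp0,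
    ← Complex.cpow_add _ _ hp0]
  congr 2
  ring

theorem differentiable_natCast_cpow {a b : ℂ} (hp : p ≠ 0) :
    Differentiable ℂ fun s : ℂ => (p : ℂ) ^ (a * s + b) :=
  ((differentiable_id.const_mul a).add_const b).const_cpow (Or.inl (Nat.cast_ne_zero.2 hp))

theorem differentiable_heckeCoeff (i j : ℕ) : Differentiable ℂ (heckeCoeff ψ i j) := by
  have h : heckeCoeff ψ i j = fun s => (p : ℂ) ^ (2 * (i : ℂ) * s + -((j : ℂ) * ((j : ℂ) + 1) / 2)) *
      (weightPolynomial ψ j).coeff (j - i) := by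
    funext s
    rw [heckeCoeff]
    congr 2
    ring
  rw [h]
  exact (differentiable_natCast_cpow (Fact.out : p.Prime).ne_zero).mul_const _

theorem evenProd_ne_zero (h : ℕ) : evenProd (p : ℂ) h ≠ 0 := by
  refine Finset.prod_ne_zero_iff.2 fun i _ => sub_ne_zero.2 ?_
  have : 1 < p ^ (2 * (i + 1)) := Nat.one_lt_pow (by omega) (Fact.out : p.Prime).one_lt
  exact_mod_cast this.ne'

theorem evenProd_eq (q : ℂ) (h : ℕ) : evenProd q h = ∏ r ∈ Finset.Icc 1 h, (q ^ (2 * r) - 1) := by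
  rw [evenProd, Finset.prod_bij' (fun i _ => i + 1) (fun r _ => r - 1)] <;>
    simp <;> omega

theorem fallingProd_eq (q : ℂ) {i j : ℕ} (hij : i ≤ j) :
    fallingProd q j (j - i) = ∏ r ∈ Finset.Icc (i + 1) j, (q ^ r - 1) := by
  rw [fallingProd, Finset.prod_bij' (fun l _ => j - l) (fun r _ => j - r)] <;>
    simp <;> omega

end Coefficients

/-! ### The trivial and the quadratic character -/

section Characters

variable {p : ℕ} [Fact p.Prime]

theorem trivialCharacter_sq (x : ZMod p) (hx : x ≠ 0) :
    (1 : DirichletCharacter ℂ p) x ^ 2 = 1 := by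
  rw [MulChar.one_apply (isUnit_iff_ne_zero.2 hx), one_pow]

theorem sum_trivialCharacter : ∑ a, (1 : DirichletCharacter ℂ p) a = (p : ℂ) - 1 := by
  rw [MulChar.sum_one_eq_card_units, ZMod.card_units, Nat.cast_sub (Fact.out : p.Prime).one_le,
    Nat.cast_one]

theorem quadraticDirichletCharacter_sq (x : ZMod p) (hx : x ≠ 0) :
    quadraticDirichletCharacter p x ^ 2 = 1 := by
  rw [quadraticDirichletCharacter, MulChar.ringHomComp_apply, ← map_pow, quadraticChar_sq_one hx,
    map_one]

theorem sum_quadraticDirichletCharacter (hp : p ≠ 2) :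
    ∑ a, quadraticDirichletCharacter p a = 0 := by
  simp only [quadraticDirichletCharacter, MulChar.ringHomComp_apply]
  rw [← map_sum, quadraticChar_sum_zero (by rwa [ZMod.ringChar_zmod_n]), map_zero]

theorem heckeCoeff_eq_of_coeff {ψ : DirichletCharacter ℂ p} {i j h e : ℕ} (hij : i ≤ j) {c a : ℂ}
    (ha : a = e)
    (hc : (weightPolynomial ψ j).coeff (j - i) * evenProd p h =
      c * (p : ℂ) ^ e * fallingProd p j (j - i)) (s : ℂ) :
    heckeCoeff ψ i j s = c * (p : ℂ) ^ (2 * s * (i : ℂ) - (j : ℂ) * ((j : ℂ) + 1) / 2 + a) *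
      ((∏ r ∈ Finset.Icc (i + 1) j, ((p : ℂ) ^ r - 1)) /
        ∏ r ∈ Finset.Icc 1 h, ((p : ℂ) ^ (2 * r) - 1)) := by
  have hp0 : (p : ℂ) ≠ 0 := Nat.cast_ne_zero.2 (Fact.out : p.Prime).ne_zero
  rw [heckeCoeff, eq_div_of_mul_eq (evenProd_ne_zero h) hc, ← fallingProd_eq _ hij, ← evenProd_eq,
    Complex.cpow_add _ _ hp0, ha, Complex.cpow_natCast]
  ring

/-- For j - i = 2h and for j - i = 2h + 1 alike, the additional exponent in the definition of
`mTrivial` equals h(h + 1). -/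
theorem mTrivial_eq_heckeCoeff {i j : ℕ} (hij : i ≤ j) (s : ℂ) :
    mTrivial p s i j = heckeCoeff (1 : DirichletCharacter ℂ p) i j s := by
  have hc := weightPolynomial_coeff_trivial (ψ := (1 : DirichletCharacter ℂ p))
    (MulChar.one_apply isUnit_one.neg) sum_trivialCharacter j
  rw [mTrivial, if_neg hij.not_gt]
  obtain ⟨h, hh⟩ | ⟨h, hh⟩ := Nat.even_or_odd (j - i)
  · have hj : (j : ℂ) = i + 2 * h := by
      exact_mod_cast (by omega : j = i + 2 * h)
    rw [if_pos ⟨h, hh⟩, show (j - i) / 2 = h by omega, heckeCoeff_eq_of_coeff (c := 1) (h := h)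
      (e := h * (h + 1)) hij (a := ((j : ℂ) - i) * ((j : ℂ) - i + 2) / 4), one_mul]
    · rw [hj]; push_cast; ring
    · rw [show j - i = 2 * h by omega, one_mul, (hc h).1]
  · have hj : (j : ℂ) = i + 2 * h + 1 := by
      exact_mod_cast (by omega : j = i + 2 * h + 1)
    rw [if_neg (Nat.not_even_iff_odd.2 ⟨h, hh⟩), show (j - i - 1) / 2 = h by omega,
      heckeCoeff_eq_of_coeff (c := 1) (h := h) (e := h * (h + 1)) hij
        (a := (((j : ℂ) - i) ^ 2 - 1) / 4), one_mul]
    · rw [hj]; push_cast; ring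
    · rw [show j - i = 2 * h + 1 by omega, one_mul, (hc h).2]

theorem mQuadratic_eq_heckeCoeff (hp : p ≠ 2) {i j : ℕ} (hij : i ≤ j) (s : ℂ) :
    mQuadratic p s i j = heckeCoeff (quadraticDirichletCharacter p) i j s := by
  have hc := weightPolynomial_coeff_quadratic (sum_quadraticDirichletCharacter hp) j
  obtain ⟨h, hh⟩ | ⟨h, hh⟩ := Nat.even_or_odd (j - i)
  · have hj : (j : ℂ) = i + 2 * h := by
      exact_mod_cast (by omega : j = i + 2 * h)
    rw [mQuadratic, if_pos ⟨hij, h, hh⟩, show (j - i) / 2 = h by omega,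
      heckeCoeff_eq_of_coeff (c := quadraticDirichletCharacter p (-1) ^ h) (h := h) (e := h ^ 2) hij
        (a := ((j : ℂ) - i) ^ 2 / 4)]
    · rw [hj]; push_cast; ring
    · rw [show j - i = 2 * h by omega, (hc h).1]
  · rw [mQuadratic, if_neg fun H => Nat.not_even_iff_odd.2 ⟨h, hh⟩ H.2, heckeCoeff, hh, (hc h).2,
      mul_zero]

theorem sum_mTrivial (n i : ℕ) (s : ℂ) (x : ℕ → ℂ) :
    ∑ j ∈ Finset.Icc i n, mTrivial p s i j * x j =
      ∑ j ∈ Finset.Icc i n, heckeCoeff (1 : DirichletCharacter ℂ p) i j s * x j :=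
  Finset.sum_congr rfl fun j hj => by rw [mTrivial_eq_heckeCoeff (Finset.mem_Icc.1 hj).1]

theorem sum_mQuadratic (hp : p ≠ 2) (n i : ℕ) (s : ℂ) (x : ℕ → ℂ) :
    ∑ j ∈ Finset.Icc i n with j ≡ i [MOD 2], mQuadratic p s i j * x j =
      ∑ j ∈ Finset.Icc i n, heckeCoeff (quadraticDirichletCharacter p) i j s * x j := by
  rw [Finset.sum_filter]
  refine Finset.sum_congr rfl fun j hj => ?_
  have hij := (Finset.mem_Icc.1 hj).1
  rw [← mQuadratic_eq_heckeCoeff hp hij]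
  split_ifs with h
  · rfl
  · rw [mQuadratic, if_neg, zero_mul]
    rintro ⟨-, m, hm⟩
    exact h (by rw [Nat.ModEq]; omega)

theorem differentiable_heckeFactor (n : ℕ) (k : ℤ) :
    Differentiable ℂ fun s : ℂ => (p : ℂ) ^ ((n : ℂ) * ((k : ℂ) / 2 - s)) := by
  have h : (fun s : ℂ => (p : ℂ) ^ ((n : ℂ) * ((k : ℂ) / 2 - s))) =
      fun s => (p : ℂ) ^ (-(n : ℂ) * s + (n : ℂ) * ((k : ℂ) / 2)) := by
    funext s
    congr 1
    ring
  rw [h]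
  exact differentiable_natCast_cpow (Fact.out : p.Prime).ne_zero

end Characters

/-! ### The theorem -/

theorem mainTheorem5 (p : ℕ) [Fact p.Prime] (hp : p ≠ 2) (n : ℕ) (k : ℤ) :
    -- the trivial character
    ((1 : DirichletCharacter ℂ p) (-1) = (-1 : ℂ) ^ k →
      ∀ i ≤ n,
        -- the region of absolute convergence
        (∀ s : ℂ, (n : ℝ) + 1 < 2 * s.re → ∀ Z ∈ siegelUpperHalfSpace n,
          heckeU n (1 : DirichletCharacter ℂ p) k
              (fun W => siegelEisenstein n (1 : DirichletCharacter ℂ p) k i W s) Z =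
            (p : ℂ) ^ ((n : ℂ) * ((k : ℂ) / 2 - s)) *
              ∑ j ∈ Finset.Icc i n,
                mTrivial p s i j * siegelEisenstein n (1 : DirichletCharacter ℂ p) k j Z s) ∧
        -- the meromorphic continuation to the whole plane
        (∀ F : ℕ → Matrix (Fin n) (Fin n) ℂ → ℂ → ℂ,
          IsEisensteinContinuation n (1 : DirichletCharacter ℂ p) k F →
          (∀ Z ∈ siegelUpperHalfSpace n,
            (fun s : ℂ => heckeU n (1 : DirichletCharacter ℂ p) k (fun W => F i W s) Z)
              =ᶠ[Filter.codiscrete ℂ]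
            (fun s : ℂ => (p : ℂ) ^ ((n : ℂ) * ((k : ℂ) / 2 - s)) *
              ∑ j ∈ Finset.Icc i n, mTrivial p s i j * F j Z s)) ∧
          (∀ s : ℂ,
            (∀ j ≤ n, ∀ W ∈ siegelUpperHalfSpace n, AnalyticAt ℂ (F j W) s) →
            ∀ Z ∈ siegelUpperHalfSpace n,
              heckeU n (1 : DirichletCharacter ℂ p) k (fun W => F i W s) Z =
                (p : ℂ) ^ ((n : ℂ) * ((k : ℂ) / 2 - s)) *
                  ∑ j ∈ Finset.Icc i n, mTrivial p s i j * F j Z s))) ∧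
    -- the quadratic character
    (quadraticDirichletCharacter p (-1) = (-1 : ℂ) ^ k →
      ∀ i ≤ n,
        -- the region of absolute convergence
        (∀ s : ℂ, (n : ℝ) + 1 < 2 * s.re → ∀ Z ∈ siegelUpperHalfSpace n,
          heckeU n (quadraticDirichletCharacter p) k
              (fun W => siegelEisenstein n (quadraticDirichletCharacter p) k i W s) Z =
            (p : ℂ) ^ ((n : ℂ) * ((k : ℂ) / 2 - s)) *
              ∑ j ∈ Finset.Icc i n with j ≡ i [MOD 2],
                mQuadratic p s i j *
                  siegelEisenstein n (quadraticDirichletCharacter p) k j Z s) ∧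
        -- the meromorphic continuation to the whole plane
        (∀ F : ℕ → Matrix (Fin n) (Fin n) ℂ → ℂ → ℂ,
          IsEisensteinContinuation n (quadraticDirichletCharacter p) k F →
          (∀ Z ∈ siegelUpperHalfSpace n,
            (fun s : ℂ => heckeU n (quadraticDirichletCharacter p) k (fun W => F i W s) Z)
              =ᶠ[Filter.codiscrete ℂ]
            (fun s : ℂ => (p : ℂ) ^ ((n : ℂ) * ((k : ℂ) / 2 - s)) *
              ∑ j ∈ Finset.Icc i n with j ≡ i [MOD 2], mQuadratic p s i j * F j Z s)) ∧
          (∀ s : ℂ,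
            (∀ j ≤ n, ∀ W ∈ siegelUpperHalfSpace n, AnalyticAt ℂ (F j W) s) →
            ∀ Z ∈ siegelUpperHalfSpace n,
              heckeU n (quadraticDirichletCharacter p) k (fun W => F i W s) Z =
                (p : ℂ) ^ ((n : ℂ) * ((k : ℂ) / 2 - s)) *
                  ∑ j ∈ Finset.Icc i n with j ≡ i [MOD 2], mQuadratic p s i j * F j Z s))) := by
  simp only [sum_mTrivial, sum_mQuadratic hp]
  refine ⟨fun hk i hi => ?_, fun hk i hi => ?_⟩
  · have h : ∀ s : ℂ, (n : ℝ) + 1 < 2 * s.re → ∀ Z ∈ siegelUpperHalfSpace n, _ := fun s hs Z hZ =>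
      heckeU_eq_heckeCoeff hp trivialCharacter_sq hk hi hs hZ
    exact ⟨h, fun F hF => heckeU_continuation hi (fun j => differentiable_heckeCoeff i j)
      (differentiable_heckeFactor n k) h hF⟩
  · have h : ∀ s : ℂ, (n : ℝ) + 1 < 2 * s.re → ∀ Z ∈ siegelUpperHalfSpace n, _ := fun s hs Z hZ =>
      heckeU_eq_heckeCoeff hp quadraticDirichletCharacter_sq hk hi hs hZ
    exact ⟨h, fun F hF => heckeU_continuation hi (fun j => differentiable_heckeCoeff i j)
      (differentiable_heckeFactor n k) h hF⟩
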